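/- **Setting.** Let $k,l\ge1$ and let $J:\mathbb R^l\to\mathrm{End}(\mathbb R^k)$ be linear with every $J_Z$ skew-symmetric and $J_Z^2=-|Z|^2\,\mathrm{id}$ (a Heisenberg-type algebra $\mathbb R^k\times\mathbb R^l\ni(X,Z)$). Let $0<R_X\le\infty$, let $R$ be a positive smooth function on $\{t\in[0,\infty): t<R_X^2\}$, and let $$M=\{(X,Z): |X|<R_X,\ |Z|<R(|X|^2)\}.$$ Fix a boundary condition $a\,u+b\,\partial_r u=0$ with constants $a,b\ge0$, $a+b>0$ (Dirichlet: $b=0$; Neumann: $a=0$; mixed: $a,b>0$), and $s\ge0$, where $s\le1$ if $l=1$. The $s$-th order spectrum of the ball $B_r\subset\mathbb R^l$ consists of the numbers $\lambda$ for which $-\Delta u=\lambda u$ has a non-zero solution on $B_r$, of class $C^2$ up to the boundary, of the form $y(|Z|)\,h(Z/|Z|)$ with $h$ a spherical harmonic of order $s$, that satisfies the boundary condition on $|Z|=r$. Let $\lambda^{(s)}_i(t)$ be its $i$-th element in increasing order for $r=R(t)$. For $Q\in\mathbb R^k$ and $u\in\mathbb R^l$, $|u|=1$, put $\Theta_Q(X,u)=\langle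 Q+\mathbf iJ_u(Q),X\rangle$. Let $\mathbf B=(B_1,\dots,B_m)$ be any finite system of vectors of $\mathbb R^k$ (one pole: $m=1$, $B_1=Q$; multipole: $m=k/2$). For $n\ge0$ and exponents with $\sum_j(p_j+q_j)=n$ put $T_{p,q}=\prod_j\Theta_{B_j}^{p_j}\overline\Theta_{B_j}^{q_j}$. Let $\Pi_X^{(n)}$ be the projection of $n$-homogeneous polynomials in $X$ to harmonic ones along multiples of $|X|^2$, and $\Pi_K^{(s)}$ the projection of polynomials restricted to the unit sphere of $\mathbb R^l$ to spherical harmonics of order $s$. Let $\mathcal P_\Phi$ be the set of all functions $P(X,u)=\Pi_K^{(s)}(\beta\,T_{p,q})(X,u)$ and $\mathcal P_\Xi$ the set of all $P(X,u)=\Pi_K^{(s)}(\beta\,\Pi_X^{(n)}T_{p,q})(X,u)$, where $\beta$ runs through the homogeneous polynomials on $\mathbb R^l$ of all degrees and $(p,q)$ through the exponents with $\sum_j(p_j+q_j)=n$. For $\mu$ the Lebesgue measure on $M$, let $\mathbf\Phi^{(n,s)}_{\mathbf B}(\mu)$ (resp. $\mathbf\Xi^{(n,s)}_{\mathbf B}(\mu)$)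 be the closed subspace of $L^2(\mu)$ spanned by the restrictions, as far as they are in $L^2(\mu)$, of the Z-Fourier transforms $$\int_{\mathbb R^l}e^{\mathbf i\langle Z,K\rangle}\phi(|X|,|K|)\,P(X,K/|K|)\,dK,\qquad P\in\mathcal P_\Phi\ (\text{resp. }\mathcal P_\Xi),$$ where $\phi$ is measurable and $K\mapsto\phi(|X|,|K|)$ is integrable and square integrable for each $|X|$. This is $\mathbf\Phi^{(n,s)}_{\mathbf B}(M)$ (resp. $\mathbf\Xi^{(n,s)}_{\mathbf B}(M)$). The same definition is used over one point $X$, $|X|<R_X$, with $\mu$ the Lebesgue measure of the ball $\{X\}\times B_{R(|X|^2)}$. **Theorem.** 1. For every $i$ the eigenvalue $\lambda_i^{(s)}(t)$ exists for all $0\le t<R_X^2$, and it is a smooth function of $t$. 2. For every $i$, every function $\phi:\mathbb R\to\mathbb C$ and every $P\in\mathcal P_\Phi\cup\mathcal P_\Xi$, the function $$F(X,Z)=\oint_{S_{\sqrt{\lambda}}}e^{\mathbf i\langle Z,K\rangle}\phi(|X|^2)\,P(X,K/|K|)\,dK_{no},\qquad \lambda=\lambda^{(s)}_i(|X|^2),$$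 with $dK_{no}$ the normalized measure of the sphere (for $\lambda=0$ the integral is read by $K=\sqrt\lambda\,u$ as an average over unit vectors $u$), satisfies for each $X$ with $|X|<R_X$ the given condition $aF+b\,\partial_{|Z|}F=0$ on $|Z|=R(|X|^2)$; for $b=0$, $a=0$ and $a,b>0$ this is the Dirichlet, the Z-Neumann and the mixed condition. If $b=0$ and $\phi(R_X^2)=0$ (no requirement if $R_X=\infty$), then $F=0$ on all of $\partial M$. 3. Let $\mathcal A$ be any class of measurable functions $\phi:\mathbb R\to\mathbb C$ that contains all smooth functions with compact support in $\{t<R_X^2\}$. For each fixed boundary condition, the functions $F$ formed with all $i$, all $\phi\in\mathcal A$ and all $P\in\mathcal P_\Phi$ (resp. $P\in\mathcal P_\Xi$), as far as their restrictions are in $L^2(\mu)$, have closed span $\mathbf\Phi^{(n,s)}_{\mathbf B}(\mu)$ (resp. $\mathbf\Xi^{(n,s)}_{\mathbf B}(\mu)$) in $L^2(\mu)$, both for the Lebesgue measure $\mu$ on $M$ and for the Lebesgue measure of the Z-ball over each single point $X$ with $|X|<R_X$. -/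

import Mathlib

open MeasureTheory Set
open scoped ContDiff ENNReal

noncomputable section

namespace ZBall

/-- The Euclidean space `ℝᵈ`. -/
abbrev Euc (d : ℕ) := EuclideanSpace ℝ (Fin d)

/-- The skew endomorphisms `J_Z` (`Z ∈ ℝˡ`) of `ℝᵏ` of a Heisenberg-type Lie algebra
`ℝᵏ × ℝˡ`: linear in `Z`, skew-symmetric, and subject to `J_Z² = -|Z|² id`. -/
structure HTypeStructure (k l : ℕ) where
  J : Euc l →ₗ[ℝ] Euc k →ₗ[ℝ] Euc k
  skew : ∀ Z X Y, inner ℝ (J Z X) Y = -inner ℝ X (J Z Y)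
  clifford : ∀ Z X, J Z (J Z X) = -(‖Z‖ ^ 2) • X

/-! ### Spherical harmonics and harmonic projections -/

/-- Value of a complex polynomial in `d` variables at a point of `ℝᵈ`. -/
def evalAt {d : ℕ} (x : Euc d) (P : MvPolynomial (Fin d) ℂ) : ℂ :=
  MvPolynomial.eval (fun i => (x i : ℂ)) P

/-- Homogeneous harmonic polynomials of degree `s` in `d` real variables. Their restrictions to
the unit sphere are the spherical harmonics of order `s`. -/
def IsHarmonicPoly {d : ℕ} (s : ℕ) (P : MvPolynomial (Fin d) ℂ) : Prop :=
  P.IsHomogeneous s ∧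
    ∑ i, MvPolynomial.pderiv i (MvPolynomial.pderiv i P) = 0

/-- `H` is a decomposition of the function `f` on the unit sphere into spherical harmonics:
`f(u) = ∑ⱼ Hⱼ(u)` for `|u| = 1`, where `Hⱼ` is a homogeneous harmonic polynomial of degree `j`.
Every restriction of a polynomial to the unit sphere has exactly one such decomposition. -/
def IsHarmonicDecomposition {d : ℕ} (f : Euc d → ℂ) (H : ℕ →₀ MvPolynomial (Fin d) ℂ) : Prop :=
  (∀ j, IsHarmonicPoly j (H j)) ∧
    ∀ u : Euc d, ‖u‖ = 1 → f u = H.sum fun _ h => evalAt u h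

open Classical in
/-- The projection `Π⁽ˢ⁾` to harmonic polynomials of degree `s`: the degree `s` term of the
decomposition of `f` on the unit sphere into spherical harmonics. (For a homogeneous polynomial
`f` of degree `n` and `s = n` this is the harmonic polynomial that differs from `f` by a multiple
of `|x|²`.) -/
def harmProj {d : ℕ} (s : ℕ) (f : Euc d → ℂ) : MvPolynomial (Fin d) ℂ :=
  if h : ∃ H, IsHarmonicDecomposition f H then h.choose s else 0

/-! ### Boundary conditions and eigenvalues of a Euclidean ball -/

/-- A homogeneous condition `a u + b ∂u/∂r = 0` with constants `a, b ≥ 0`, not both zero. -/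
structure BoundaryCondition where
  a : ℝ
  b : ℝ
  a_nonneg : 0 ≤ a
  b_nonneg : 0 ≤ b
  pos : 0 < a + b

/-- The Dirichlet condition `u = 0`. -/
def BoundaryCondition.dirichlet : BoundaryCondition :=
  ⟨1, 0, zero_le_one, le_rfl, by norm_num⟩

/-- The Neumann condition `∂u/∂r = 0`. -/
def BoundaryCondition.neumann : BoundaryCondition :=
  ⟨0, 1, le_rfl, zero_le_one, by norm_num⟩

/-- `u` has a radial derivative at every point of the sphere of radius `r` and satisfies the
boundary condition there. -/
def BoundaryCondition.HoldsOn {l : ℕ} (bc : BoundaryCondition) (r : ℝ) (u : Euc l → ℂ) : Prop :=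
  ∀ v : Euc l, ‖v‖ = 1 → ∃ u' : ℂ,
    HasDerivAt (fun t : ℝ => u (t • v)) u' r ∧ (bc.a : ℂ) * u (r • v) + (bc.b : ℂ) * u' = 0

/-- `lam` belongs to the `s`-th order spectrum of the ball of radius `r` in `ℝˡ`: there is a
nonzero eigenfunction `-Δu = lam u` of the form (radial function) × (spherical harmonic of
order `s`) that satisfies the boundary condition. -/
def IsEigenvalue (l s : ℕ) (bc : BoundaryCondition) (r lam : ℝ) : Prop :=
  ∃ (u : Euc l → ℂ) (y : ℝ → ℂ) (h : MvPolynomial (Fin l) ℂ),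
    IsHarmonicPoly s h ∧
    (∀ z ∈ Metric.closedBall (0 : Euc l) r, u z = y ‖z‖ * evalAt (‖z‖⁻¹ • z) h) ∧
    (∀ z ∈ Metric.closedBall (0 : Euc l) r, ContDiffAt ℝ 2 u z) ∧
    (∃ z ∈ Metric.ball (0 : Euc l) r, u z ≠ 0) ∧
    (∀ z ∈ Metric.ball (0 : Euc l) r, -Laplacian.laplacian u z = (lam : ℂ) * u z) ∧
    bc.HoldsOn r u

/-- `lam` is an eigenvalue of order `s` with exactly `i` eigenvalues of order `s` below it
(so the indices `i = 0, 1, 2, …` enumerate the `s`-th order spectrum in increasing order). -/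
def IsNthEigenvalue (l s : ℕ) (bc : BoundaryCondition) (i : ℕ) (r lam : ℝ) : Prop :=
  IsEigenvalue l s bc r lam ∧ {μ | IsEigenvalue l s bc r μ ∧ μ < lam}.encard = i

/-- The `i`-th eigenvalue (`i = 0, 1, 2, …`) in the `s`-th order spectrum of the ball of radius
`r` in `ℝˡ`. -/
def eigenvalue (l s : ℕ) (bc : BoundaryCondition) (i : ℕ) (r : ℝ) : ℝ :=
  sInf {lam | IsNthEigenvalue l s bc i r lam}

/-! ### Ball × ball-type domains -/

/-- The values of `|X|²` for `X` in the open X-ball of radius `RX ∈ (0, ∞]`. -/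
def baseSet (RX : ℝ≥0∞) : Set ℝ := {t | 0 ≤ t ∧ ENNReal.ofReal t < RX ^ 2}

/-- The domain of all `(X, Z)` with `|X| < RX` and `|Z| < R(|X|²)`. -/
def domain (k l : ℕ) (RX : ℝ≥0∞) (R : ℝ → ℝ) : Set (Euc k × Euc l) :=
  {w | ‖w.1‖ₑ < RX ∧ ‖w.2‖ < R (‖w.1‖ ^ 2)}

/-- Lebesgue measure on the domain. -/
def domainMeasure (k l : ℕ) (RX : ℝ≥0∞) (R : ℝ → ℝ) : Measure (Euc k × Euc l) :=
  volume.restrict (domain k l RX R)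

/-- Lebesgue measure of the Z-ball of the domain over one point `X`. -/
def fibreMeasure {k : ℕ} (l : ℕ) (R : ℝ → ℝ) (X : Euc k) : Measure (Euc k × Euc l) :=
  (Measure.dirac X).prod (volume.restrict (Metric.ball (0 : Euc l) (R (‖X‖ ^ 2))))

/-! ### Twisting polynomials -/

section Twisting

variable {k l m : ℕ} (S : HTypeStructure k l)

/-- `Θ_Q(X, u) = ⟨Q + i J_u(Q), X⟩`. -/
def theta (Q X : Euc k) (u : Euc l) : ℂ :=
  (inner ℝ Q X : ℂ) + Complex.I * (inner ℝ (S.J u Q) X : ℂ)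

/-- `∏ᵢ Θ_{Bᵢ}(X, u)^{pᵢ} · conj Θ_{Bᵢ}(X, u)^{qᵢ}`. For a single pole (`m = 1`, `B = Q`) this
is `Θ_Qᵖ · conj Θ_Q^q`. -/
def twist (B : Fin m → Euc k) (p q : Fin m → ℕ) (X : Euc k) (u : Euc l) : ℂ :=
  ∏ i, theta S (B i) X u ^ p i * (starRingEnd ℂ) (theta S (B i) X u) ^ q i

/-- `Π_X⁽ⁿ⁾` of the twisting polynomial: the harmonic projection in `X`, for fixed `u`. -/
def harmTwist (n : ℕ) (B : Fin m → Euc k) (p q : Fin m → ℕ) (X : Euc k) (u : Euc l) : ℂ :=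
  evalAt X (harmProj n fun Y => twist S B p q Y u)

/-- `(X, u) ↦ Π_K⁽ˢ⁾(β · G)(X, u)`: the projection to spherical harmonics of order `s` in the
variable `u`, for fixed `X`. -/
def projSymbol (s : ℕ) (β : MvPolynomial (Fin l) ℂ) (G : Euc k → Euc l → ℂ)
    (X : Euc k) (u : Euc l) : ℂ :=
  evalAt u (harmProj s fun v => evalAt v β * G X v)

/-- All `Π_K⁽ˢ⁾(β ∏ Θ^{pᵢ} conj Θ^{qᵢ})` with `∑ (pᵢ + qᵢ) = n` and `β` a homogeneous polynomial. -/
def phiSymbols (n s : ℕ) (B : Fin m → Euc k) : Set (Euc k → Euc l → ℂ) :=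
  {P | ∃ (p q : Fin m → ℕ) (d : ℕ) (β : MvPolynomial (Fin l) ℂ),
    ∑ i, (p i + q i) = n ∧ β.IsHomogeneous d ∧ P = projSymbol s β (twist S B p q)}

/-- All `Π_K⁽ˢ⁾(β Π_X⁽ⁿ⁾(∏ Θ^{pᵢ} conj Θ^{qᵢ}))` with `∑ (pᵢ + qᵢ) = n` and `β` a homogeneous
polynomial. -/
def xiSymbols (n s : ℕ) (B : Fin m → Euc k) : Set (Euc k → Euc l → ℂ) :=
  {P | ∃ (p q : Fin m → ℕ) (d : ℕ) (β : MvPolynomial (Fin l) ℂ),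
    ∑ i, (p i + q i) = n ∧ β.IsHomogeneous d ∧ P = projSymbol s β (harmTwist S n B p q)}

end Twisting

/-! ### Twisted Z-Fourier transforms and the spaces they span -/

section Transforms

variable {k l : ℕ}

/-- `∮ e^{i⟨Z, K⟩} φ(|X|²) P(X, K/|K|) dK` over the sphere of radius `√(lam |X|²)` with its
normalized measure, written as an average over the unit sphere by `K = √lam · u` (so that a
sphere of radius `0` causes no exception). -/
def sphereTransform (lam : ℝ → ℝ) (φ : ℝ → ℂ) (P : Euc k → Euc l → ℂ) (w : Euc k × Euc l) : ℂ :=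
  ⨍ u : Metric.sphere (0 : Euc l) 1,
    Complex.exp (Complex.I * (inner ℝ w.2 (Real.sqrt (lam (‖w.1‖ ^ 2)) • (u : Euc l)) : ℝ)) *
      φ (‖w.1‖ ^ 2) * P w.1 u ∂((volume : Measure (Euc l)).toSphere)

/-- `∫ e^{i⟨Z, K⟩} φ(|X|, |K|) P(X, K/|K|) dK` over the whole Z-space. -/
def zFourier (φ : ℝ → ℝ → ℂ) (P : Euc k → Euc l → ℂ) (w : Euc k × Euc l) : ℂ :=
  ∫ K : Euc l, Complex.exp (Complex.I * (inner ℝ w.2 K : ℝ)) *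
    φ ‖w.1‖ ‖K‖ * P w.1 (‖K‖⁻¹ • K)

/-- Profiles `φ(|X|, |K|)` that are, for each fixed `|X|`, integrable and square integrable
functions of `K ∈ ℝˡ`. -/
def IsProfile (l : ℕ) (φ : ℝ → ℝ → ℂ) : Prop :=
  Measurable (Function.uncurry φ) ∧
    ∀ x, Integrable (fun K : Euc l => φ x ‖K‖) ∧ MemLp (fun K : Euc l => φ x ‖K‖) 2

/-- The closed subspace of `L²(μ)` spanned by the square integrable functions in a set. -/
def closedSpan (μ : Measure (Euc k × Euc l)) (A : Set (Euc k × Euc l → ℂ)) :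
    Submodule ℂ (Lp ℂ 2 μ) :=
  (Submodule.span ℂ {g | ∃ (F : Euc k × Euc l → ℂ) (hF : MemLp F 2 μ),
    F ∈ A ∧ g = hF.toLp F}).topologicalClosure

/-- The `L²(μ)`-space of the `s`-th order twisted Hankel functions: Z-Fourier transforms of the
functions `φ(|X|, |K|) P(X, K/|K|)` with `P` in the given set of symbols. -/
def hankelSpace (μ : Measure (Euc k × Euc l)) (Ps : Set (Euc k → Euc l → ℂ)) :
    Submodule ℂ (Lp ℂ 2 μ) :=
  closedSpan μ {F | ∃ φ, IsProfile l φ ∧ ∃ P ∈ Ps, F = zFourier φ P}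

/-- `Φ_B⁽ⁿ'ˢ⁾` on the domain (or on one fibre), according to the measure `μ`. -/
def PhiSpace {m : ℕ} (S : HTypeStructure k l) (n s : ℕ) (B : Fin m → Euc k)
    (μ : Measure (Euc k × Euc l)) : Submodule ℂ (Lp ℂ 2 μ) :=
  hankelSpace μ (phiSymbols S n s B)

/-- `Ξ_B⁽ⁿ'ˢ⁾` on the domain (or on one fibre), according to the measure `μ`. -/
def XiSpace {m : ℕ} (S : HTypeStructure k l) (n s : ℕ) (B : Fin m → Euc k)
    (μ : Measure (Euc k × Euc l)) : Submodule ℂ (Lp ℂ 2 μ) :=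
  hankelSpace μ (xiSymbols S n s B)

/-- The closed span in `L²(μ)` of the twisted functions
`∮ e^{i⟨Z, K⟩} φ(|X|²) P(X, K/|K|) dK` over the spheres of radius `√λᵢ(|X|²)`, where
`λᵢ(t)` is the `i`-th eigenvalue of order `s` of the ball of radius `R t`, for all `i`,
all `φ` in the class `𝒜`, and all symbols `P` in `Ps`. -/
def twistedSpan (s : ℕ) (bc : BoundaryCondition) (R : ℝ → ℝ) (𝒜 : Set (ℝ → ℂ))
    (Ps : Set (Euc k → Euc l → ℂ)) (μ : Measure (Euc k × Euc l)) : Submodule ℂ (Lp ℂ 2 μ) :=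
  closedSpan μ {F | ∃ i : ℕ, ∃ φ ∈ 𝒜, ∃ P ∈ Ps,
    F = sphereTransform (fun t => eigenvalue l s bc i (R t)) φ P}

end Transforms

end ZBall

end

/-! Write `E` for `bessel p` with `p = l - 1 + 2s`: the power series with `E(0) = 1` that solves
`4tE'' + 2(p+1)E' + E = 0`. Equivalently, `x ↦ E(λx²)` is the regular solution of `(xᵖ u')' = -λ xᵖ
u`. Everything reduces to this one function. For fixed `X` every admissible symbol `P(X, ·)` is a
harmonic homogeneous polynomial of degree `s` (`isHarmonicSymbol_of_mem`). The Funk–Hecke formula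
`integral_sphere_exp_mul` evaluates the integral of `e^{i⟨Z,ru⟩} P(X,u)` over the unit sphere as a
nonzero constant times `rˢ E(r²|Z|²) P(X,Z)`. Hence both the twisted functions and the Z-Fourier
transforms have the form `c(|X|², |Z|) P(X,Z)`, and for the twisted functions `c` is a function of
`|X|²` times `E(λ|Z|²)`.

Eigenvalues. A function `E(λ|Z|²)H(Z)` with `H` harmonic of degree `s` satisfies `-Δu = λu`, and
regularity at the origin leaves no other radial profile (`radial_unique`). On `|Z| = r` the boundary
condition becomes `c E(τ) + 2bτE'(τ) = 0` with `τ = λr²` and `c = ar + bs`. For `b = 0` the roots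
are the zeros of `E`. For `b > 0` the equation says `-2τE'/E = c/b`. The left side is strictly
increasing between zeros of `E`, because its derivative is a positive quadratic form over `E²`
(`besselForm_pos`). So there is exactly one root in each gap, and the inverse function theorem makes
it smooth in `c` (`exists_roots`). Claim 1 follows, and claim 2 is the same boundary identity read
for the twisted function.

Completeness. For one radius, the functions `√(xᵖ) E(λx²)` over all roots `λ` are complete in
`L²(0,r)` (`bessel_complete`). The Green operator at the parameter `-1` is `A*A` plus a nonnegative
rank-one term, with `A` a Hilbert–Schmidt Volterra operator. It is compact, symmetric and injective,
and its eigenfunctions are exactly of this form. Over the domain or a single fibre, `c ↦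
c(|X|²,|Z|)P(X,Z)` is an isometry from a weighted `L²` space in the two radial variables
(`symbolEmbedding`). If `h` is orthogonal to all twisted functions with smooth compactly supported
profile, testing in `|X|²` gives orthogonality on almost every fibre. One-radius completeness then
makes `h` orthogonal to every square-integrable `c(|X|²,|Z|)P`
(`inner_eq_zero_of_orthogonal_smooth`).

The converse passage uses Z-Fourier transforms of profiles concentrated in thin shells, whose limits
are the smooth twisted functions (`inner_sphereTransform_eq_zero`). So anything orthogonal to the
Hankel space is also orthogonal to these. The two closed spans have the same orthogonal complement
and coincide. -/

noncomputable section
namespace ZBall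

/-! ### The entire functions `∑ (-t)ᵐ / ∏ⱼ (2j+2)(2j+1+p)` -/

/-- The denominators of the power series of the normalized Bessel function. -/
def besselDenom (p m : ℕ) : ℝ := ∏ j ∈ Finset.range m, ((2 * j + 2) * (2 * j + 1 + p) : ℝ)

theorem besselDenom_zero (p : ℕ) : besselDenom p 0 = 1 := by simp [besselDenom]

theorem besselDenom_succ (p m : ℕ) :
    besselDenom p (m + 1) = besselDenom p m * ((2 * m + 2) * (2 * m + 1 + p)) := by
  simp [besselDenom, Finset.prod_range_succ]

theorem besselDenom_pos (p m : ℕ) : 0 < besselDenom p m :=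
  Finset.prod_pos fun j _ => by positivity

/-- Makes the exponential series a majorant, so that convergence and termwise differentiation hold
on the whole line. -/
theorem factorial_le_besselDenom (p m : ℕ) : (m.factorial : ℝ) ≤ besselDenom p m := by
  induction m with
  | zero => simp [besselDenom_zero]
  | succ m ih =>
    rw [besselDenom_succ, Nat.factorial_succ, mul_comm]
    push_cast
    refine mul_le_mul ih ?_ (by positivity) (besselDenom_pos p m).le
    have : (0 : ℝ) ≤ m := by positivity
    have : (0 : ℝ) ≤ p := by positivity
    nlinarith [mul_nonneg ‹(0 : ℝ) ≤ m› ‹(0 : ℝ) ≤ p›]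

/-- The coefficient identity behind `hasDerivAt_bessel`: differentiation raises the index `p` by
two. -/
theorem besselDenom_shift (p m : ℕ) :
    besselDenom p (m + 1) = 2 * (m + 1) * (p + 1) * besselDenom (p + 2) m := by
  induction m with
  | zero => simp [besselDenom_succ, besselDenom_zero]; ring
  | succ m ih =>
    rw [besselDenom_succ p (m + 1), ih, besselDenom_succ (p + 2) m]
    push_cast
    ring

theorem besselDenom_add_two (p m : ℕ) :
    (p + 1) * besselDenom (p + 2) m = (2 * m + p + 1) * besselDenom p m := by
  induction m with
  | zero => simp [besselDenom_zero]
  | succ m ih =>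
    rw [besselDenom_succ, besselDenom_succ, ← mul_assoc, ih]
    push_cast
    ring

/-- The normalized Bessel function: the solution with value `1` at the origin of
`4 t f'' + 2 (p + 1) f' + f = 0`. -/
def bessel (p : ℕ) (t : ℝ) : ℝ := ∑' m, (-t) ^ m / besselDenom p m

theorem norm_bessel_term_le (p m : ℕ) {t r : ℝ} (h : |t| ≤ r) :
    ‖(-t) ^ m / besselDenom p m‖ ≤ r ^ m / m.factorial := by
  rw [norm_div, norm_pow, norm_neg, Real.norm_eq_abs, Real.norm_eq_abs,
    abs_of_pos (besselDenom_pos p m)]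
  exact div_le_div₀ (pow_nonneg ((abs_nonneg t).trans h) m) (pow_le_pow_left₀ (abs_nonneg t) h m)
    (by positivity) (factorial_le_besselDenom p m)

theorem summable_bessel (p : ℕ) (t : ℝ) : Summable fun m => (-t) ^ m / besselDenom p m :=
  .of_norm_bounded (Real.summable_pow_div_factorial |t|) fun m => norm_bessel_term_le p m le_rfl

theorem bessel_zero (p : ℕ) : bessel p 0 = 1 := by
  rw [bessel, tsum_eq_single 0]
  · simp [besselDenom_zero]
  · intro m hm
    simp [hm]

theorem one_le_bessel {p : ℕ} {t : ℝ} (ht : t ≤ 0) : 1 ≤ bessel p t := by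
  have := (summable_bessel p t).le_tsum 0 fun m _ =>
    div_nonneg (pow_nonneg (neg_nonneg.2 ht) m) (besselDenom_pos p m).le
  simpa [besselDenom_zero, bessel] using this

theorem hasDerivAt_bessel_tsum (p : ℕ) (t : ℝ) :
    HasDerivAt (bessel p) (∑' m : ℕ, -(m * (-t) ^ (m - 1)) / besselDenom p m) t := by
  have hu : Summable fun m : ℕ => (m : ℝ) * (|t| + 1) ^ (m - 1) / m.factorial := by
    refine (summable_nat_add_iff 1).1 ?_
    refine (Real.summable_pow_div_factorial (|t| + 1)).congr fun m => ?_
    rw [Nat.factorial_succ]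
    push_cast
    field_simp
  refine hasDerivAt_tsum_of_isPreconnected (t := Metric.ball 0 (|t| + 1))
    (g := fun m t => (-t) ^ m / besselDenom p m)
    (g' := fun m t => -(m * (-t) ^ (m - 1)) / besselDenom p m) hu Metric.isOpen_ball
    (convex_ball _ _).isPreconnected ?_ ?_ (y₀ := 0) ?_ (summable_bessel p 0) ?_
  · intro m y _
    have := ((hasDerivAt_neg y).pow m).div_const (besselDenom p m)
    refine this.congr_deriv ?_
    ring
  · intro m y hy
    have hy : |y| ≤ |t| + 1 := by simpa using (mem_ball_zero_iff.1 hy).le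
    rw [norm_div, norm_neg, norm_mul, norm_pow, norm_neg, Real.norm_eq_abs, Real.norm_eq_abs,
      Real.norm_eq_abs, abs_of_pos (besselDenom_pos p m), Nat.abs_cast]
    exact div_le_div₀ (by positivity)
      (mul_le_mul_of_nonneg_left (pow_le_pow_left₀ (abs_nonneg y) hy _) (by positivity))
      (by positivity) (factorial_le_besselDenom p m)
  · exact Metric.mem_ball_self (by positivity)
  · simp

theorem hasDerivAt_bessel (p : ℕ) (t : ℝ) :
    HasDerivAt (bessel p) (-(bessel (p + 2) t / (2 * (p + 1)))) t := by
  convert hasDerivAt_bessel_tsum p t using 1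
  symm
  rw [bessel, ← tsum_div_const, ← tsum_neg, tsum_eq_zero_add']
  · rw [Nat.cast_zero, zero_mul, neg_zero, zero_div, zero_add]
    refine tsum_congr fun m => ?_
    rw [besselDenom_shift, add_tsub_cancel_right]
    have := besselDenom_pos (p + 2) m
    push_cast
    field_simp
  · refine ((summable_bessel (p + 2) t).div_const (2 * (p + 1))).neg.congr fun m => ?_
    rw [besselDenom_shift, add_tsub_cancel_right]
    have := besselDenom_pos (p + 2) m
    push_cast
    field_simp

theorem deriv_bessel (p : ℕ) : deriv (bessel p) = fun t => -(bessel (p + 2) t / (2 * (p + 1))) :=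
  funext fun t => (hasDerivAt_bessel p t).deriv

theorem bessel_recurrence (p : ℕ) (t : ℝ) :
    -(t * bessel (p + 4) t / (p + 3)) + (p + 1) * bessel (p + 2) t = (p + 1) * bessel p t := by
  -- This quantity is `2t` times the derivative of `bessel (p + 2)`, an operation that multiplies
  -- the `m`-th term by `2m`. The recurrence is then `besselDenom_add_two` term by term.
  have h1 : -(t * bessel (p + 4) t / (p + 3)) =
      ∑' m : ℕ, 2 * m * ((-t) ^ m / besselDenom (p + 2) m) := by
    have h := (hasDerivAt_bessel (p + 2) t).unique (hasDerivAt_bessel_tsum (p + 2) t)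
    have h2 : -(t * bessel (p + 4) t / (p + 3)) =
        2 * t * -(bessel (p + 2 + 2) t / (2 * ((p + 2 : ℕ) + 1))) := by
      push_cast
      have : (p : ℝ) + 3 ≠ 0 := by positivity
      field_simp
      ring
    rw [h2, h, ← tsum_mul_left]
    refine tsum_congr fun m => ?_
    rcases m with _ | m
    · simp
    · rw [Nat.add_sub_cancel, pow_succ]
      ring
  have h3 : Summable fun m : ℕ => 2 * m * ((-t) ^ m / besselDenom (p + 2) m) := by
    refine (((summable_bessel p t).mul_left (p + 1 : ℝ)).sub
      ((summable_bessel (p + 2) t).mul_left (p + 1 : ℝ))).congr fun m => ?_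
    have := besselDenom_add_two p m
    have h4 := besselDenom_pos (p + 2) m
    have h5 := besselDenom_pos p m
    field_simp
    linear_combination this * (-t) ^ m
  rw [h1, bessel, bessel, ← tsum_mul_left, ← tsum_mul_left,
    ← h3.tsum_add ((summable_bessel (p + 2) t).mul_left _)]
  refine tsum_congr fun m => ?_
  have := besselDenom_add_two p m
  have h4 := besselDenom_pos (p + 2) m
  have h5 := besselDenom_pos p m
  field_simp
  linear_combination (-(-t) ^ m) * this

theorem contDiff_bessel (p : ℕ) {n : ℕ∞} : ContDiff ℝ n (bessel p) := by
  refine ContDiff.of_le (n := ∞) ?_ (by exact_mod_cast le_top)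
  refine contDiff_infty.2 fun n => ?_
  induction n generalizing p with
  | zero =>
    refine contDiff_zero.2 (continuous_iff_continuousAt.2 fun t => ?_)
    exact (hasDerivAt_bessel p t).continuousAt
  | succ n ih =>
    have h := contDiff_succ_iff_deriv (𝕜 := ℝ) (n := n) (f := bessel p)
    push_cast at h ⊢
    refine h.2 ⟨fun t => (hasDerivAt_bessel p t).differentiableAt, by simp, ?_⟩
    rw [deriv_bessel]
    exact ((ih (p + 2)).div_const _).neg

@[fun_prop]
theorem continuous_bessel (p : ℕ) : Continuous (bessel p) := (contDiff_bessel p (n := 0)).continuous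

/-- The derivative of the normalized Bessel function. -/
def besselDeriv (p : ℕ) (t : ℝ) : ℝ := -(bessel (p + 2) t / (2 * (p + 1)))

theorem hasDerivAt_bessel' (p : ℕ) (t : ℝ) : HasDerivAt (bessel p) (besselDeriv p t) t :=
  hasDerivAt_bessel p t

theorem contDiff_besselDeriv (p : ℕ) {n : ℕ∞} : ContDiff ℝ n (besselDeriv p) :=
  ((contDiff_bessel (p + 2)).div_const _).neg

@[fun_prop]
theorem continuous_besselDeriv (p : ℕ) : Continuous (besselDeriv p) :=
  (contDiff_besselDeriv p (n := 0)).continuous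

theorem besselDeriv_neg {p : ℕ} {t : ℝ} (ht : t ≤ 0) : besselDeriv p t < 0 := by
  have := one_le_bessel (p := p + 2) ht
  rw [besselDeriv, neg_lt_zero]
  positivity

/-- The second derivative of the normalized Bessel function. -/
def besselDeriv₂ (p : ℕ) (t : ℝ) : ℝ := bessel (p + 4) t / (4 * (p + 1) * (p + 3))

theorem hasDerivAt_besselDeriv (p : ℕ) (t : ℝ) :
    HasDerivAt (besselDeriv p) (besselDeriv₂ p t) t := by
  refine ((hasDerivAt_bessel (p + 2) t).div_const (2 * (p + 1))).neg.congr_deriv ?_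
  rw [besselDeriv₂]
  push_cast
  have : (p : ℝ) + 3 ≠ 0 := by positivity
  have : (p : ℝ) + 2 + 1 ≠ 0 := by positivity
  field_simp
  ring

/-- The differential equation of the normalized Bessel function. -/
theorem bessel_ode (p : ℕ) (t : ℝ) :
    4 * t * besselDeriv₂ p t + 2 * (p + 1) * besselDeriv p t + bessel p t = 0 := by
  have h1 := bessel_recurrence p t
  have h2 : bessel p t = (-(t * bessel (p + 4) t / (p + 3)) + (p + 1) * bessel (p + 2) t) /
      (p + 1) := by
    rw [h1]; field_simp
  rw [h2, besselDeriv, besselDeriv₂]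
  have : (p : ℝ) + 3 ≠ 0 := by positivity
  field_simp
  ring

end ZBall
end

noncomputable section
namespace ZBall
open Filter Topology

/-! ### Uniqueness of the regular solution of the radial equation -/

theorem hasDerivAt_bessel_sq (p : ℕ) (lam x : ℝ) :
    HasDerivAt (fun x => bessel p (lam * x ^ 2)) (2 * lam * x * besselDeriv p (lam * x ^ 2)) x := by
  have h := (hasDerivAt_bessel' p (lam * x ^ 2)).comp x
    (((hasDerivAt_id x).pow 2).const_mul lam)
  refine h.congr_deriv ?_
  simp
  ring

/-- `bessel_ode` in divergence form. The flux `xᵖ u'` is the right second unknown, since it stays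
regular at the singular point `0`. -/
theorem hasDerivAt_flux (p : ℕ) (lam x : ℝ) :
    HasDerivAt (fun x => x ^ p * (2 * lam * x * besselDeriv p (lam * x ^ 2)))
      (-(lam * x ^ p) * bessel p (lam * x ^ 2)) x := by
  have h1 := (hasDerivAt_besselDeriv p (lam * x ^ 2)).comp x
    (((hasDerivAt_id x).pow 2).const_mul lam)
  have h2 := ((hasDerivAt_id x).pow (p + 1)).mul h1
  have h3 := h2.const_mul (2 * lam)
  refine (h3.congr_of_eventuallyEq (.of_forall fun y => ?_)).congr_deriv ?_
  · simp
    ring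
  · have := bessel_ode p (lam * x ^ 2)
    simp
    linear_combination lam * x ^ p * this

/-- The system for a solution and its flux is singular at `0`, but Lipschitz on `(ε, r)` for each `ε
> 0`. It suffices to choose `ε` below both points. -/
theorem linear_ode_unique {F : Type*} [NormedAddCommGroup F] [NormedSpace ℝ F] (p : ℕ) (lam : ℝ)
    {r x₀ : ℝ} (hx₀ : x₀ ∈ Ioo 0 r) {v q w z : ℝ → F}
    (hv : ∀ x ∈ Ioo 0 r, HasDerivAt v ((x ^ p)⁻¹ • q x) x)
    (hq : ∀ x ∈ Ioo 0 r, HasDerivAt q (-(lam * x ^ p) • v x) x)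
    (hw : ∀ x ∈ Ioo 0 r, HasDerivAt w ((x ^ p)⁻¹ • z x) x)
    (hz : ∀ x ∈ Ioo 0 r, HasDerivAt z (-(lam * x ^ p) • w x) x)
    (h1 : v x₀ = w x₀) (h2 : q x₀ = z x₀) {x : ℝ} (hx : x ∈ Ioo 0 r) :
    v x = w x ∧ q x = z x := by
  obtain ⟨ε, hε, hεx⟩ := exists_between (lt_min hx₀.1 hx.1)
  have hε' : ∀ t ∈ Ioo ε r, t ∈ Ioo 0 r := fun t ht => ⟨hε.trans ht.1, ht.2⟩
  set K : ℝ := max (ε ^ p)⁻¹ (|lam| * r ^ p)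
  have hK : 0 ≤ K := le_max_of_le_left (by positivity)
  have key := ODE_solution_unique_of_mem_Ioo (K := ⟨K, hK⟩) (s := fun _ => univ)
    (v := fun t (a : F × F) => ((t ^ p)⁻¹ • a.2, -(lam * t ^ p) • a.1))
    (f := fun t => (v t, q t)) (g := fun t => (w t, z t)) (a := ε) (b := r) (t₀ := x₀) ?_
    ⟨hεx.trans_le (min_le_left _ _), hx₀.2⟩
    (fun t ht => ⟨(hv t (hε' t ht)).prodMk (hq t (hε' t ht)), trivial⟩)
    (fun t ht => ⟨(hw t (hε' t ht)).prodMk (hz t (hε' t ht)), trivial⟩) (by simp [h1, h2])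
  · have := key ⟨hεx.trans_le (min_le_right _ _), hx.2⟩
    simpa using this
  · intro t ht
    have ht0 : 0 < t := hε.trans ht.1
    refine (LipschitzWith.of_dist_le_mul fun a b => ?_).lipschitzOnWith
    rw [Prod.dist_eq, Prod.dist_eq]
    simp only [dist_smul₀, Real.norm_eq_abs]
    refine max_le (mul_le_mul ?_ (le_max_right _ _) dist_nonneg hK)
      (mul_le_mul ?_ (le_max_left _ _) dist_nonneg hK)
    · refine le_max_of_le_left ?_
      rw [abs_of_pos (by positivity)]
      gcongr
      exact ht.1.le
    · refine le_max_of_le_right ?_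
      rw [abs_neg, abs_mul, abs_of_pos (a := t ^ p) (by positivity)]
      gcongr
      exact ht.2.le

/-- The Wronskian with the Bessel solution is constant, and the two limits at the origin force that
constant to be zero. At a point where the Bessel solution does not vanish, value and flux therefore
both agree with those of one multiple of it. -/
theorem radial_unique {F : Type*} [NormedAddCommGroup F] [NormedSpace ℝ F] (p : ℕ) (lam : ℝ)
    {r : ℝ} (hr : 0 < r) {v v' : ℝ → F}
    (hv : ∀ x ∈ Ioo 0 r, HasDerivAt v (v' x) x)
    (hv' : ∀ x ∈ Ioo 0 r, HasDerivAt (fun x => x ^ p • v' x) (-(lam * x ^ p) • v x) x)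
    (h0' : Tendsto (fun x => x ^ p • v' x) (𝓝[>] 0) (𝓝 0))
    (h0 : Tendsto (fun x => x ^ (p + 1) • v x) (𝓝[>] 0) (𝓝 0)) :
    ∃ C : F, ∀ x ∈ Ioo 0 r, v x = bessel p (lam * x ^ 2) • C ∧
      v' x = (2 * lam * x * besselDeriv p (lam * x ^ 2)) • C := by
  set e : ℝ → ℝ := fun x => bessel p (lam * x ^ 2)
  set g : ℝ → ℝ := fun x => x ^ p * (2 * lam * x * besselDeriv p (lam * x ^ 2))
  have he : ∀ x, HasDerivAt e (2 * lam * x * besselDeriv p (lam * x ^ 2)) x :=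
    hasDerivAt_bessel_sq p lam
  have hg : ∀ x, HasDerivAt g (-(lam * x ^ p) * e x) x := hasDerivAt_flux p lam
  set W : ℝ → F := fun x => e x • (x ^ p • v' x) - g x • v x
  have hW : ∀ x ∈ Ioo 0 r, HasDerivAt W 0 x := fun x hx => by
    refine (((he x).smul (hv' x hx)).sub ((hg x).smul (hv x hx))).congr_deriv ?_
    simp only [g]
    module
  -- `g` is `x ^ (p + 1)` times a continuous function, so each term of `W` is controlled by one of
  -- the two limit hypotheses.
  have hW0 : Tendsto W (𝓝[>] 0) (𝓝 0) := by
    have h1 : Tendsto e (𝓝[>] 0) (𝓝 (e 0)) := (he 0).continuousAt.tendsto.mono_left inf_le_left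
    have hc : Continuous fun x : ℝ => 2 * lam * besselDeriv p (lam * x ^ 2) := by fun_prop
    have h2 := (hc.tendsto 0).mono_left (inf_le_left (b := 𝓟 (Ioi 0)))
    have := (h1.smul h0').sub (h2.smul h0)
    simp only [smul_zero, sub_zero] at this
    refine this.congr fun x => ?_
    simp only [W, g, e]
    module
  have hWz : ∀ x ∈ Ioo 0 r, W x = 0 := fun x hx => by
    have hconst : ∀ y ∈ Ioo 0 r, W y = W x := fun y hy =>
      (convex_Ioo 0 r).is_const_of_fderivWithin_eq_zero (𝕜 := ℝ)
        (fun t ht => (hW t ht).differentiableAt.differentiableWithinAt)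
        (fun t ht => by
          rw [fderivWithin_of_isOpen isOpen_Ioo ht, (hW t ht).hasFDerivAt.fderiv]; ext; simp)
        hy hx
    refine tendsto_nhds_unique (tendsto_const_nhds.congr' ?_) hW0
    filter_upwards [Ioo_mem_nhdsGT hr] with y hy using (hconst y hy).symm
  obtain ⟨x₀, hx₀, hex₀⟩ : ∃ x₀ ∈ Ioo 0 r, e x₀ ≠ 0 := by
    have h1 : ∀ᶠ x in 𝓝[>] (0 : ℝ), e x ≠ 0 :=
      ((he 0).continuousAt.eventually_ne (by simp [e, bessel_zero])).filter_mono inf_le_left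
    obtain ⟨x, h2, h3⟩ := (h1.and (Ioo_mem_nhdsGT hr)).exists
    exact ⟨x, h3, h2⟩
  refine ⟨(e x₀)⁻¹ • v x₀, fun x hx => ?_⟩
  have key := linear_ode_unique p lam hx₀ (v := v) (q := fun x => x ^ p • v' x)
    (w := fun x => e x • ((e x₀)⁻¹ • v x₀)) (z := fun x => g x • ((e x₀)⁻¹ • v x₀))
    (fun x hx => (hv x hx).congr_deriv ?_) hv'
    (fun x hx => ((he x).smul_const _).congr_deriv ?_)
    (fun x hx => ((hg x).smul_const _).congr_deriv ?_) ?_ ?_ hx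
  · refine ⟨key.1, ?_⟩
    have hxp : x ^ p ≠ 0 := (pow_pos hx.1 p).ne'
    have := congrArg (fun z => (x ^ p)⁻¹ • z) key.2
    simp only [g, smul_smul] at this
    rw [inv_mul_cancel₀ hxp, one_smul] at this
    rw [this, smul_smul]
    congr 1
    field_simp
  · have hxp : x ^ p ≠ 0 := (pow_pos hx.1 p).ne'
    rw [smul_smul, inv_mul_cancel₀ hxp, one_smul]
  · have hxp : x ^ p ≠ 0 := (pow_pos hx.1 p).ne'
    rw [smul_smul _ (g x)]
    simp only [g]
    rw [inv_mul_cancel_left₀ hxp]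
  · simp [smul_smul, mul_assoc]
  · rw [smul_smul, mul_inv_cancel₀ hex₀, one_smul]
  · have := sub_eq_zero.1 (hWz x₀ hx₀)
    rw [smul_comm, ← this, smul_smul, inv_mul_cancel₀ hex₀, one_smul]

end ZBall
end

noncomputable section
namespace ZBall
open Filter Topology

/-! ### Zeros of the normalized Bessel functions -/

/-- A quadratic form in `E`, `E'` that is positive on the half-line. -/
def besselForm (p : ℕ) (t : ℝ) : ℝ :=
  t * besselDeriv p t ^ 2 + (p - 1) / 2 * bessel p t * besselDeriv p t + bessel p t ^ 2 / 4

/-- By the differential equation, `x ^ (p + 1) * besselForm p (x ^ 2)` has derivative `xᵖ E(x²)²/2 ≥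
0`. The form equals `1/(2(p+1))` at the origin, so the product is positive near `0` and stays
positive. -/
theorem besselForm_pos {p : ℕ} {t : ℝ} (ht : 0 ≤ t) : 0 < besselForm p t := by
  have h0 : 0 < besselForm p 0 := by
    have : (0 : ℝ) < 1 / (2 * (p + 1)) := by positivity
    rw [besselForm, besselDeriv, bessel_zero, bessel_zero]
    refine this.trans_eq ?_
    field_simp
    ring
  rcases ht.eq_or_lt with rfl | ht
  · exact h0
  have hd : ∀ x, HasDerivAt (fun x => x ^ (p + 1) * besselForm p (x ^ 2))
      (x ^ p * (bessel p (x ^ 2) ^ 2 / 2)) x := fun x => by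
    have hs : HasDerivAt (fun x : ℝ => x ^ 2) (2 * x) x := by
      simpa using hasDerivAt_pow 2 x
    have hE := (hasDerivAt_bessel' p (x ^ 2)).comp x hs
    have hE' := (hasDerivAt_besselDeriv p (x ^ 2)).comp x hs
    have h1 := ((hs.mul (hE'.pow 2)).add ((hE.const_mul ((p - 1) / 2 : ℝ)).mul hE')).add
      ((hE.pow 2).div_const 4)
    have h2 := (hasDerivAt_pow (p + 1) x).mul h1
    refine (h2.congr_of_eventuallyEq (.of_forall fun y => ?_)).congr_deriv ?_
    · simp [besselForm]
    · have := bessel_ode p (x ^ 2)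
      simp
      linear_combination x ^ p * (x ^ 2 * besselDeriv p (x ^ 2) +
        (p - 1) / 4 * bessel p (x ^ 2)) * this
  have hmono : MonotoneOn (fun x => x ^ (p + 1) * besselForm p (x ^ 2)) (Ici 0) := by
    refine monotoneOn_of_deriv_nonneg (convex_Ici 0)
      (fun x _ => (hd x).continuousAt.continuousWithinAt)
      (fun x _ => (hd x).differentiableAt.differentiableWithinAt) fun x hx => ?_
    rw [interior_Ici] at hx
    rw [(hd x).deriv]
    have : 0 < x := hx
    positivity
  have hc : Continuous fun x : ℝ => besselForm p (x ^ 2) := by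
    unfold besselForm
    fun_prop
  have hev : ∀ᶠ x in 𝓝[>] (0 : ℝ), 0 < besselForm p (x ^ 2) :=
    (hc.continuousAt.eventually_const_lt (by simpa using h0)).filter_mono inf_le_left
  obtain ⟨y, hy, hy0, hyt⟩ := (hev.and (Ioo_mem_nhdsGT (Real.sqrt_pos.2 ht))).exists
  have h1 : 0 < y ^ (p + 1) * besselForm p (y ^ 2) := mul_pos (pow_pos hy0 _) hy
  have h2 := h1.trans_le (hmono hy0.le (Real.sqrt_nonneg t) hyt.le)
  simp only [Real.sq_sqrt ht.le] at h2
  exact (pos_iff_pos_of_mul_pos h2).1 (pow_pos (Real.sqrt_pos.2 ht) _)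

theorem pos_of_bessel_eq_zero {p : ℕ} {t : ℝ} (h : bessel p t = 0) : 0 < t := by
  by_contra! ht
  linarith [one_le_bessel (p := p) ht]

/-- At a double zero the quadratic form would vanish. -/
theorem besselDeriv_ne_zero {p : ℕ} {t : ℝ} (h : bessel p t = 0) : besselDeriv p t ≠ 0 := by
  intro h'
  have := besselForm_pos (p := p) (pos_of_bessel_eq_zero h).le
  simp [besselForm, h, h'] at this

/-- The negative logarithmic derivative `-2τE'(τ)/E(τ)`. -/
def besselLog (p : ℕ) (t : ℝ) : ℝ := -(2 * t * besselDeriv p t / bessel p t)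

theorem hasDerivAt_besselLog {p : ℕ} {t : ℝ} (h : bessel p t ≠ 0) :
    HasDerivAt (besselLog p) (2 * besselForm p t / bessel p t ^ 2) t := by
  have h1 := ((((hasDerivAt_id t).const_mul 2).mul (hasDerivAt_besselDeriv p t)).div
    (hasDerivAt_bessel' p t) h).neg
  refine h1.congr_deriv ?_
  have := bessel_ode p t
  simp only [besselForm, id, Pi.mul_apply]
  field_simp
  linear_combination (-2 * bessel p t) * this

theorem strictMonoOn_besselLog {p : ℕ} {D : Set ℝ} (hD : Convex ℝ D) (h0 : ∀ t ∈ D, 0 ≤ t)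
    (hE : ∀ t ∈ D, bessel p t ≠ 0) : StrictMonoOn (besselLog p) D := by
  refine strictMonoOn_of_deriv_pos hD
    (fun t ht => (hasDerivAt_besselLog (hE t ht)).continuousAt.continuousWithinAt) fun t ht => ?_
  have ht := interior_subset ht
  rw [(hasDerivAt_besselLog (hE t ht)).deriv]
  have := besselForm_pos (p := p) (h0 t ht)
  have := hE t ht
  positivity

/-- The derivative of `L = besselLog p` is `(L² - (p-1)L + t)/(2t)`. For `t ≥ (p-1)²` half of `L² +
t` absorbs the linear term. -/
theorem riccati_bound {p : ℕ} {t : ℝ} (h : bessel p t ≠ 0) (ht : 1 ≤ t)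
    (htp : ((p : ℝ) - 1) ^ 2 ≤ t) :
    (besselLog p t ^ 2 + t) / (4 * t) ≤ 2 * besselForm p t / bessel p t ^ 2 := by
  have ht0 : 0 < t := by linarith
  have h1 : 2 * besselForm p t / bessel p t ^ 2 =
      (besselLog p t ^ 2 - (p - 1) * besselLog p t + t) / (2 * t) := by
    rw [besselForm, besselLog]
    field_simp
    ring
  rw [h1, div_le_div_iff₀ (by positivity) (by positivity)]
  nlinarith [sq_nonneg (besselLog p t - (p - 1)), mul_nonneg ht0.le
    (sq_nonneg (besselLog p t - (p - 1)))]

/-- Without further zeros, `L = besselLog p` would solve the Riccati inequality `L' ≥ (L² + t)/(4t)`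
forever. First `L' ≥ 1/4` drives `L` above `1`. Then `(1/L)' ≤ -1/(4t)` makes `log t / 4 + 1/L`
nonincreasing, against the divergence of the logarithm. -/
theorem exists_bessel_eq_zero_gt (p : ℕ) (T : ℝ) : ∃ t > T, bessel p t = 0 := by
  by_contra! hT
  set T₁ : ℝ := max (max T 1) ((p - 1) ^ 2) + 1
  have hT₁ : ∀ t ≥ T₁, T < t ∧ 1 ≤ t ∧ ((p : ℝ) - 1) ^ 2 ≤ t := fun t ht => by
    have h1 := le_max_left (max T 1) (((p : ℝ) - 1) ^ 2)
    have h2 := le_max_right (max T 1) (((p : ℝ) - 1) ^ 2)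
    have h3 := le_max_left T 1
    have h4 := le_max_right T 1
    refine ⟨?_, ?_, ?_⟩ <;> linarith
  have hd : ∀ t ≥ T₁, HasDerivAt (besselLog p) (2 * besselForm p t / bessel p t ^ 2) t :=
    fun t ht => hasDerivAt_besselLog (hT t (hT₁ t ht).1)
  have hb : ∀ t ≥ T₁, (besselLog p t ^ 2 + t) / (4 * t) ≤ 2 * besselForm p t / bessel p t ^ 2 :=
    fun t ht => riccati_bound (hT t (hT₁ t ht).1) (hT₁ t ht).2.1 (hT₁ t ht).2.2
  have hgrow : MonotoneOn (fun t => besselLog p t - t / 4) (Ici T₁) := by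
    have hd' : ∀ t ≥ T₁, HasDerivAt (fun t => besselLog p t - t / 4)
        (2 * besselForm p t / bessel p t ^ 2 - 1 / 4) t :=
      fun t ht => (hd t ht).sub ((hasDerivAt_id t).div_const 4)
    refine monotoneOn_of_deriv_nonneg (convex_Ici _)
      (fun t ht => (hd' t ht).continuousAt.continuousWithinAt)
      (fun t ht => (hd' t (interior_subset ht)).differentiableAt.differentiableWithinAt)
      fun t ht => ?_
    have ht := interior_subset ht
    rw [(hd' t ht).deriv]
    have h1 := (hT₁ t ht).2.1
    have : 1 / 4 ≤ (besselLog p t ^ 2 + t) / (4 * t) := by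
      rw [div_le_div_iff₀ (by positivity) (by positivity)]
      nlinarith [sq_nonneg (besselLog p t)]
    linarith [hb t ht]
  -- From here on, growth with slope at least `1/4` starting at `T₁` has brought `besselLog` up to
  -- `1`.
  set T₂ : ℝ := max T₁ (T₁ - 4 * besselLog p T₁ + 4)
  have hpos : ∀ t ≥ T₂, 1 ≤ besselLog p t := fun t ht => by
    have h1 : T₁ ≤ t := (le_max_left _ _).trans ht
    have h2 : T₁ - 4 * besselLog p T₁ + 4 ≤ t := (le_max_right _ _).trans ht
    have := hgrow (mem_Ici.2 le_rfl) (mem_Ici.2 h1) h1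
    simp only at this
    linarith
  have hanti : AntitoneOn (fun t => Real.log t / 4 + (besselLog p t)⁻¹) (Ici T₂) := by
    have hd' : ∀ t ≥ T₂, HasDerivAt (fun t => Real.log t / 4 + (besselLog p t)⁻¹)
        (t⁻¹ / 4 + -(2 * besselForm p t / bessel p t ^ 2) / besselLog p t ^ 2) t := fun t ht => by
      have h1 : T₁ ≤ t := (le_max_left _ _).trans ht
      exact ((Real.hasDerivAt_log (by linarith [(hT₁ t h1).2.1])).div_const 4).add
        ((hd t h1).inv (by linarith [hpos t ht]))
    refine antitoneOn_of_deriv_nonpos (convex_Ici _)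
      (fun t ht => (hd' t ht).continuousAt.continuousWithinAt)
      (fun t ht => (hd' t (interior_subset ht)).differentiableAt.differentiableWithinAt)
      fun t ht => ?_
    have ht := interior_subset ht
    have h1 : T₁ ≤ t := (le_max_left _ _).trans ht
    have h2 := (hT₁ t h1).2.1
    have h3 := hpos t ht
    rw [(hd' t ht).deriv, neg_div, ← sub_eq_add_neg, sub_nonpos, le_div_iff₀ (by positivity)]
    refine le_trans ?_ (hb t h1)
    rw [inv_eq_one_div, div_div, div_mul_eq_mul_div, div_le_div_iff₀ (by positivity) (by positivity)]
    nlinarith [sq_nonneg (besselLog p t)]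
  obtain ⟨t, ht1, ht2⟩ := ((Real.tendsto_log_atTop.eventually_gt_atTop
    (4 * (Real.log T₂ / 4 + (besselLog p T₂)⁻¹))).and (eventually_ge_atTop T₂)).exists
  have h1 := hanti (mem_Ici.2 le_rfl) (mem_Ici.2 ht2) ht2
  have h2 : 0 < (besselLog p t)⁻¹ := inv_pos.2 (by linarith [hpos t ht2])
  simp only at h1
  linarith

/-- All zeros are positive, so infinitely many of them below `T` would accumulate at a zero; but
zeros are simple and therefore isolated. -/
theorem finite_bessel_zeros (p : ℕ) (T : ℝ) : ({t | bessel p t = 0} ∩ Iic T).Finite := by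
  by_contra hinf
  have hsub : {t | bessel p t = 0} ∩ Iic T ⊆ Icc 0 T := fun t ht =>
    ⟨(pos_of_bessel_eq_zero ht.1).le, ht.2⟩
  obtain ⟨x, -, hx⟩ := Set.Infinite.exists_accPt_of_subset_isCompact hinf isCompact_Icc hsub
  have hx' : AccPt x (𝓟 {t | bessel p t = 0}) := hx.mono (principal_mono.2 inter_subset_left)
  have hx0 : bessel p x = 0 := by
    have hcl : IsClosed {t | bessel p t = 0} := isClosed_eq (continuous_bessel p) continuous_const
    exact hcl.closure_subset_iff.2 le_rfl hx'.clusterPt.mem_closure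
  have h1 := (hasDerivAt_bessel' p x).eventually_ne (c := 0) (besselDeriv_ne_zero hx0)
  rw [accPt_iff_frequently_nhdsNE] at hx'
  exact hx' (h1.mono fun y hy => hy)

/-- An infinite set of real numbers that is finite below each number is enumerated by a strictly
increasing sequence. -/
theorem exists_strictMono_range {Z : Set ℝ} (hne : ∀ T, ∃ t ∈ Z, T < t)
    (hfin : ∀ T, (Z ∩ Iic T).Finite) : ∃ e : ℕ → ℝ, StrictMono e ∧ range e = Z := by
  classical
  obtain ⟨z₀, hz₀, -⟩ := hne 0
  have hmin : ∀ T, ∃ t ∈ Z, T < t ∧ ∀ y ∈ Z, T < y → t ≤ y := fun T => by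
    obtain ⟨t, htZ, hTt⟩ := hne T
    obtain ⟨m, hm, hmin⟩ := Set.exists_min_image (Z ∩ Iic t ∩ Ioi T) id
      ((hfin t).subset inter_subset_left) ⟨t, ⟨htZ, mem_Iic.2 le_rfl⟩, hTt⟩
    refine ⟨m, hm.1.1, hm.2, fun y hy hTy => ?_⟩
    rcases le_total y t with h | h
    · exact hmin y ⟨⟨hy, h⟩, hTy⟩
    · exact (mem_Iic.1 hm.1.2).trans h
  choose f hfZ hfT hfmin using hmin
  obtain ⟨m, hm, hmmin⟩ := Set.exists_min_image (Z ∩ Iic z₀) id (hfin z₀)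
    ⟨z₀, hz₀, mem_Iic.2 le_rfl⟩
  have hmZ : ∀ y ∈ Z, m ≤ y := fun y hy => by
    rcases le_total y z₀ with h | h
    · exact hmmin y ⟨hy, h⟩
    · exact (mem_Iic.1 hm.2).trans h
  set e : ℕ → ℝ := fun n => f^[n] m
  have hes : ∀ n, e (n + 1) = f (e n) := fun n => Function.iterate_succ_apply' f n m
  have hmono : StrictMono e := strictMono_nat_of_lt_succ fun n => by rw [hes]; exact hfT _
  have heZ : ∀ n, e n ∈ Z := fun n => by
    cases n with
    | zero => exact hm.1
    | succ n => rw [hes]; exact hfZ _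
  refine ⟨e, hmono, Subset.antisymm (range_subset_iff.2 heZ) fun y hy => ?_⟩
  have hex : ∃ n, y < e n := by
    by_contra! hle
    exact Set.infinite_of_injective_forall_mem (s := Z ∩ Iic y) hmono.injective
      (fun n => ⟨heZ n, hle n⟩) (hfin y)
  have hlt := Nat.find_spec hex
  rcases hn : Nat.find hex with _ | n
  · rw [hn] at hlt
    exact absurd (hmZ y hy) (not_le.2 hlt)
  · rw [hn, hes] at hlt
    refine ⟨n, le_antisymm (not_lt.1 (Nat.find_min hex (hn ▸ n.lt_succ_self))) ?_⟩
    by_contra! hlt'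
    exact absurd (hfmin _ y hy hlt') (not_le.2 hlt)

theorem exists_bessel_zeros (p : ℕ) :
    ∃ j : ℕ → ℝ, StrictMono j ∧ ∀ t, bessel p t = 0 ↔ ∃ i, j i = t := by
  obtain ⟨j, hj, hr⟩ := exists_strictMono_range (Z := {t | bessel p t = 0})
    (fun T => by obtain ⟨t, h1, h2⟩ := exists_bessel_eq_zero_gt p T; exact ⟨t, h2, h1⟩)
    (finite_bessel_zeros p)
  exact ⟨j, hj, fun t => by rw [← mem_range, hr]; rfl⟩

theorem deriv_sign_of_pos {f : ℝ → ℝ} {α β f₁ f₂ : ℝ} (hαβ : α < β) (hα : f α = 0) (hβ : f β = 0)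
    (hf : ∀ t ∈ Ioo α β, 0 < f t) (h1 : HasDerivAt f f₁ α) (h2 : HasDerivAt f f₂ β) :
    0 ≤ f₁ ∧ f₂ ≤ 0 := by
  rw [hasDerivAt_iff_tendsto_slope] at h1 h2
  constructor
  · have hle : 𝓝[>] α ≤ 𝓝[≠] α := nhdsWithin_mono _ fun y (hy : α < y) => hy.ne'
    refine ge_of_tendsto (h1.mono_left hle) ?_
    filter_upwards [Ioo_mem_nhdsGT hαβ] with y hy
    rw [slope_def_field, hα, sub_zero]
    exact div_nonneg (hf y hy).le (sub_nonneg.2 hy.1.le)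
  · have hle : 𝓝[<] β ≤ 𝓝[≠] β := nhdsWithin_mono _ fun y (hy : y < β) => hy.ne
    refine le_of_tendsto (h2.mono_left hle) ?_
    filter_upwards [Ioo_mem_nhdsLT hαβ] with y hy
    rw [slope_def_field, hβ, sub_zero]
    exact div_nonpos_of_nonneg_of_nonpos (hf y hy).le (sub_nonpos.2 hy.2.le)

/-- Between consecutive zeros the sign is constant, so the slopes at the two ends have opposite
signs; simplicity makes them nonzero. -/
theorem besselDeriv_mul_neg {p : ℕ} {α β : ℝ} (hαβ : α < β) (hα : bessel p α = 0)
    (hβ : bessel p β = 0) (h : ∀ t ∈ Ioo α β, bessel p t ≠ 0) :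
    besselDeriv p α * besselDeriv p β < 0 := by
  have h1 := besselDeriv_ne_zero hα
  have h2 := besselDeriv_ne_zero hβ
  have hsign : (∀ t ∈ Ioo α β, 0 < bessel p t) ∨ ∀ t ∈ Ioo α β, 0 < -bessel p t := by
    by_contra! hcon
    obtain ⟨⟨x, hx, hx0⟩, y, hy, hy0⟩ := hcon
    obtain ⟨z, hz, hz0⟩ := isPreconnected_Ioo.intermediate_value hx hy
      (continuous_bessel p).continuousOn ⟨hx0, neg_nonpos.1 hy0⟩
    exact h z hz hz0
  rcases hsign with hs | hs
  · have := deriv_sign_of_pos hαβ hα hβ hs (hasDerivAt_bessel' p α) (hasDerivAt_bessel' p β)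
    exact mul_neg_of_pos_of_neg (this.1.lt_of_ne h1.symm) (this.2.lt_of_ne h2)
  · have := deriv_sign_of_pos hαβ (f := fun t => -bessel p t) (by simp [hα]) (by simp [hβ]) hs
      (hasDerivAt_bessel' p α).neg (hasDerivAt_bessel' p β).neg
    exact mul_neg_of_neg_of_pos ((neg_nonneg.1 this.1).lt_of_ne h1)
      ((neg_nonpos.1 this.2).lt_of_ne h2.symm)

end ZBall
end

noncomputable section
namespace ZBall
open Filter Topology

/-! ### Roots of the boundary equation -/

/-- The boundary function: `E(λx²)` satisfies the boundary condition for order `s` on the sphere of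
radius `r` if and only if this function with `c = a r + b s` vanishes at `τ = λr²`. -/
def bdryFun (p : ℕ) (c b t : ℝ) : ℝ := c * bessel p t + 2 * b * t * besselDeriv p t

theorem continuous_bdryFun (p : ℕ) (c b : ℝ) : Continuous (bdryFun p c b) := by
  unfold bdryFun
  fun_prop

theorem bdryFun_zero (p : ℕ) (c b : ℝ) : bdryFun p c b 0 = c := by simp [bdryFun, bessel_zero]

/-- For negative arguments `E ≥ 1` and `E' < 0`, so both terms are nonnegative and one is positive.
This excludes negative eigenvalues. -/
theorem bdryFun_pos {p : ℕ} {c b t : ℝ} (hc : 0 ≤ c) (hb : 0 ≤ b) (hcb : 0 < c + b) (ht : t < 0) :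
    0 < bdryFun p c b t := by
  have h1 := one_le_bessel (p := p) ht.le
  have h2 : 0 < t * besselDeriv p t := mul_pos_of_neg_of_neg ht (besselDeriv_neg ht.le)
  have h3 : bdryFun p c b t = c * bessel p t + 2 * (b * (t * besselDeriv p t)) := by
    rw [bdryFun]; ring
  rw [h3]
  rcases hb.eq_or_lt with rfl | hb
  · rw [zero_mul, mul_zero, add_zero]
    exact mul_pos (by simpa using hcb) (by linarith)
  · have := mul_pos hb h2
    have := mul_nonneg hc (by linarith : 0 ≤ bessel p t)
    linarith

theorem nonneg_of_bdryFun_eq_zero {p : ℕ} {c b t : ℝ} (hc : 0 ≤ c) (hb : 0 ≤ b) (hcb : 0 < c + b)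
    (h : bdryFun p c b t = 0) : 0 ≤ t := by
  by_contra! ht
  exact (bdryFun_pos hc hb hcb ht).ne' h

theorem bessel_ne_zero_of_bdryFun {p : ℕ} {c b t : ℝ} (hb : b ≠ 0)
    (h : bdryFun p c b t = 0) : bessel p t ≠ 0 := by
  intro h0
  have h1 := besselDeriv_ne_zero h0
  have h2 := pos_of_bessel_eq_zero h0
  rw [bdryFun, h0] at h
  simp [hb, h1, h2.ne'] at h

theorem bdryFun_eq_zero_iff {p : ℕ} {c b t : ℝ} (hb : b ≠ 0) (h : bessel p t ≠ 0) :
    bdryFun p c b t = 0 ↔ besselLog p t = c / b := by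
  rw [bdryFun, besselLog, eq_div_iff hb]
  constructor
  · intro h'
    field_simp
    linarith
  · intro h'
    field_simp at h'
    linarith

/-- On an interval free of zeros of `E` a root is a solution of `besselLog p t = c / b`, and
`besselLog p` is injective there. -/
theorem bdryFun_root_unique {p : ℕ} {c b t₁ t₂ : ℝ} (hb : b ≠ 0) (h0 : 0 ≤ t₁) (h12 : t₁ ≤ t₂)
    (hE : ∀ t ∈ Icc t₁ t₂, bessel p t ≠ 0) (h1 : bdryFun p c b t₁ = 0)
    (h2 : bdryFun p c b t₂ = 0) : t₁ = t₂ := by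
  have hm := strictMonoOn_besselLog (convex_Icc t₁ t₂) (fun t ht => h0.trans ht.1) hE
  refine hm.injOn ⟨le_rfl, h12⟩ ⟨h12, le_rfl⟩ ?_
  rw [(bdryFun_eq_zero_iff hb (hE _ ⟨le_rfl, h12⟩)).1 h1,
    (bdryFun_eq_zero_iff hb (hE _ ⟨h12, le_rfl⟩)).1 h2]

/-- The left end of the `i`-th interval between the zeros `j`. -/
def leftEnd (j : ℕ → ℝ) : ℕ → ℝ
  | 0 => 0
  | i + 1 => j i

theorem leftEnd_nonneg {p : ℕ} {j : ℕ → ℝ} (hz : ∀ t, bessel p t = 0 ↔ ∃ i, j i = t) (i : ℕ) :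
    0 ≤ leftEnd j i := by
  cases i with
  | zero => exact le_rfl
  | succ i => exact (pos_of_bessel_eq_zero ((hz _).2 ⟨i, rfl⟩)).le

theorem bessel_ne_zero_between {p : ℕ} {j : ℕ → ℝ} (hj : StrictMono j)
    (hz : ∀ t, bessel p t = 0 ↔ ∃ i, j i = t) {i : ℕ} {t : ℝ} (h1 : leftEnd j i < t)
    (h2 : t < j i) : bessel p t ≠ 0 := by
  intro h
  obtain ⟨n, rfl⟩ := (hz t).1 h
  have hn := hj.lt_iff_lt.1 h2
  cases i with
  | zero => omega
  | succ i =>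
    have := hj.lt_iff_lt.1 h1
    omega

theorem leftEnd_lt {p : ℕ} {j : ℕ → ℝ} (hj : StrictMono j)
    (hz : ∀ t, bessel p t = 0 ↔ ∃ i, j i = t) (i : ℕ) : leftEnd j i < j i := by
  cases i with
  | zero => exact pos_of_bessel_eq_zero ((hz _).2 ⟨0, rfl⟩)
  | succ i => exact hj i.lt_succ_self

/-- At a zero `z` of `E` the boundary function equals `2bzE'(z)`, and these values alternate in sign
along consecutive zeros. On the first gap the left value is `c ≥ 0` and the right one is negative.
The left end itself is the root when `c = 0`, which is why the gaps are taken half-open. -/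
theorem exists_root_between {p : ℕ} {j : ℕ → ℝ} (hj : StrictMono j)
    (hz : ∀ t, bessel p t = 0 ↔ ∃ i, j i = t) {c b : ℝ} (hc : 0 ≤ c) (hb : 0 < b) (i : ℕ) :
    ∃ t, leftEnd j i ≤ t ∧ t < j i ∧ bdryFun p c b t = 0 := by
  have hlt := leftEnd_lt hj hz i
  have hji := (hz _).2 ⟨i, rfl⟩
  have hjpos := pos_of_bessel_eq_zero hji
  have hR : bdryFun p c b (j i) ≠ 0 := fun h => bessel_ne_zero_of_bdryFun hb.ne' h hji
  suffices h : ∃ t ∈ Icc (leftEnd j i) (j i), bdryFun p c b t = 0 by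
    obtain ⟨t, ht, h0⟩ := h
    exact ⟨t, ht.1, ht.2.lt_of_ne fun h => hR (h ▸ h0), h0⟩
  have hcont := (continuous_bdryFun p c b).continuousOn (s := Icc (leftEnd j i) (j i))
  cases i with
  | zero =>
    have hpos : ∀ t ∈ Ioo 0 (j 0), 0 < bessel p t := by
      intro t ht
      by_contra! hle
      obtain ⟨z, hz1, hz0⟩ := isPreconnected_Icc.intermediate_value (s := Icc 0 t)
        ⟨ht.1.le, le_rfl⟩ ⟨le_rfl, ht.1.le⟩ (continuous_bessel p).continuousOn
        ⟨hle, by rw [bessel_zero]; exact zero_le_one⟩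
      exact bessel_ne_zero_between hj hz (pos_of_bessel_eq_zero hz0) (hz1.2.trans_lt ht.2) hz0
    have hd : besselDeriv p (j 0) < 0 := by
      refine lt_of_le_of_ne ?_ (besselDeriv_ne_zero hji)
      have h2 := hasDerivAt_iff_tendsto_slope.1 (hasDerivAt_bessel' p (j 0))
      have hle : 𝓝[<] (j 0) ≤ 𝓝[≠] (j 0) := nhdsWithin_mono _ fun y (hy : y < j 0) => hy.ne
      refine le_of_tendsto (h2.mono_left hle) ?_
      filter_upwards [Ioo_mem_nhdsLT hjpos] with y hy
      rw [slope_def_field, hji, sub_zero]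
      exact div_nonpos_of_nonneg_of_nonpos (hpos y hy).le (sub_nonpos.2 hy.2.le)
    refine intermediate_value_Icc' hlt.le hcont ⟨?_, ?_⟩
    · rw [bdryFun, hji]
      have := mul_neg_of_pos_of_neg (mul_pos (mul_pos two_pos hb) hjpos) hd
      linarith
    · exact (bdryFun_zero p c b).symm ▸ hc
  | succ i =>
    have hji' := (hz _).2 ⟨i, rfl⟩
    have hjpos' := pos_of_bessel_eq_zero hji'
    have hmul := besselDeriv_mul_neg hlt hji' hji fun t ht =>
      bessel_ne_zero_between hj hz ht.1 ht.2
    have h1 : bdryFun p c b (leftEnd j (i + 1)) = 2 * b * j i * besselDeriv p (j i) := by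
      rw [leftEnd, bdryFun, hji']; ring
    have h2 : bdryFun p c b (j (i + 1)) = 2 * b * j (i + 1) * besselDeriv p (j (i + 1)) := by
      rw [bdryFun, hji]; ring
    rcases mul_neg_iff.1 hmul with ⟨h3, h4⟩ | ⟨h3, h4⟩
    · refine intermediate_value_Icc' hlt.le hcont ⟨?_, ?_⟩
      · rw [h2]
        exact (mul_neg_of_pos_of_neg (by positivity) h4).le
      · rw [h1]
        exact (mul_pos (by positivity) h3).le
    · refine intermediate_value_Icc hlt.le hcont ⟨?_, ?_⟩
      · rw [h1]
        exact (mul_neg_of_pos_of_neg (by positivity) h3).le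
      · rw [h2]
        exact (mul_pos (by positivity) h4).le

theorem root_unique_between {p : ℕ} {j : ℕ → ℝ} (hj : StrictMono j)
    (hz : ∀ t, bessel p t = 0 ↔ ∃ i, j i = t) {c b : ℝ} (hb : 0 < b) {i : ℕ} {t₁ t₂ : ℝ}
    (h1 : leftEnd j i ≤ t₁) (h1' : t₁ < j i) (h1z : bdryFun p c b t₁ = 0)
    (h2 : leftEnd j i ≤ t₂) (h2' : t₂ < j i) (h2z : bdryFun p c b t₂ = 0) : t₁ = t₂ := by
  wlog h : t₁ ≤ t₂ generalizing t₁ t₂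
  · exact (this h2 h2' h2z h1 h1' h1z (le_of_not_ge h)).symm
  refine bdryFun_root_unique hb.ne' ((leftEnd_nonneg hz i).trans h1) h (fun t ht => ?_) h1z h2z
  rcases ht.1.eq_or_lt with rfl | hlt
  · exact bessel_ne_zero_of_bdryFun hb.ne' h1z
  · exact bessel_ne_zero_between hj hz (h1.trans_lt hlt) (ht.2.trans_lt h2')

theorem exists_leftEnd_le {p : ℕ} {j : ℕ → ℝ} (hz : ∀ t, bessel p t = 0 ↔ ∃ i, j i = t) {t : ℝ}
    (ht : 0 ≤ t) : ∃ i, leftEnd j i ≤ t ∧ t < j i := by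
  have hex : ∃ i, t < j i := by
    obtain ⟨y, hy, hy0⟩ := exists_bessel_eq_zero_gt p t
    obtain ⟨i, rfl⟩ := (hz y).1 hy0
    exact ⟨i, hy⟩
  classical
  refine ⟨Nat.find hex, ?_, Nat.find_spec hex⟩
  rcases hn : Nat.find hex with _ | n
  · exact ht
  · exact not_lt.1 (Nat.find_min hex (hn ▸ n.lt_succ_self))

/-- The root in the `i`-th gap is the local inverse of `besselLog p` at `c / b`. Smoothness is
claimed only for `c > 0`, since at `c = 0` the first root sits at the end of its gap. -/
theorem exists_roots (p : ℕ) {b : ℝ} (hb : 0 < b) :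
    ∃ τ : ℕ → ℝ → ℝ, (∀ c, 0 ≤ c → StrictMono (fun i => τ i c) ∧
      ∀ t, bdryFun p c b t = 0 ↔ ∃ i, τ i c = t) ∧ ∀ i, ContDiffOn ℝ ∞ (τ i) (Ioi 0) := by
  obtain ⟨j, hj, hz⟩ := exists_bessel_zeros p
  have hex : ∀ (i : ℕ) (c : ℝ), ∃ t, 0 ≤ c → leftEnd j i ≤ t ∧ t < j i ∧ bdryFun p c b t = 0 := by
    intro i c
    by_cases hc : 0 ≤ c
    · obtain ⟨t, ht⟩ := exists_root_between hj hz hc hb i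
      exact ⟨t, fun _ => ht⟩
    · exact ⟨0, fun h => absurd h hc⟩
  choose τ hτ using hex
  refine ⟨τ, fun c hc => ⟨strictMono_nat_of_lt_succ fun i => ?_, fun t => ⟨fun h => ?_, ?_⟩⟩,
    fun i c₀ hc₀ => ContDiffAt.contDiffWithinAt ?_⟩
  · exact (hτ i c hc).2.1.trans_le (hτ (i + 1) c hc).1
  · obtain ⟨i, h1, h2⟩ := exists_leftEnd_le hz (nonneg_of_bdryFun_eq_zero hc hb.le (by linarith) h)
    have := hτ i c hc
    exact ⟨i, root_unique_between hj hz hb this.1 this.2.1 this.2.2 h1 h2 h⟩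
  · rintro ⟨i, rfl⟩
    exact (hτ i c hc).2.2
  · have hc₀ : 0 < c₀ := hc₀
    obtain ⟨h1, h2, h3⟩ := hτ i c₀ hc₀.le
    set t₀ := τ i c₀
    have hE : bessel p t₀ ≠ 0 := bessel_ne_zero_of_bdryFun hb.ne' h3
    have h1' : leftEnd j i < t₀ := by
      refine h1.lt_of_ne fun h => ?_
      cases i with
      | zero =>
        rw [← h, leftEnd, bdryFun_zero] at h3
        exact hc₀.ne' h3
      | succ i => exact hE ((hz _).2 ⟨i, h⟩)
    have ht₀ : 0 < t₀ := (leftEnd_nonneg hz i).trans_lt h1'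
    have hsm : ContDiffAt ℝ ∞ (besselLog p) t₀ := by
      refine (ContDiffAt.div ?_ (contDiff_bessel p).contDiffAt hE).neg
      exact ((contDiff_const.mul contDiff_id).mul (contDiff_besselDeriv p)).contDiffAt
    have hd := hasDerivAt_besselLog hE
    have hd0 : 2 * besselForm p t₀ / bessel p t₀ ^ 2 ≠ 0 := by
      have := besselForm_pos (p := p) ht₀.le
      positivity
    have hd' : HasFDerivAt (besselLog p)
        (ContinuousLinearEquiv.unitsEquivAut ℝ (Units.mk0 _ hd0) : ℝ →L[ℝ] ℝ) t₀ := hd.hasFDerivAt.congr_fderiv (by ext; simp)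
    have hn : (∞ : WithTop ℕ∞) ≠ 0 := by simp
    have hinv := hsm.to_localInverse hd' hn
    have hstrict := hsm.hasStrictFDerivAt' hd' hn
    have hv : besselLog p t₀ = c₀ / b := (bdryFun_eq_zero_iff hb.ne' hE).1 h3
    have hcomp : ContDiffAt ℝ ∞ (fun c => hsm.localInverse hd' hn (c / b)) c₀ := by
      refine ContDiffAt.comp (g := hsm.localInverse hd' hn) c₀ ?_ (contDiffAt_id.div_const b)
      exact (show c₀ / b = besselLog p t₀ from hv.symm) ▸ hinv
    refine hcomp.congr_of_eventuallyEq ?_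
    have hdiv : Tendsto (fun c : ℝ => c / b) (𝓝 c₀) (𝓝 (besselLog p t₀)) := by
      rw [hv]
      exact (continuous_id.div_const b).tendsto c₀
    have hev1 := hdiv.eventually hstrict.eventually_right_inverse
    -- Keeps the local inverse inside the same open gap, where uniqueness identifies it with the
    -- chosen root.
    have hev2 : ∀ᶠ c in 𝓝 c₀, hsm.localInverse hd' hn (c / b) ∈ Ioo (leftEnd j i) (j i) := by
      refine hcomp.continuousAt.eventually_mem (Ioo_mem_nhds ?_ ?_)
      all_goals
        rw [← hv, hsm.localInverse_apply_image hd' hn]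
        assumption
    filter_upwards [hev1, hev2, lt_mem_nhds hc₀] with c e1 e2 e3
    obtain ⟨k1, k2, k3⟩ := hτ i c e3.le
    refine root_unique_between hj hz hb k1 k2 k3 e2.1.le e2.2 ?_
    exact (bdryFun_eq_zero_iff hb.ne' (bessel_ne_zero_between hj hz e2.1 e2.2)).2 e1

/-- The numbers `λ` for which `r^s E(λr²)` satisfies the boundary condition are enumerated by
smooth functions of the radius `r`. -/
theorem exists_eigenvalue_branches (p s : ℕ) (bc : BoundaryCondition) :
    ∃ e : ℕ → ℝ → ℝ, (∀ r, 0 < r → StrictMono (fun i => e i r) ∧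
      ∀ lam, bdryFun p (bc.a * r + bc.b * s) bc.b (lam * r ^ 2) = 0 ↔ ∃ i, e i r = lam) ∧
      ∀ i, ContDiffOn ℝ ∞ (e i) (Ioi 0) := by
  have key : ∃ τ : ℕ → ℝ → ℝ, (∀ r, 0 < r → StrictMono (fun i => τ i r) ∧
      ∀ t, bdryFun p (bc.a * r + bc.b * s) bc.b t = 0 ↔ ∃ i, τ i r = t) ∧
      ∀ i, ContDiffOn ℝ ∞ (τ i) (Ioi 0) := by
    have ha := bc.a_nonneg
    -- For `b = 0` the roots are the zeros of `E` and do not depend on the radius.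
    rcases bc.b_nonneg.eq_or_lt with hb | hb
    · obtain ⟨j, hj, hz⟩ := exists_bessel_zeros p
      refine ⟨fun i _ => j i, fun r hr => ⟨hj, fun t => ?_⟩, fun i => contDiffOn_const⟩
      rw [← hz, bdryFun, ← hb]
      have : bc.a ≠ 0 := by
        have := bc.pos
        rw [← hb, add_zero] at this
        exact this.ne'
      simp [this, hr.ne']
    · obtain ⟨τ, h1, h2⟩ := exists_roots p hb
      refine ⟨fun i r => τ i (bc.a * r + bc.b * s), fun r hr => h1 _ (by positivity), fun i => ?_⟩
      -- For `a = 0` the parameter `b s` may be zero, where smoothness in the parameter is not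
      -- available, but it is constant in `r`. For `a > 0` the parameter stays positive.
      rcases ha.eq_or_lt with ha | ha
      · simp only [← ha, zero_mul, zero_add]
        exact contDiffOn_const
      · refine (h2 i).comp (by fun_prop) fun r hr => ?_
        have : 0 < r := hr
        exact mem_Ioi.2 (by positivity)
  obtain ⟨τ, h1, h2⟩ := key
  refine ⟨fun i r => τ i r / r ^ 2, fun r hr => ⟨fun i k hik => ?_, fun lam => ?_⟩, fun i => ?_⟩
  · exact div_lt_div_of_pos_right ((h1 r hr).1 hik) (by positivity)
  · rw [(h1 r hr).2]
    refine exists_congr fun i => ?_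
    rw [div_eq_iff (by positivity)]
  · refine (h2 i).div (by fun_prop) fun r hr => ?_
    have : 0 < r := hr
    positivity

end ZBall
end

noncomputable section
namespace ZBall
open Filter Topology

/-! ### Hilbert–Schmidt operators -/

section HilbertSchmidt

variable {H : Type*} [NormedAddCommGroup H] [InnerProductSpace ℝ H] [CompleteSpace H]

/-- An operator with uniformly bounded sums `∑ ‖A eᵢ‖²` over the finite orthonormal families is
compact. -/
theorem isCompactOperator_of_sum_sq_le (A : H →L[ℝ] H) (M : ℝ)
    (hA : ∀ (w : Set H) (e : w → H) (s : Finset w), Orthonormal ℝ e →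
      ∑ i ∈ s, ‖A (e i)‖ ^ 2 ≤ M) : IsCompactOperator A := by
  classical
  obtain ⟨w, b, -⟩ := exists_hilbertBasis ℝ H
  have hsum : Summable fun i => ‖A (b i)‖ ^ 2 :=
    summable_of_sum_le (fun i => by positivity) fun s => hA _ _ s b.orthonormal
  -- Finite-rank truncations. By the Cauchy–Schwarz and Bessel inequalities the error is at most the
  -- square root of a tail of `∑ ‖A bᵢ‖²`, so they converge to `A` in norm.
  set F : Finset w → H →L[ℝ] H := fun s => ∑ i ∈ s, (innerSL ℝ (b i)).smulRight (A (b i))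
  have hF : ∀ s f, F s f = ∑ i ∈ s, inner ℝ (b i) f • A (b i) := fun s f => by
    simp [F]
  have hlim : ∀ f, Tendsto (fun s => F s f) atTop (𝓝 (A f)) := fun f => by
    have := (b.hasSum_repr f).mapL A
    simp only [map_smul, b.repr_apply_apply] at this
    simp only [hF]
    exact this
  have hcs : ∀ (t : Finset w) f,
      ‖∑ i ∈ t, inner ℝ (b i) f • A (b i)‖ ≤ ‖f‖ * √(∑ i ∈ t, ‖A (b i)‖ ^ 2) := fun t f => by
    calc ‖∑ i ∈ t, inner ℝ (b i) f • A (b i)‖ ≤ ∑ i ∈ t, ‖inner ℝ (b i) f‖ * ‖A (b i)‖ :=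
          (norm_sum_le _ _).trans_eq (Finset.sum_congr rfl fun i _ => norm_smul _ _)
      _ ≤ √(∑ i ∈ t, ‖inner ℝ (b i) f‖ ^ 2) * √(∑ i ∈ t, ‖A (b i)‖ ^ 2) :=
          Real.sum_mul_le_sqrt_mul_sqrt _ _ _
      _ ≤ _ := by
          gcongr
          exact Real.sqrt_le_iff.2 ⟨norm_nonneg f, b.orthonormal.sum_inner_products_le f⟩
  refine isCompactOperator_of_tendsto (l := atTop) (F := F) ?_ (.of_forall fun s => ?_)
  · rw [Metric.tendsto_atTop]
    intro ε hε
    obtain ⟨s, hs⟩ := summable_iff_vanishing_norm.1 hsum ((ε / 2) ^ 2) (by positivity)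
    refine ⟨s, fun t ht => ?_⟩
    rw [dist_eq_norm]
    refine lt_of_le_of_lt (ContinuousLinearMap.opNorm_le_bound _ (half_pos hε).le fun f => ?_)
      (half_lt_self hε)
    rw [← norm_neg, ← neg_apply, neg_sub]
    have h1 : Tendsto (fun t' => (F t' - F t) f) atTop (𝓝 ((A - F t) f)) :=
      (hlim f).sub tendsto_const_nhds
    refine le_of_tendsto h1.norm ?_
    filter_upwards [eventually_ge_atTop t] with t' ht'
    have h2 : (F t' - F t) f = ∑ i ∈ t' \ t, inner ℝ (b i) f • A (b i) := by
      rw [sub_apply, hF, hF, ← Finset.sum_sdiff ht', add_sub_cancel_right]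
    rw [h2, mul_comm]
    refine (hcs _ f).trans ?_
    gcongr
    rw [Real.sqrt_le_left (half_pos hε).le]
    have h3 := hs (t' \ t) (Finset.disjoint_of_subset_right ht Finset.sdiff_disjoint)
    exact (le_abs_self _).trans h3.le
  · refine sum_mem (S := compactOperator (RingHom.id ℝ) H H) fun i _ => ?_
    have h1 : IsCompactOperator ((ContinuousLinearMap.id ℝ ℝ).smulRight (A (b i))) :=
      isCompactOperator_of_locallyCompactSpace_rng _
    exact h1.comp_clm (innerSL ℝ (b i))

end HilbertSchmidt

section Kernel

variable {α : Type*} [MeasurableSpace α] {μ : Measure α} [IsFiniteMeasure μ]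

/-- Turns each section of a kernel into a vector of `L²`, so that norm bounds and the Bessel
inequality apply pointwise in the other variable. -/
theorem exists_inner_eq_integral {k : α → ℝ} (hk : Measurable k) (hk1 : ∀ y, |k y| ≤ 1) :
    ∃ g : Lp ℝ 2 μ, ‖g‖ ^ 2 ≤ μ.real univ ∧
      ∀ f : Lp ℝ 2 μ, ∫ y, k y * f y ∂μ = inner ℝ g f := by
  have hm : MemLp k 2 μ := .of_bound hk.aestronglyMeasurable 1 (.of_forall hk1)
  refine ⟨hm.toLp k, ?_, fun f => ?_⟩
  · rw [← real_inner_self_eq_norm_sq, L2.inner_def]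
    have h1 : ∫ a, inner ℝ (hm.toLp k a) (hm.toLp k a) ∂μ = ∫ a, k a * k a ∂μ := by
      refine integral_congr_ae ?_
      filter_upwards [hm.coeFn_toLp] with a ha
      simp [ha, sq]
    rw [h1]
    calc ∫ a, k a * k a ∂μ ≤ ∫ a, (1 : ℝ) ∂μ := by
          refine integral_mono (hm.integrable_mul hm) (integrable_const 1) fun a => ?_
          have := hk1 a
          simp only [← sq]
          exact (sq_le_one_iff_abs_le_one _).2 this
      _ = μ.real univ := by simp
  · rw [L2.inner_def]
    refine integral_congr_ae ?_
    filter_upwards [hm.coeFn_toLp] with a ha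
    simp [ha, mul_comm]

/-- The compact operator on `L²` with a bounded integral kernel. -/
theorem exists_kernel_operator {k : α → α → ℝ} (hk : Measurable (Function.uncurry k))
    (hk1 : ∀ x y, |k x y| ≤ 1) :
    ∃ A : Lp ℝ 2 μ →L[ℝ] Lp ℝ 2 μ, IsCompactOperator A ∧
      ∀ f, A f =ᵐ[μ] fun x => ∫ y, k x y * f y ∂μ := by
  choose g hg1 hg2 using fun x => exists_inner_eq_integral (μ := μ) (hk.of_uncurry_left (x := x))
    (hk1 x)
  have hgn : ∀ x, ‖g x‖ ≤ √(μ.real univ) := fun x => Real.le_sqrt_of_sq_le (hg1 x)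
  have hmem : ∀ f : Lp ℝ 2 μ, MemLp (fun x => ∫ y, k x y * f y ∂μ) 2 μ := fun f => by
    have hsm : StronglyMeasurable fun x => ∫ y, k x y * f y ∂μ := by
      refine StronglyMeasurable.integral_prod_right' (f := fun z : α × α => k z.1 z.2 * f z.2) ?_
      exact (hk.mul ((Lp.stronglyMeasurable f).measurable.comp measurable_snd)).stronglyMeasurable
    refine .of_bound hsm.aestronglyMeasurable (√(μ.real univ) * ‖f‖) (.of_forall fun x => ?_)
    rw [hg2]
    exact (norm_inner_le_norm _ _).trans (by gcongr; exact hgn x)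
  set A₀ : Lp ℝ 2 μ →ₗ[ℝ] Lp ℝ 2 μ :=
    { toFun := fun f => (hmem f).toLp _
      map_add' := fun f f' => by
        rw [← MemLp.toLp_add (hmem f) (hmem f')]
        refine MemLp.toLp_congr _ _ (.of_forall fun x => ?_)
        simp only [hg2, Pi.add_apply, inner_add_right]
      map_smul' := fun c f => by
        rw [RingHom.id_apply, ← MemLp.toLp_const_smul c (hmem f)]
        refine MemLp.toLp_congr _ _ (.of_forall fun x => ?_)
        simp only [hg2, Pi.smul_apply, inner_smul_right, smul_eq_mul] }
  have hA₀ : ∀ f, A₀ f =ᵐ[μ] fun x => ∫ y, k x y * f y ∂μ := fun f => (hmem f).coeFn_toLp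
  have hsq : ∀ f, ‖A₀ f‖ ^ 2 = ∫ x, (inner ℝ (g x) f) ^ 2 ∂μ := fun f => by
    rw [← real_inner_self_eq_norm_sq, L2.inner_def]
    refine integral_congr_ae ?_
    filter_upwards [hA₀ f] with x hx
    rw [hx, hg2]
    simp [sq]
  have hbound : ∀ f, ‖A₀ f‖ ≤ μ.real univ * ‖f‖ := fun f => by
    refine abs_le_of_sq_le_sq' ?_ (by positivity) |>.2
    rw [hsq]
    calc ∫ x, (inner ℝ (g x) f) ^ 2 ∂μ ≤ ∫ x, μ.real univ * ‖f‖ ^ 2 ∂μ := by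
          refine integral_mono_of_nonneg (.of_forall fun x => by positivity)
            (integrable_const _) (.of_forall fun x => ?_)
          have h1 := real_inner_mul_inner_self_le (g x) f
          have h2 := hg1 x
          simp only [real_inner_self_eq_norm_sq] at h1
          simp only [sq] at h1 h2 ⊢
          exact h1.trans (mul_le_mul_of_nonneg_right h2 (by positivity))
      _ = (μ.real univ * ‖f‖) ^ 2 := by simp; ring
  refine ⟨A₀.mkContinuous _ hbound, ?_, hA₀⟩
  -- For each `x` the Bessel inequality bounds `∑ ⟨g x, eᵢ⟩²` by `‖g x‖²`; integrating over `x`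
  -- gives the Hilbert–Schmidt bound.
  refine isCompactOperator_of_sum_sq_le _ (μ.real univ * μ.real univ) fun w e s he => ?_
  have hint : ∀ i, Integrable (fun x => (inner ℝ (g x) (e i)) ^ 2) μ := fun i => by
    have := (hmem (e i)).integrable_sq
    simpa only [hg2] using this
  calc ∑ i ∈ s, ‖A₀ (e i)‖ ^ 2 = ∫ x, ∑ i ∈ s, (inner ℝ (g x) (e i)) ^ 2 ∂μ := by
        rw [integral_finsetSum _ fun i _ => hint i]
        exact Finset.sum_congr rfl fun i _ => hsq (e i)
    _ ≤ ∫ x, μ.real univ ∂μ := by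
        refine integral_mono (integrable_finsetSum _ fun i _ => hint i) (integrable_const _)
          fun x => ?_
        refine le_trans (le_of_eq ?_) ((he.sum_inner_products_le (g x) (s := s)).trans (hg1 x))
        refine Finset.sum_congr rfl fun i _ => ?_
        rw [real_inner_comm, Real.norm_eq_abs, sq_abs]
    _ = μ.real univ * μ.real univ := by simp

/-- Fubini; it identifies the operator with transposed kernel as the adjoint. -/
theorem inner_kernel_operator {k : α → α → ℝ} (hk : Measurable (Function.uncurry k))
    (hk1 : ∀ x y, |k x y| ≤ 1) {A : Lp ℝ 2 μ →L[ℝ] Lp ℝ 2 μ}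
    (hA : ∀ f, A f =ᵐ[μ] fun x => ∫ y, k x y * f y ∂μ) (g h : Lp ℝ 2 μ) :
    inner ℝ (A g) h = ∫ y, g y * ∫ x, k x y * h x ∂μ ∂μ := by
  have hg : Integrable g μ := (Lp.memLp g).integrable (by norm_num)
  have hh : Integrable h μ := (Lp.memLp h).integrable (by norm_num)
  have hint : Integrable (fun z : α × α => k z.1 z.2 * (h z.1 * g z.2)) (μ.prod μ) :=
    (hh.mul_prod hg).bdd_mul hk.aestronglyMeasurable (c := 1) (.of_forall fun z => hk1 z.1 z.2)
  calc inner ℝ (A g) h = ∫ x, ∫ y, k x y * (h x * g y) ∂μ ∂μ := by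
        rw [L2.inner_def]
        refine integral_congr_ae ?_
        filter_upwards [hA g] with x hx
        rw [hx, RCLike.inner_apply, conj_trivial, mul_comm, ← integral_mul_const]
        refine integral_congr_ae (.of_forall fun y => ?_)
        simp only
        ring
    _ = ∫ y, ∫ x, k x y * (h x * g y) ∂μ ∂μ := integral_integral_swap hint
    _ = _ := by
        refine integral_congr_ae (.of_forall fun y => ?_)
        simp only
        rw [← integral_const_mul]
        refine integral_congr_ae (.of_forall fun x => ?_)
        simp only
        ring

end Kernel

end ZBall
end

noncomputable section
namespace ZBall
open Filter Topology

/-! ### Completeness of the radial eigenfunctions -/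

section Green

/-- The Volterra kernel `w(y)/w(x)` on `0 < y < x`. -/
def volterraKernel (w : ℝ → ℝ) (x y : ℝ) : ℝ :=
  if 0 < y ∧ y < x then w y / w x else 0

theorem measurable_volterraKernel {w : ℝ → ℝ} (hw : Measurable w) :
    Measurable (Function.uncurry (volterraKernel w)) := by
  refine Measurable.ite ?_ ?_ measurable_const
  · exact (measurableSet_lt measurable_const measurable_snd).inter
      (measurableSet_lt measurable_snd measurable_fst)
  · exact (hw.comp measurable_snd).div (hw.comp measurable_fst)

theorem abs_volterraKernel_le {w : ℝ → ℝ} (hpos : ∀ x, 0 < x → 0 < w x)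
    (hmono : MonotoneOn w (Ioi 0)) (x y : ℝ) : |volterraKernel w x y| ≤ 1 := by
  rw [volterraKernel]
  split_ifs with h
  · have hx := h.1.trans h.2
    rw [abs_of_pos (div_pos (hpos y h.1) (hpos x hx)), div_le_one (hpos x hx)]
    exact hmono h.1 hx h.2.le
  · simp

variable {w : ℝ → ℝ} {r : ℝ}

theorem integral_volterraKernel {x : ℝ} (hx : x ∈ Ioo 0 r) (f : ℝ → ℝ) :
    ∫ y in Ioo 0 r, volterraKernel w x y * f y = (∫ y in 0..x, w y * f y) / w x := by
  rw [intervalIntegral.integral_of_le hx.1.le, integral_Ioc_eq_integral_Ioo, div_eq_mul_inv, ← integral_mul_const,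
    ← integral_indicator measurableSet_Ioo, ← integral_indicator measurableSet_Ioo]
  congr 1
  ext y
  by_cases h : y ∈ Ioo 0 x
  · rw [indicator_of_mem h, indicator_of_mem (Ioo_subset_Ioo_right hx.2.le h), volterraKernel,
      if_pos (mem_Ioo.1 h)]
    ring
  · rw [indicator_of_notMem h]
    by_cases h' : y ∈ Ioo 0 r
    · rw [indicator_of_mem h', volterraKernel, if_neg (mt mem_Ioo.2 h), zero_mul]
    · rw [indicator_of_notMem h']

theorem integral_volterraKernel' {z : ℝ} (hz : z ∈ Ioo 0 r) (f : ℝ → ℝ) :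
    ∫ x in Ioo 0 r, volterraKernel w x z * f x = w z * ∫ x in z..r, f x / w x := by
  rw [intervalIntegral.integral_of_le hz.2.le, integral_Ioc_eq_integral_Ioo, ← integral_const_mul,
    ← integral_indicator measurableSet_Ioo, ← integral_indicator measurableSet_Ioo]
  congr 1
  ext x
  by_cases h : x ∈ Ioo z r
  · rw [indicator_of_mem h, indicator_of_mem (Ioo_subset_Ioo_left hz.1.le h), volterraKernel,
      if_pos ⟨hz.1, h.1⟩]
    ring
  · rw [indicator_of_notMem h]
    by_cases h' : x ∈ Ioo 0 r
    · rw [indicator_of_mem h', volterraKernel, if_neg fun h2 => h ⟨h2.2, h'.2⟩, zero_mul]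
    · rw [indicator_of_notMem h']

theorem memLp_weight (hr : 0 < r) (hw : Measurable w) (hpos : ∀ x, 0 < x → 0 < w x)
    (hmono : MonotoneOn w (Ioi 0)) : MemLp w 2 (volume.restrict (Ioo 0 r)) := by
  refine .of_bound hw.aestronglyMeasurable (w r) ?_
  filter_upwards [ae_restrict_mem measurableSet_Ioo] with x hx
  rw [Real.norm_eq_abs, abs_of_pos (hpos x hx.1)]
  exact hmono hx.1 hr hx.2.le

theorem intervalIntegrable_weight_mul (hr : 0 < r) (hw : Measurable w)
    (hpos : ∀ x, 0 < x → 0 < w x) (hmono : MonotoneOn w (Ioi 0))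
    (f : Lp ℝ 2 (volume.restrict (Ioo 0 r))) :
    IntegrableOn (fun x => w x * f x) (Icc 0 r) := by
  rw [integrableOn_Icc_iff_integrableOn_Ioo]
  exact (memLp_weight hr hw hpos hmono).integrable_mul (Lp.memLp f)

/-- The Green operator of the weight `w`: its eigenfunctions have an explicit continuous form, and
no function is orthogonal to all of them. -/
theorem green_complete (hr : 0 < r) (hw : Measurable w) (hpos : ∀ x, 0 < x → 0 < w x)
    (hmono : MonotoneOn w (Ioi 0)) {γ : ℝ} (hγ : 0 ≤ γ)
    {h : Lp ℝ 2 (volume.restrict (Ioo 0 r))}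
    (horth : ∀ (f : Lp ℝ 2 (volume.restrict (Ioo 0 r))) (m : ℝ), m ≠ 0 →
      (f =ᵐ[volume.restrict (Ioo 0 r)] fun z => m * (w z *
        ((∫ x in z..r, (∫ y in 0..x, w y * f y) / w x ^ 2) + γ * ∫ y in 0..r, w y * f y))) →
      inner ℝ f h = 0) : h = 0 := by
  obtain ⟨A, hAc, hA⟩ := exists_kernel_operator (μ := volume.restrict (Ioo 0 r)) (measurable_volterraKernel hw)
    (abs_volterraKernel_le hpos hmono)
  obtain ⟨A', -, hA'⟩ := exists_kernel_operator (μ := volume.restrict (Ioo 0 r)) (k := fun x y => volterraKernel w y x)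
    ((measurable_volterraKernel hw).comp measurable_swap)
    (fun x y => abs_volterraKernel_le hpos hmono y x)
  have hadj : ∀ f g, inner ℝ (A g) f = inner ℝ g (A' f) := fun f g => by
    rw [inner_kernel_operator (measurable_volterraKernel hw) (abs_volterraKernel_le hpos hmono) hA,
      L2.inner_def]
    refine integral_congr_ae ?_
    filter_upwards [hA' f] with x hx
    rw [hx, RCLike.inner_apply, conj_trivial, mul_comm]
  have hwm := memLp_weight hr hw hpos hmono
  set W := hwm.toLp w
  have hWf : ∀ f : Lp ℝ 2 (volume.restrict (Ioo 0 r)), inner ℝ W f = ∫ y in 0..r, w y * f y := fun f => by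
    rw [intervalIntegral.integral_of_le hr.le, integral_Ioc_eq_integral_Ioo, L2.inner_def]
    refine integral_congr_ae ?_
    filter_upwards [hwm.coeFn_toLp] with x hx
    rw [RCLike.inner_apply, conj_trivial, mul_comm, hx]
  -- `A'` is the adjoint of `A`, so `⟨f, T f⟩ = ‖A f‖² + γ⟨W, f⟩²`. The rank-one term carries the
  -- boundary condition at `r`.
  set T : Lp ℝ 2 (volume.restrict (Ioo 0 r)) →L[ℝ] Lp ℝ 2 (volume.restrict (Ioo 0 r)) := A' ∘L A + γ • (innerSL ℝ W).smulRight W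
  have hTapp : ∀ f, T f = A' (A f) + (γ * inner ℝ W f) • W := fun f => by
    simp [T, smul_smul]
  have hTin : ∀ g f, inner ℝ g (T f) = inner ℝ (A g) (A f) + γ * (inner ℝ W f * inner ℝ W g) :=
    fun g f => by
      rw [hTapp, inner_add_right, ← hadj, inner_smul_right, real_inner_comm W g]
      ring
  have hTc : IsCompactOperator T := by
    refine (hAc.clm_comp A').add ?_
    have h1 : IsCompactOperator ((ContinuousLinearMap.id ℝ ℝ).smulRight W) :=
      isCompactOperator_of_locallyCompactSpace_rng _
    exact (h1.comp_clm (innerSL ℝ W)).smul γ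
  have hTs : T.IsSymmetric := fun f g => by
    change inner ℝ (T f) g = inner ℝ f (T g)
    rw [real_inner_comm, hTin, hTin, real_inner_comm (A f)]
    ring
  have hTae : ∀ f, T f =ᵐ[(volume.restrict (Ioo 0 r))] fun z => w z *
      ((∫ x in z..r, (∫ y in 0..x, w y * f y) / w x ^ 2) + γ * ∫ y in 0..r, w y * f y) :=
    fun f => by
      rw [hTapp]
      filter_upwards [Lp.coeFn_add (A' (A f)) ((γ * inner ℝ W f) • W),
        Lp.coeFn_smul (γ * inner ℝ W f) W, hA' (A f), hwm.coeFn_toLp,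
        ae_restrict_mem measurableSet_Ioo] with z h1 h2 h3 h4 hz
      rw [h1, Pi.add_apply, h2, Pi.smul_apply, h3, h4, integral_volterraKernel' hz, hWf, smul_eq_mul,
        mul_add]
      congr 1
      · congr 1
        rw [intervalIntegral.integral_of_le hz.2.le, intervalIntegral.integral_of_le hz.2.le, integral_Ioc_eq_integral_Ioo,
          integral_Ioc_eq_integral_Ioo]
        refine integral_congr_ae ?_
        have h5 := ae_restrict_of_ae_restrict_of_subset (Ioo_subset_Ioo_left hz.1.le) (hA f)
        filter_upwards [h5, ae_restrict_mem measurableSet_Ioo] with x h6 hx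
        rw [h6, integral_volterraKernel ⟨hz.1.trans hx.1, hx.2⟩, div_div, sq]
      · ring
  have hmem : h ∈ (⨆ m, Module.End.eigenspace (T : Module.End ℝ (Lp ℝ 2 (volume.restrict (Ioo 0 r)))) m)ᗮ := by
    rw [← Submodule.iInf_orthogonal, Submodule.mem_iInf]
    intro m
    rw [Submodule.mem_orthogonal]
    intro f hf
    have hf : T f = m • f := Module.End.mem_eigenspace_iff.1 hf
    by_cases hm : m = 0
    -- The kernel of `T` is trivial: `γ ≥ 0` gives `A f = 0`, so the primitive of `w f` vanishes on
    -- the interval, and Lebesgue differentiation gives `f = 0` almost everywhere.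
    · suffices h0 : f = 0 by rw [h0, inner_zero_left]
      have h1 := hTin f f
      rw [hf, hm, zero_smul, inner_zero_right, real_inner_self_eq_norm_sq] at h1
      have h2 : A f = 0 := by
        have : 0 ≤ γ * (inner ℝ W f * inner ℝ W f) := mul_nonneg hγ (mul_self_nonneg _)
        rw [← norm_eq_zero, ← sq_eq_zero_iff]
        nlinarith [sq_nonneg ‖A f‖]
      have hint := intervalIntegrable_weight_mul hr hw hpos hmono f
      have hcont := intervalIntegral.continuousOn_primitive_interval
        (by rwa [uIcc_of_le hr.le] : IntegrableOn (fun x => w x * f x) (uIcc 0 r))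
      rw [uIcc_of_le hr.le] at hcont
      have hFae : (fun x => ∫ y in 0..x, w y * f y) =ᵐ[(volume.restrict (Ioo 0 r))] fun _ => 0 := by
        have h3 := hA f
        rw [h2] at h3
        filter_upwards [h3, Lp.coeFn_zero ℝ 2 (volume.restrict (Ioo 0 r)), ae_restrict_mem measurableSet_Ioo] with x h4 h5 hx
        rw [integral_volterraKernel hx, h5, Pi.zero_apply, eq_comm, div_eq_zero_iff] at h4
        exact h4.resolve_right (hpos x hx.1).ne'
      have hF : EqOn (fun x => ∫ y in 0..x, w y * f y) (fun _ => 0) (Ioo 0 r) :=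
        Measure.eqOn_open_of_ae_eq hFae isOpen_Ioo (hcont.mono Ioo_subset_Icc_self)
          continuousOn_const
      rw [Lp.eq_zero_iff_ae_eq_zero]
      have hii : IntervalIntegrable (fun x => w x * f x) volume 0 r :=
        (intervalIntegrable_iff_integrableOn_Icc_of_le hr.le).2 hint
      filter_upwards [ae_restrict_of_ae hii.ae_hasDerivAt_integral,
        ae_restrict_mem measurableSet_Ioo] with x h3 hx
      have h4 := h3 (by rw [uIcc_of_le hr.le]; exact Ioo_subset_Icc_self hx) 0
        (by rw [uIcc_of_le hr.le]; exact ⟨le_rfl, hr.le⟩)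
      have h5 : HasDerivAt (fun x => ∫ y in 0..x, w y * f y) 0 x :=
        (hasDerivAt_const x (0 : ℝ)).congr_of_eventuallyEq
          (hF.eventuallyEq_of_mem (isOpen_Ioo.mem_nhds hx))
      exact (mul_eq_zero.1 (h4.unique h5)).resolve_left (hpos x hx.1).ne'
    · refine horth f m⁻¹ (inv_ne_zero hm) ?_
      have h1 := hTae f
      rw [hf] at h1
      filter_upwards [h1, Lp.coeFn_smul m f] with z h2 h3
      rw [← h2, h3, Pi.smul_apply, smul_eq_mul, inv_mul_cancel_left₀ hm]
  rw [ContinuousLinearMap.orthogonalComplement_iSup_eigenspaces_eq_bot hTc hTs] at hmem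
  exact (Submodule.mem_bot ℝ).1 hmem

end Green

end ZBall
end

/-! ### The Green operator of the radial equation at the parameter `-1`. -/

noncomputable section
namespace ZBall
open Filter Topology

/-- The positive solution `E(-x²)` of the radial equation with parameter `-1`. -/
def posSol (p : ℕ) (x : ℝ) : ℝ := bessel p (-1 * x ^ 2)

/-- The derivative of the positive solution. -/
def posSolDeriv (p : ℕ) (x : ℝ) : ℝ := 2 * (-1) * x * besselDeriv p (-1 * x ^ 2)

theorem hasDerivAt_posSol (p : ℕ) (x : ℝ) : HasDerivAt (posSol p) (posSolDeriv p x) x :=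
  hasDerivAt_bessel_sq p (-1) x

theorem hasDerivAt_posSol_flux (p : ℕ) (x : ℝ) :
    HasDerivAt (fun x => x ^ p * posSolDeriv p x) (x ^ p * posSol p x) x :=
  (hasDerivAt_flux p (-1) x).congr_deriv (by rw [posSol]; ring)

theorem one_le_posSol (p : ℕ) (x : ℝ) : 1 ≤ posSol p x :=
  one_le_bessel (by nlinarith [sq_nonneg x])

theorem posSolDeriv_pos {p : ℕ} {x : ℝ} (hx : 0 < x) : 0 < posSolDeriv p x := by
  have := besselDeriv_neg (p := p) (t := -1 * x ^ 2) (by nlinarith [sq_nonneg x])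
  rw [posSolDeriv]
  nlinarith

theorem monotoneOn_posSol (p : ℕ) : MonotoneOn (posSol p) (Ici 0) := by
  refine monotoneOn_of_deriv_nonneg (convex_Ici 0)
    (fun x _ => (hasDerivAt_posSol p x).continuousAt.continuousWithinAt)
    (fun x _ => (hasDerivAt_posSol p x).differentiableAt.differentiableWithinAt) fun x hx => ?_
  rw [interior_Ici] at hx
  rw [(hasDerivAt_posSol p x).deriv]
  exact (posSolDeriv_pos hx).le

theorem continuous_posSol (p : ℕ) : Continuous (posSol p) := by
  unfold posSol
  fun_prop

theorem continuous_posSolDeriv (p : ℕ) : Continuous (posSolDeriv p) := by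
  unfold posSolDeriv
  fun_prop

/-- The weight of the Green operator. -/
def greenWeight (p : ℕ) (x : ℝ) : ℝ := √(x ^ p) * posSol p x

theorem continuous_greenWeight (p : ℕ) : Continuous (greenWeight p) := by
  have := continuous_posSol p
  unfold greenWeight
  fun_prop

theorem greenWeight_pos {p : ℕ} {x : ℝ} (hx : 0 < x) : 0 < greenWeight p x :=
  mul_pos (Real.sqrt_pos.2 (pow_pos hx p)) (by linarith [one_le_posSol p x])

theorem greenWeight_sq {p : ℕ} {x : ℝ} (hx : 0 < x) :
    greenWeight p x ^ 2 = x ^ p * posSol p x ^ 2 := by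
  rw [greenWeight, mul_pow, Real.sq_sqrt (pow_pos hx p).le]

theorem monotoneOn_greenWeight (p : ℕ) : MonotoneOn (greenWeight p) (Ioi 0) := by
  intro x (hx : 0 < x) y (hy : 0 < y) hxy
  refine mul_le_mul (Real.sqrt_le_sqrt (pow_le_pow_left₀ hx.le hxy p))
    (monotoneOn_posSol p hx.le hy.le hxy) ?_ (Real.sqrt_nonneg _)
  linarith [one_le_posSol p x]

section Eigenfunction

variable {p : ℕ} {r γ m : ℝ} {f : ℝ → ℝ}

/-- An eigenfunction of the Green operator is a multiple of `E(λx²)`. -/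
theorem green_eigenfunction (hr : 0 < r) (hm : m ≠ 0)
    (hint : IntegrableOn (fun x => greenWeight p x * f x) (Icc 0 r))
    (hint' : IntegrableOn f (Ioo 0 r))
    (hf : f =ᵐ[volume.restrict (Ioo 0 r)] fun z => m * (greenWeight p z *
        ((∫ x in z..r, (∫ y in 0..x, greenWeight p y * f y) / greenWeight p x ^ 2) +
          γ * ∫ y in 0..r, greenWeight p y * f y))) :
    ∃ C F : ℝ, (f =ᵐ[volume.restrict (Ioo 0 r)]
        fun x => C * (√(x ^ p) * bessel p ((m - 1) * x ^ 2))) ∧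
      bessel p ((m - 1) * r ^ 2) * C = m * (posSol p r * (γ * F)) ∧
      2 * (m - 1) * r * besselDeriv p ((m - 1) * r ^ 2) * C =
        m * (posSolDeriv p r * (γ * F) - posSol p r * (F / greenWeight p r ^ 2)) := by
  set w := greenWeight p
  set F : ℝ → ℝ := fun x => ∫ y in 0..x, w y * f y
  -- With this notation the hypothesis reads `f = m w V`. Thus `F' = m w² V` and `V' = -F / w²`, a
  -- first-order system for the quotient of an eigenfunction by `posSol`.
  set V : ℝ → ℝ := fun z => (∫ x in z..r, F x / w x ^ 2) + γ * F r
  have hwc : Continuous w := continuous_greenWeight p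
  have hw0 : ∀ x, 0 < x → w x ≠ 0 := fun x hx => (greenWeight_pos hx).ne'
  have hFc : ContinuousOn F (Icc 0 r) := by
    have := intervalIntegral.continuousOn_primitive_interval
      (by rwa [uIcc_of_le hr.le] : IntegrableOn (fun x => w x * f x) (uIcc 0 r))
    rwa [uIcc_of_le hr.le] at this
  have hqc : ∀ z, 0 < z → ContinuousOn (fun x => F x / w x ^ 2) (Icc z r) := fun z hz =>
    (hFc.mono (Icc_subset_Icc_left hz.le)).div (hwc.pow 2).continuousOn fun x hx =>
      pow_ne_zero 2 (hw0 x (hz.trans_le hx.1))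
  have hqi : ∀ z ∈ Ioc 0 r, IntervalIntegrable (fun x => F x / w x ^ 2) volume z r :=
    fun z hz => (hqc z hz.1).intervalIntegrable_of_Icc hz.2
  have hV : ∀ z ∈ Ioo 0 r, HasDerivAt V (-(F z / w z ^ 2)) z := fun z hz => by
    obtain ⟨z', hz', hz'z⟩ := exists_between hz.1
    have hca : ContinuousAt (fun x => F x / w x ^ 2) z :=
      (hqc z' hz').continuousAt (Icc_mem_nhds hz'z hz.2)
    refine (intervalIntegral.integral_hasDerivAt_left (hqi z ⟨hz.1, hz.2.le⟩) ?_ hca).add_const _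
    exact ((hqc z' hz').mono Ioo_subset_Icc_self).stronglyMeasurableAtFilter isOpen_Ioo z
      ⟨hz'z, hz.2⟩
  have hVr : ContinuousWithinAt V (Iic r) r := by
    have h2 : IntegrableOn (fun x => F x / w x ^ 2) (uIcc (r / 2) r) := by
      rw [uIcc_of_le (by linarith)]
      exact (hqc (r / 2) (half_pos hr)).integrableOn_Icc
    have h1 := intervalIntegral.continuousOn_primitive_interval_left h2
    rw [uIcc_of_le (by linarith)] at h1
    have h3 := (h1 r ⟨by linarith, le_rfl⟩).add_const (γ * F r)
    exact h3.mono_of_mem_nhdsWithin (Icc_mem_nhdsLE (by linarith))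
  have hVcont : ∀ z ∈ Ioo 0 r, ContinuousAt V z := fun z hz => (hV z hz).continuousAt
  have hFi : ∀ x ∈ Icc 0 r, F x = ∫ y in 0..x, m * (w y ^ 2 * V y) := fun x hx => by
    simp only [F]
    rw [intervalIntegral.integral_of_le hx.1, intervalIntegral.integral_of_le hx.1,
      integral_Ioc_eq_integral_Ioo, integral_Ioc_eq_integral_Ioo]
    refine integral_congr_ae ?_
    filter_upwards [ae_restrict_of_ae_restrict_of_subset (Ioo_subset_Ioo_right hx.2) hf] with y hy
    rw [hy]
    ring
  have hgi : IntegrableOn (fun y => m * (w y ^ 2 * V y)) (Ioo 0 r) := by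
    have h1 : IntegrableOn (fun x => w x * f x) (Ioo 0 r) := hint.mono_set Ioo_subset_Icc_self
    refine (integrable_congr ?_).1 h1
    filter_upwards [hf] with y hy
    rw [hy]
    ring
  have hF : ∀ x ∈ Ioo 0 r, HasDerivAt F (m * (w x ^ 2 * V x)) x := fun x hx => by
    have hcon : ContinuousOn (fun y => m * (w y ^ 2 * V y)) (Ioo 0 r) := fun y hy =>
      (continuousAt_const.mul ((hwc.pow 2).continuousAt.mul
        (hVcont y hy))).continuousWithinAt
    have hii : IntervalIntegrable (fun y => m * (w y ^ 2 * V y)) volume 0 x := by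
      rw [intervalIntegrable_iff_integrableOn_Ioo_of_le hx.1.le]
      exact hgi.mono_set (Ioo_subset_Ioo_right hx.2.le)
    have h1 := intervalIntegral.integral_hasDerivAt_right hii
      (hcon.stronglyMeasurableAtFilter isOpen_Ioo x hx) (hcon.continuousAt (isOpen_Ioo.mem_nhds hx))
    refine h1.congr_of_eventuallyEq ?_
    filter_upwards [isOpen_Ioo.mem_nhds hx] with y hy using hFi y (Ioo_subset_Icc_self hy)
  -- Control at the origin from integrability of `f` alone. Monotonicity of `w` gives `|F| ≤ w M`,
  -- then a bound for `|V| w`, and finally one for `xᵖ |V|`, which yields both limits required by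
  -- `radial_unique`.
  set M : ℝ := ∫ x in Ioo 0 r, |f x|
  have hM : 0 ≤ M := integral_nonneg fun x => abs_nonneg _
  have hFM : ∀ x ∈ Ioc 0 r, |F x| ≤ w x * M := fun x hx => by
    have hi : IntegrableOn (fun y => |f y|) (Ioo 0 x) :=
      Integrable.abs (hint'.mono_set (Ioo_subset_Ioo_right hx.2))
    simp only [F]
    rw [intervalIntegral.integral_of_le hx.1.le, integral_Ioc_eq_integral_Ioo]
    calc |∫ y in Ioo 0 x, w y * f y| ≤ ∫ y in Ioo 0 x, w x * |f y| := by
          rw [← Real.norm_eq_abs]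
          refine norm_integral_le_of_norm_le (hi.const_mul _) ?_
          filter_upwards [ae_restrict_mem measurableSet_Ioo] with y hy
          rw [norm_mul, Real.norm_eq_abs, Real.norm_eq_abs, abs_of_pos (greenWeight_pos hy.1)]
          exact mul_le_mul_of_nonneg_right (monotoneOn_greenWeight p hy.1 hx.1 hy.2.le)
            (abs_nonneg _)
      _ = w x * ∫ y in Ioo 0 x, |f y| := integral_const_mul _ _
      _ ≤ w x * M := by
          refine mul_le_mul_of_nonneg_left ?_ (greenWeight_pos hx.1).le
          exact setIntegral_mono_set hint'.abs (.of_forall fun y => abs_nonneg _)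
            (LE.le.eventuallyLE (Ioo_subset_Ioo_right hx.2))
  set M' : ℝ := M * r + |γ * F r| * w r
  have hVM : ∀ z ∈ Ioo 0 r, |V z| * w z ≤ M' := fun z hz => by
    have hwz : 0 < w z := greenWeight_pos hz.1
    have h1 : ‖∫ x in z..r, F x / w x ^ 2‖ ≤ M / w z * |r - z| := by
      refine intervalIntegral.norm_integral_le_of_norm_le_const fun x hx => ?_
      rw [uIoc_of_le hz.2.le] at hx
      have hx0 : 0 < x := hz.1.trans hx.1
      have hwx : 0 < w x := greenWeight_pos hx0
      have hwm : w z ≤ w x := monotoneOn_greenWeight p hz.1 hx0 hx.1.le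
      rw [norm_div, Real.norm_eq_abs, Real.norm_eq_abs, abs_of_pos (pow_pos hwx 2),
        div_le_div_iff₀ (pow_pos hwx 2) hwz]
      calc |F x| * w z ≤ (w x * M) * w x :=
            mul_le_mul (hFM x ⟨hx0, hx.2⟩) hwm hwz.le (mul_nonneg hwx.le hM)
        _ = M * w x ^ 2 := by ring
    have h2 : |r - z| ≤ r := by rw [abs_of_pos (sub_pos.2 hz.2)]; linarith [hz.1]
    calc |V z| * w z ≤ (M / w z * |r - z| + |γ * F r|) * w z := by
          gcongr
          exact (abs_add_le _ _).trans (by gcongr; exact h1)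
      _ = M * |r - z| + |γ * F r| * w z := by field_simp
      _ ≤ M' := by
          have := monotoneOn_greenWeight p hz.1 hr hz.2.le
          simp only [M']
          gcongr
  have hpw : ∀ x ∈ Ioo 0 r, x ^ p * |V x| ≤ w r * M' := fun x hx => by
    have hwx : 0 < w x := greenWeight_pos hx.1
    have h1 : x ^ p ≤ w x * w x := by
      rw [← sq, greenWeight_sq hx.1]
      exact le_mul_of_one_le_right (pow_pos hx.1 p).le (one_le_pow₀ (one_le_posSol p x))
    calc x ^ p * |V x| ≤ (w x * w x) * |V x| := by gcongr
      _ = w x * (|V x| * w x) := by ring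
      _ ≤ w r * M' := mul_le_mul (monotoneOn_greenWeight p hx.1 hr hx.2.le) (hVM x hx)
          (by positivity) (greenWeight_pos hr).le
  have hpx : ∀ x, 0 < posSol p x := fun x => by linarith [one_le_posSol p x]
  -- The factor `posSol` has parameter `-1` and the system for `V` contributes `m`, so the product
  -- solves the radial equation with parameter `m - 1`.
  have hrad := radial_unique p (m - 1) hr (v := fun x => m * (posSol p x * V x))
    (v' := fun x => m * (posSolDeriv p x * V x - posSol p x * (F x / w x ^ 2))) ?_ ?_ ?_ ?_
  · obtain ⟨C, hC⟩ := hrad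
    refine ⟨C, F r, ?_, ?_, ?_⟩
    · filter_upwards [hf, ae_restrict_mem measurableSet_Ioo] with x h1 hx
      have h2 := (hC x hx).1
      rw [smul_eq_mul] at h2
      have h3 : w x = √(x ^ p) * posSol p x := rfl
      rw [h1, h3]
      linear_combination √(x ^ p) * h2
    -- The identity with the Bessel solution is known only inside the interval; the boundary values
    -- are its limits from the left.
    · have hl : Tendsto (fun x => m * (posSol p x * V x)) (𝓝[<] r)
          (𝓝 (m * (posSol p r * V r))) :=
        (((continuous_posSol p).tendsto r).mono_left inf_le_left |>.mul
          (hVr.tendsto.mono_left (nhdsWithin_mono _ Iio_subset_Iic_self))).const_mul m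
      have hr' : Tendsto (fun x => bessel p ((m - 1) * x ^ 2) * C) (𝓝[<] r)
          (𝓝 (bessel p ((m - 1) * r ^ 2) * C)) :=
        (Continuous.tendsto (by fun_prop) r).mono_left inf_le_left
      have hVeq : V r = γ * F r := by simp [V]
      rw [← hVeq]
      refine tendsto_nhds_unique (hr'.congr' ?_) hl
      filter_upwards [Ioo_mem_nhdsLT hr] with x hx
      rw [(hC x hx).1, smul_eq_mul]
    · have hFr : Tendsto F (𝓝[<] r) (𝓝 (F r)) := by
        have h1 := (hFc r ⟨hr.le, le_rfl⟩).mono_of_mem_nhdsWithin (s := Iio r)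
          (mem_of_superset (Ioo_mem_nhdsLT hr) Ioo_subset_Icc_self)
        exact h1.tendsto
      have hl : Tendsto (fun x => m * (posSolDeriv p x * V x - posSol p x * (F x / w x ^ 2)))
          (𝓝[<] r) (𝓝 (m * (posSolDeriv p r * V r - posSol p r * (F r / w r ^ 2)))) := by
        refine Tendsto.const_mul m (Tendsto.sub (Tendsto.mul ?_ ?_) (Tendsto.mul ?_
          (Tendsto.div hFr ?_ (pow_ne_zero 2 (hw0 r hr)))))
        · exact ((continuous_posSolDeriv p).tendsto r).mono_left inf_le_left
        · exact hVr.tendsto.mono_left (nhdsWithin_mono _ Iio_subset_Iic_self)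
        · exact ((continuous_posSol p).tendsto r).mono_left inf_le_left
        · exact ((hwc.pow 2).tendsto r).mono_left inf_le_left
      have hr' : Tendsto (fun x => 2 * (m - 1) * x * besselDeriv p ((m - 1) * x ^ 2) * C) (𝓝[<] r)
          (𝓝 (2 * (m - 1) * r * besselDeriv p ((m - 1) * r ^ 2) * C)) :=
        (Continuous.tendsto (by fun_prop) r).mono_left inf_le_left
      have hVeq : V r = γ * F r := by simp [V]
      rw [← hVeq]
      refine tendsto_nhds_unique (hr'.congr' ?_) hl
      filter_upwards [Ioo_mem_nhdsLT hr] with x hx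
      rw [(hC x hx).2, smul_eq_mul]
  · intro x hx
    refine (((hasDerivAt_posSol p x).mul (hV x hx)).const_mul m).congr_deriv ?_
    ring
  · intro x hx
    have h1 := (((hasDerivAt_posSol_flux p x).mul (hV x hx)).sub
      ((hF x hx).div (hasDerivAt_posSol p x) (hpx x).ne')).const_mul m
    refine (h1.congr_of_eventuallyEq ?_).congr_deriv ?_
    · filter_upwards [isOpen_Ioo.mem_nhds hx] with y hy
      have := hpx y
      have hyp := pow_pos hy.1 p
      simp only [smul_eq_mul, Pi.mul_apply, Pi.sub_apply, Pi.div_apply, w]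
      rw [greenWeight_sq hy.1]
      field_simp
    · have := hpx x
      have hxp := pow_pos hx.1 p
      simp only [smul_eq_mul, w]
      rw [greenWeight_sq hx.1]
      field_simp
      ring
  · have h1 : Tendsto (fun x => |m| * (|posSolDeriv p x| * (w r * M') + |F x|)) (𝓝[>] 0) (𝓝 0) := by
      have h2 : Tendsto (fun x => |posSolDeriv p x|) (𝓝[>] 0) (𝓝 0) := by
        have := ((continuous_posSolDeriv p).abs.tendsto 0).mono_left
          (nhdsWithin_le_nhds (s := Ioi 0))
        simpa [posSolDeriv] using this
      have h3 : Tendsto (fun x => |F x|) (𝓝[>] 0) (𝓝 0) := by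
        have h4 := ((hFc 0 ⟨le_rfl, hr.le⟩).mono_of_mem_nhdsWithin (s := Ioi 0)
          (mem_of_superset (Ioo_mem_nhdsGT hr) Ioo_subset_Icc_self)).tendsto.abs
        simpa [F] using h4
      simpa using ((h2.mul_const (w r * M')).add h3).const_mul |m|
    refine squeeze_zero_norm' ?_ h1
    filter_upwards [Ioo_mem_nhdsGT hr] with x hx
    have hp := hpx x
    have hxp := pow_pos hx.1 p
    have h5 : x ^ p • (m * (posSolDeriv p x * V x - posSol p x * (F x / w x ^ 2))) =
        m * (posSolDeriv p x * (x ^ p * V x) - F x / posSol p x) := by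
      simp only [smul_eq_mul, w]
      rw [greenWeight_sq hx.1]
      field_simp
    rw [h5, norm_mul, Real.norm_eq_abs, Real.norm_eq_abs]
    refine mul_le_mul_of_nonneg_left ((abs_sub _ _).trans (add_le_add ?_ ?_)) (abs_nonneg m)
    · rw [abs_mul, abs_mul, abs_of_pos hxp]
      exact mul_le_mul_of_nonneg_left (hpw x hx) (abs_nonneg _)
    · rw [abs_div, abs_of_pos hp]
      exact div_le_self (abs_nonneg _) (one_le_posSol p x)
  · have h1 : Tendsto (fun x => x * (|m| * posSol p x * (w r * M'))) (𝓝[>] 0) (𝓝 0) := by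
      have hc : Continuous fun x => x * (|m| * posSol p x * (w r * M')) := by
        have := continuous_posSol p
        fun_prop
      simpa using (hc.tendsto 0).mono_left (nhdsWithin_le_nhds (s := Ioi 0))
    refine squeeze_zero_norm' ?_ h1
    filter_upwards [Ioo_mem_nhdsGT hr] with x hx
    have h5 : x ^ (p + 1) • (m * (posSol p x * V x)) = x * (m * posSol p x * (x ^ p * V x)) := by
      rw [smul_eq_mul]
      ring
    rw [h5]
    simp only [norm_mul, norm_pow, Real.norm_eq_abs, abs_of_pos hx.1, abs_of_pos (hpx x)]
    have := hpw x hx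
    have := hpx x
    have := hx.1
    gcongr

end Eigenfunction

/-- The radial functions `E(λx²)` that satisfy a boundary condition are complete. -/
theorem bessel_complete (p : ℕ) {r c b : ℝ} (hr : 0 < r) (hc : 0 ≤ c) (hb : 0 ≤ b)
    (hcb : 0 < c + b) {h : ℝ → ℝ} (hh : MemLp h 2 (volume.restrict (Ioo 0 r)))
    (horth : ∀ lam, bdryFun p c b (lam * r ^ 2) = 0 →
      ∫ x in Ioo 0 r, √(x ^ p) * bessel p (lam * x ^ 2) * h x = 0) :
    h =ᵐ[volume.restrict (Ioo 0 r)] 0 := by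
  have he := one_le_posSol p r
  have he1 := posSolDeriv_pos (p := p) hr
  have hwr := greenWeight_pos (p := p) hr
  have hden : 0 < c * posSol p r + b * r * posSolDeriv p r := by
    rcases hb.eq_or_lt with rfl | hb
    · have : 0 < c := by simpa using hcb
      rw [zero_mul, zero_mul, add_zero]
      positivity
    · have : 0 ≤ c * posSol p r := mul_nonneg hc (by linarith)
      positivity
  -- Since `V(r) = γF` and `V'(r) = -F/w(r)²`, this is the value for which `u = posSol · V`
  -- satisfies `c u(r) + b r u'(r) = 0`. The denominator is positive because `posSol` and its
  -- derivative are, so `-1` is never an eigenvalue.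
  set γ : ℝ := b * r * posSol p r /
    (greenWeight p r ^ 2 * (c * posSol p r + b * r * posSolDeriv p r)) with hγ
  suffices h0 : hh.toLp h = 0 by
    have h1 := hh.coeFn_toLp
    rw [h0] at h1
    exact h1.symm.trans (Lp.coeFn_zero ℝ 2 _)
  refine green_complete hr (continuous_greenWeight p).measurable (fun x hx => greenWeight_pos hx)
    (monotoneOn_greenWeight p) (γ := γ) (by positivity) fun f m hm hf => ?_
  obtain ⟨C, F, h1, h2, h3⟩ := green_eigenfunction hr hm
    (intervalIntegrable_weight_mul hr (continuous_greenWeight p).measurable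
      (fun x hx => greenWeight_pos hx) (monotoneOn_greenWeight p) f)
    ((Lp.memLp f).integrable (by norm_num)) hf
  have h4 : inner ℝ f (hh.toLp h) =
      C * ∫ x in Ioo 0 r, √(x ^ p) * bessel p ((m - 1) * x ^ 2) * h x := by
    rw [L2.inner_def, ← integral_const_mul]
    refine integral_congr_ae ?_
    filter_upwards [h1, hh.coeFn_toLp] with x h5 h6
    rw [RCLike.inner_apply, conj_trivial, h5, h6]
    ring
  rw [h4]
  by_cases hC : C = 0
  · rw [hC, zero_mul]
  · rw [horth (m - 1), mul_zero]
    have h5 : C * bdryFun p c b ((m - 1) * r ^ 2) = 0 := by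
      have h6 : C * bdryFun p c b ((m - 1) * r ^ 2) =
          c * (bessel p ((m - 1) * r ^ 2) * C) +
            b * r * (2 * (m - 1) * r * besselDeriv p ((m - 1) * r ^ 2) * C) := by
        rw [bdryFun]
        ring
      rw [h6, h2, h3, hγ]
      field_simp
      ring
    exact (mul_eq_zero.1 h5).resolve_left hC


end ZBall
end

noncomputable section
namespace ZBall
open MvPolynomial

/-! ### Harmonic polynomials -/

variable {d : ℕ}

/-- The Laplacian of complex polynomials. -/
def polyLap (d : ℕ) : MvPolynomial (Fin d) ℂ →ₗ[ℂ] MvPolynomial (Fin d) ℂ :=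
  ∑ i, (pderiv i).toLinearMap ∘ₗ (pderiv i).toLinearMap

theorem polyLap_apply (P : MvPolynomial (Fin d) ℂ) :
    polyLap d P = ∑ i, pderiv i (pderiv i P) := by
  simp [polyLap]

theorem isHarmonicPoly_iff {s : ℕ} {P : MvPolynomial (Fin d) ℂ} :
    IsHarmonicPoly s P ↔ P.IsHomogeneous s ∧ polyLap d P = 0 := by
  rw [polyLap_apply]
  rfl

theorem pderiv_eq_zero_of_isHomogeneous_zero {P : MvPolynomial (Fin d) ℂ}
    (h : P.IsHomogeneous 0) (i : Fin d) : pderiv i P = 0 := by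
  rw [← totalDegree_zero_iff_isHomogeneous, totalDegree_eq_zero_iff_eq_C] at h
  rw [h, pderiv_C]

theorem isHomogeneous_polyLap {n : ℕ} {P : MvPolynomial (Fin d) ℂ} (h : P.IsHomogeneous n) :
    (polyLap d P).IsHomogeneous (n - 2) := by
  rw [polyLap_apply]
  exact IsHomogeneous.sum _ _ _ fun i _ => h.pderiv.pderiv

theorem polyLap_eq_zero_of_lt {n : ℕ} {P : MvPolynomial (Fin d) ℂ} (h : P.IsHomogeneous n)
    (hn : n < 2) : polyLap d P = 0 := by
  rw [polyLap_apply]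
  refine Finset.sum_eq_zero fun i _ => pderiv_eq_zero_of_isHomogeneous_zero ?_ i
  have := h.pderiv (i := i)
  rwa [show n - 1 = 0 by omega] at this

theorem pderiv_comm (i j : Fin d) (P : MvPolynomial (Fin d) ℂ) :
    pderiv i (pderiv j P) = pderiv j (pderiv i P) := by
  have h : ⁅(pderiv i : Derivation ℂ (MvPolynomial (Fin d) ℂ) (MvPolynomial (Fin d) ℂ)),
      (pderiv j : Derivation ℂ (MvPolynomial (Fin d) ℂ) (MvPolynomial (Fin d) ℂ))⁆ = 0 := by
    refine derivation_ext fun k => ?_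
    rw [Derivation.commutator_apply]
    classical
    simp [pderiv_X, Pi.single_apply, apply_ite]
  have := congrArg (fun D => D P) h
  rw [Derivation.commutator_apply] at this
  exact sub_eq_zero.1 this

/-- The polynomial `|x|²`. -/
def sqNorm (d : ℕ) : MvPolynomial (Fin d) ℂ := ∑ i, X i ^ 2

theorem isHomogeneous_sqNorm : (sqNorm d).IsHomogeneous 2 :=
  IsHomogeneous.sum _ _ _ fun i _ => by simpa using (isHomogeneous_X ℂ i).pow 2

theorem pderiv_sqNorm (i : Fin d) : pderiv i (sqNorm d) = 2 * X i := by
  classical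
  simp [sqNorm, pderiv_X, Pi.single_apply]

theorem polyLap_mul (P Q : MvPolynomial (Fin d) ℂ) :
    polyLap d (P * Q) = polyLap d P * Q + 2 * ∑ i, pderiv i P * pderiv i Q + P * polyLap d Q := by
  simp only [polyLap_apply, Finset.sum_mul, Finset.mul_sum, ← Finset.sum_add_distrib]
  refine Finset.sum_congr rfl fun i _ => ?_
  rw [pderiv_mul, map_add, pderiv_mul, pderiv_mul]
  ring

theorem polyLap_sqNorm : polyLap d (sqNorm d) = C (2 * d : ℂ) := by
  simp only [polyLap_apply, pderiv_sqNorm]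
  have : ∀ i : Fin d, pderiv i (2 * X i : MvPolynomial (Fin d) ℂ) = C 2 := fun i => by
    rw [show (2 : MvPolynomial (Fin d) ℂ) = C 2 from (map_ofNat C 2).symm, pderiv_C_mul, pderiv_X_self, mul_one]
  simp only [this, Finset.sum_const, Finset.card_univ, Fintype.card_fin]
  rw [nsmul_eq_mul, map_mul, mul_comm]
  simp

/-- In the product rule the mixed term is `2x · ∇P`, which Euler's identity evaluates. -/
theorem polyLap_sqNorm_mul {m : ℕ} {P : MvPolynomial (Fin d) ℂ} (h : P.IsHomogeneous m) :
    polyLap d (sqNorm d * P) = C (2 * d + 4 * m : ℂ) * P + sqNorm d * polyLap d P := by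
  rw [polyLap_mul, polyLap_sqNorm]
  have h1 : ∑ i, pderiv i (sqNorm d) * pderiv i P = 2 * (m • P) := by
    rw [← h.sum_X_mul_pderiv, Finset.mul_sum]
    refine Finset.sum_congr rfl fun i _ => ?_
    rw [pderiv_sqNorm]
    ring
  rw [h1, nsmul_eq_mul]
  simp only [map_add, map_mul, map_natCast, map_ofNat]
  ring

theorem polyLap_sqNorm_pow_mul {m : ℕ} {H : MvPolynomial (Fin d) ℂ} (h : IsHarmonicPoly m H)
    (j : ℕ) : polyLap d (sqNorm d ^ (j + 1) * H) =
      C (2 * (j + 1) * (2 * j + 2 * m + d) : ℂ) * (sqNorm d ^ j * H) := by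
  rw [isHarmonicPoly_iff] at h
  induction j with
  | zero =>
    rw [zero_add, pow_one, pow_zero, one_mul, polyLap_sqNorm_mul h.1, h.2, mul_zero, add_zero]
    congr 2
    push_cast
    ring
  | succ j ih =>
    have hh : (sqNorm d ^ (j + 1) * H).IsHomogeneous (2 * (j + 1) + m) := by
      simpa [mul_comm] using (isHomogeneous_sqNorm.pow (j + 1)).mul h.1
    rw [pow_succ', mul_assoc, polyLap_sqNorm_mul hh, ih, pow_succ']
    push_cast
    simp only [map_add, map_mul, map_natCast, map_ofNat, map_one]
    ring

/-- On harmonic polynomials the `j`-th power of the Laplacian undoes multiplication by `|x|²ʲ` up to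
a factor. Positivity of the dimension keeps that factor nonzero. -/
theorem polyLap_iterate_sqNorm_pow_mul (hd : 0 < d) {m : ℕ} {H : MvPolynomial (Fin d) ℂ}
    (h : IsHarmonicPoly m H) (j : ℕ) :
    ∃ c : ℂ, c ≠ 0 ∧ ((polyLap d) ^ j) (sqNorm d ^ j * H) = C c * H := by
  induction j with
  | zero => exact ⟨1, one_ne_zero, by simp⟩
  | succ j ih =>
    obtain ⟨c, hc, hcH⟩ := ih
    refine ⟨2 * (j + 1) * (2 * j + 2 * m + d) * c, mul_ne_zero ?_ hc, ?_⟩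
    · have h1 : ((2 * (j + 1) * (2 * j + 2 * m + d) : ℕ) : ℂ) ≠ 0 :=
        Nat.cast_ne_zero.2 (by positivity)
      push_cast at h1
      exact h1
    · rw [pow_succ, Module.End.mul_apply, polyLap_sqNorm_pow_mul h, C_mul', map_smul, hcH, ← C_mul',
        ← mul_assoc, ← C_mul]

/-! ### Values of polynomials -/

theorem evalAt_add (x : Euc d) (P Q : MvPolynomial (Fin d) ℂ) :
    evalAt x (P + Q) = evalAt x P + evalAt x Q := map_add _ P Q

theorem evalAt_sub (x : Euc d) (P Q : MvPolynomial (Fin d) ℂ) :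
    evalAt x (P - Q) = evalAt x P - evalAt x Q := map_sub _ P Q

theorem evalAt_mul (x : Euc d) (P Q : MvPolynomial (Fin d) ℂ) :
    evalAt x (P * Q) = evalAt x P * evalAt x Q := map_mul _ P Q

theorem evalAt_pow (x : Euc d) (P : MvPolynomial (Fin d) ℂ) (n : ℕ) :
    evalAt x (P ^ n) = evalAt x P ^ n := map_pow _ P n

theorem evalAt_C (x : Euc d) (c : ℂ) : evalAt x (C c) = c := eval_C c

theorem evalAt_smul (x : Euc d) (c : ℂ) (P : MvPolynomial (Fin d) ℂ) :
    evalAt x (c • P) = c * evalAt x P := by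
  rw [← C_mul', evalAt_mul, evalAt_C]

theorem evalAt_zero (x : Euc d) : evalAt x (0 : MvPolynomial (Fin d) ℂ) = 0 := map_zero _

theorem evalAt_X (x : Euc d) (i : Fin d) : evalAt x (X i) = x i := eval_X _

theorem evalAt_sum {ι : Type*} (s : Finset ι) (x : Euc d) (P : ι → MvPolynomial (Fin d) ℂ) :
    evalAt x (∑ i ∈ s, P i) = ∑ i ∈ s, evalAt x (P i) := map_sum _ P s

theorem evalAt_sqNorm (x : Euc d) : evalAt x (sqNorm d) = (‖x‖ : ℂ) ^ 2 := by
  rw [sqNorm, evalAt_sum, ← Complex.ofReal_pow, EuclideanSpace.norm_sq_eq]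
  push_cast
  refine Finset.sum_congr rfl fun i _ => ?_
  rw [evalAt_pow, evalAt_X, Real.norm_eq_abs, ← Complex.ofReal_pow, ← Complex.ofReal_pow, sq_abs]

theorem evalAt_smul_of_isHomogeneous {n : ℕ} {P : MvPolynomial (Fin d) ℂ} (h : P.IsHomogeneous n)
    (r : ℝ) (x : Euc d) : evalAt (r • x) P = (r : ℂ) ^ n * evalAt x P := by
  have h1 : (fun i => ((r • x) i : ℂ)) = fun i => (r : ℂ) * x i := by
    ext i
    simp
  rw [evalAt, evalAt, h1, eval_eq', eval_eq', Finset.mul_sum]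
  refine Finset.sum_congr rfl fun m hm => ?_
  have h2 : ∑ i, m i = n := by
    have := h (mem_support_iff.1 hm)
    rw [Finsupp.weight_apply, Finsupp.sum_fintype _ _ (by simp)] at this
    simpa using this
  simp only [mul_pow, Finset.prod_mul_distrib, Finset.prod_pow_eq_pow_sum, h2]
  ring

/-! ### Existence of the decomposition into spherical harmonics -/

theorem exists_decomposition_add {f g : Euc d → ℂ} (hf : ∃ H, IsHarmonicDecomposition f H)
    (hg : ∃ H, IsHarmonicDecomposition g H) :
    ∃ H, IsHarmonicDecomposition (fun x => f x + g x) H := by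
  obtain ⟨H, h1, h2⟩ := hf
  obtain ⟨K, k1, k2⟩ := hg
  refine ⟨H + K, fun j => ?_, fun u hu => ?_⟩
  · have := isHarmonicPoly_iff.1 (h1 j)
    have := isHarmonicPoly_iff.1 (k1 j)
    rw [isHarmonicPoly_iff, Finsupp.add_apply, map_add]
    simp_all [IsHomogeneous.add]
  · simp only
    rw [h2 u hu, k2 u hu, Finsupp.sum_add_index' (fun _ => evalAt_zero u)
      (fun _ => evalAt_add u)]

theorem exists_decomposition_single {m : ℕ} {P : MvPolynomial (Fin d) ℂ} (h : IsHarmonicPoly m P)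
    {f : Euc d → ℂ} (hf : ∀ u, ‖u‖ = 1 → f u = evalAt u P) :
    ∃ H, IsHarmonicDecomposition f H := by
  refine ⟨Finsupp.single m P, fun j => ?_, fun u hu => ?_⟩
  · rcases eq_or_ne m j with rfl | hj
    · rwa [Finsupp.single_eq_same]
    · rw [Finsupp.single_eq_of_ne' hj, isHarmonicPoly_iff]
      exact ⟨isHomogeneous_zero _ _ _, map_zero _⟩
  · rw [hf u hu]
    exact (Finsupp.sum_single_index (h := fun _ h => evalAt u h) (evalAt_zero u)).symm

theorem isHomogeneous_polyLap_pow {n : ℕ} {P : MvPolynomial (Fin d) ℂ} (hP : P.IsHomogeneous n)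
    (i : ℕ) : (((polyLap d) ^ i) P).IsHomogeneous (n - 2 * i) := by
  induction i with
  | zero => simpa using hP
  | succ i ih =>
    rw [pow_succ', Module.End.mul_apply, show n - 2 * (i + 1) = n - 2 * i - 2 by omega]
    exact isHomogeneous_polyLap ih

theorem polyLap_pow_eq_zero {n : ℕ} {P : MvPolynomial (Fin d) ℂ} (hP : P.IsHomogeneous n)
    {i : ℕ} (hi : n < 2 * i) : ((polyLap d) ^ i) P = 0 := by
  induction i with
  | zero => omega
  | succ i ih =>
    rw [pow_succ', Module.End.mul_apply]
    exact polyLap_eq_zero_of_lt (isHomogeneous_polyLap_pow hP i) (by omega)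

/-- If `Δʲ⁺¹P = 0`, then `h = ΔʲP` is harmonic, and subtracting a suitable multiple of `|x|²ʲ h`
leaves a polynomial killed by `Δʲ`. On the unit sphere the subtracted term is a multiple of `h`.
When `2j > n`, `ΔʲP` already vanishes by degree. -/
theorem exists_decomposition_of_iterate (hd : 0 < d) {n : ℕ} (j : ℕ) {P : MvPolynomial (Fin d) ℂ}
    (hP : P.IsHomogeneous n) (hj : ((polyLap d) ^ j) P = 0) :
    ∃ H, IsHarmonicDecomposition (fun x => evalAt x P) H := by
  induction j generalizing P with
  | zero =>
    have hP0 : P = 0 := by simpa using hj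
    subst hP0
    exact ⟨0, fun j => isHarmonicPoly_iff.2 ⟨isHomogeneous_zero _ _ _, map_zero _⟩,
      fun u _ => by simp [evalAt_zero]⟩
  | succ j ih =>
    by_cases hn : 2 * j ≤ n
    · set h := ((polyLap d) ^ j) P with hh
      have hhom : h.IsHomogeneous (n - 2 * j) := isHomogeneous_polyLap_pow hP j
      have hharm : IsHarmonicPoly (n - 2 * j) h := isHarmonicPoly_iff.2 ⟨hhom, by
        rwa [pow_succ', Module.End.mul_apply] at hj⟩
      obtain ⟨c, hc, hcH⟩ := polyLap_iterate_sqNorm_pow_mul hd hharm j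
      have hQ : (P - c⁻¹ • (sqNorm d ^ j * h)).IsHomogeneous n := by
        refine hP.sub ?_
        have h1 := (isHomogeneous_sqNorm.pow j).mul hhom
        rw [show 2 * j + (n - 2 * j) = n by omega] at h1
        exact (homogeneousSubmodule (Fin d) ℂ n).smul_mem _ h1
      have hQ0 : ((polyLap d) ^ j) (P - c⁻¹ • (sqNorm d ^ j * h)) = 0 := by
        rw [map_sub, map_smul, hcH, C_mul', smul_smul, inv_mul_cancel₀ hc, one_smul, sub_self]
      have hd1 := ih hQ hQ0
      have hd2 := exists_decomposition_single (P := c⁻¹ • h) (m := n - 2 * j)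
        (f := fun x => evalAt x (c⁻¹ • (sqNorm d ^ j * h)))
        (isHarmonicPoly_iff.2 ⟨(homogeneousSubmodule (Fin d) ℂ _).smul_mem _ hhom, by
          rw [map_smul, (isHarmonicPoly_iff.1 hharm).2, smul_zero]⟩) fun u hu => by
          rw [evalAt_smul, evalAt_smul, evalAt_mul, evalAt_pow, evalAt_sqNorm, hu]
          simp
      obtain ⟨H, hH⟩ := exists_decomposition_add hd1 hd2
      refine ⟨H, hH.1, fun u hu => ?_⟩
      rw [← hH.2 u hu]
      simp only [evalAt_sub]
      ring
    · exact ih hP (polyLap_pow_eq_zero hP (by omega))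

theorem exists_decomposition (hd : 0 < d) (P : MvPolynomial (Fin d) ℂ) :
    ∃ H, IsHarmonicDecomposition (fun x => evalAt x P) H := by
  have key : ∀ N : ℕ, ∃ H, IsHarmonicDecomposition
      (fun x => evalAt x (∑ i ∈ Finset.range N, homogeneousComponent i P)) H := by
    intro N
    induction N with
    | zero =>
      exact exists_decomposition_single (m := 0) (P := 0)
        (isHarmonicPoly_iff.2 ⟨isHomogeneous_zero _ _ _, map_zero _⟩) (by simp)
    | succ N ih =>
      obtain ⟨H, hH⟩ := exists_decomposition_add ih
        (exists_decomposition_of_iterate hd (N + 1) (homogeneousComponent_isHomogeneous N P)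
          (polyLap_pow_eq_zero (homogeneousComponent_isHomogeneous N P) (by omega)))
      refine ⟨H, hH.1, fun u hu => ?_⟩
      rw [← hH.2 u hu]
      simp only [Finset.sum_range_succ, evalAt_add]
  have h := key (P.totalDegree + 1)
  rwa [sum_homogeneousComponent] at h

end ZBall
end

noncomputable section
namespace ZBall
open MvPolynomial Filter Topology

/-! ### Polar coordinates -/

/-- The measure `rⁿ dr` on `(0, ∞)`. -/
def radialMeasure (n : ℕ) : Measure ℝ :=
  (volume.restrict (Ioi 0)).withDensity fun r => ENNReal.ofReal (r ^ n)

instance (n : ℕ) : SigmaFinite (radialMeasure n) :=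
  SigmaFinite.withDensity_ofReal (μ := volume.restrict (Ioi 0)) fun r : ℝ => r ^ n

theorem map_volumeIoiPow (n : ℕ) :
    (Measure.volumeIoiPow n).map Subtype.val = radialMeasure n := by
  ext s hs
  rw [Measure.map_apply measurable_subtype_coe hs, Measure.volumeIoiPow,
    withDensity_apply _ (measurable_subtype_coe hs), radialMeasure, withDensity_apply _ hs,
    Measure.restrict_restrict hs, setLIntegral_subtype measurableSet_Ioi _
      fun a : ℝ => ENNReal.ofReal (a ^ n), Subtype.image_preimage_coe, inter_comm]

/-- The surface measure of the unit sphere of `ℝᵈ`. -/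
abbrev sphereMeasure (d : ℕ) : Measure (Metric.sphere (0 : Euc d) 1) :=
  (volume : Measure (Euc d)).toSphere

variable {d : ℕ}

theorem nontrivial_euc (hd : 0 < d) : Nontrivial (Euc d) := by
  have : Nonempty (Fin d) := ⟨⟨0, hd⟩⟩
  infer_instance

/-- The polar homeomorphism of the punctured space, extended by the null origin, with the radius as
a real variable. -/
theorem measurePreserving_polar (hd : 0 < d) :
    MeasurePreserving (fun q : Metric.sphere (0 : Euc d) 1 × ℝ => q.2 • (q.1 : Euc d))
      ((sphereMeasure d).prod (radialMeasure (d - 1))) volume := by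
  have := nontrivial_euc hd
  refine ⟨by fun_prop, ?_⟩
  have h1 := (volume : Measure (Euc d)).measurePreserving_homeomorphUnitSphereProd
  rw [finrank_euclideanSpace_fin] at h1
  have h2 : MeasurePreserving (homeomorphUnitSphereProd (Euc d)).symm
      ((sphereMeasure d).prod (Measure.volumeIoiPow (d - 1)))
      (Measure.comap Subtype.val (volume : Measure (Euc d))) :=
    h1.symm (homeomorphUnitSphereProd (Euc d)).toMeasurableEquiv
  rw [← map_volumeIoiPow, ← Measure.map_id (μ := sphereMeasure d),
    Measure.map_prod_map _ _ measurable_id measurable_subtype_coe,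
    Measure.map_map (by fun_prop) (by fun_prop)]
  have h3 : (fun q : Metric.sphere (0 : Euc d) 1 × ℝ => q.2 • (q.1 : Euc d)) ∘
      Prod.map id (Subtype.val : Ioi (0 : ℝ) → ℝ) =
      Subtype.val ∘ (homeomorphUnitSphereProd (Euc d)).symm := by
    ext q
    simp
  rw [h3, ← Measure.map_map measurable_subtype_coe (by fun_prop), h2.map_eq,
    map_comap_subtype_coe (measurableSet_singleton _).compl, restrict_compl_singleton]

theorem integral_polar (hd : 0 < d) {f : Euc d → ℂ} (hf : Integrable f) :
    ∫ x, f x = ∫ r, ∫ u : Metric.sphere (0 : Euc d) 1, f (r • (u : Euc d)) ∂sphereMeasure d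
      ∂radialMeasure (d - 1) := by
  have h := measurePreserving_polar hd
  have h1 : Integrable (fun q : Metric.sphere (0 : Euc d) 1 × ℝ => f (q.2 • (q.1 : Euc d)))
      ((sphereMeasure d).prod (radialMeasure (d - 1))) :=
    h.integrable_comp_of_integrable hf
  rw [← integral_prod_symm _ h1, ← h.map_eq, integral_map h.measurable.aemeasurable]
  rw [h.map_eq]
  exact hf.aestronglyMeasurable

theorem lintegral_polar (hd : 0 < d) {f : Euc d → ℝ≥0∞} (hf : Measurable f) :
    ∫⁻ x, f x = ∫⁻ r, ∫⁻ u : Metric.sphere (0 : Euc d) 1, f (r • (u : Euc d)) ∂sphereMeasure d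
      ∂radialMeasure (d - 1) := by
  have h := measurePreserving_polar hd
  rw [← h.lintegral_comp hf, lintegral_prod_symm']
  exact hf.comp h.measurable

/-! ### Derivatives and growth of polynomials -/

theorem contDiff_evalAt (P : MvPolynomial (Fin d) ℂ) {n : WithTop ℕ∞} :
    ContDiff ℝ n (fun x => evalAt x P) := by
  induction P using MvPolynomial.induction_on with
  | C a => simpa only [evalAt_C] using contDiff_const
  | add p q hp hq => simpa only [evalAt_add] using hp.add hq
  | mul_X p j hp =>
    simp only [evalAt_mul, evalAt_X]
    exact hp.mul (Complex.ofRealCLM.comp (EuclideanSpace.proj j : Euc d →L[ℝ] ℝ)).contDiff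

theorem differentiableAt_evalAt (P : MvPolynomial (Fin d) ℂ) (x : Euc d) :
    DifferentiableAt ℝ (fun x => evalAt x P) x :=
  (contDiff_evalAt P (n := 1)).differentiable one_ne_zero x

theorem fderiv_evalAt_single (P : MvPolynomial (Fin d) ℂ) (x : Euc d) (i : Fin d) :
    fderiv ℝ (fun x => evalAt x P) x (EuclideanSpace.single i 1) = evalAt x (pderiv i P) := by
  induction P using MvPolynomial.induction_on with
  | C a => simp [evalAt_C, evalAt_zero]
  | add p q hp hq =>
    simp only [evalAt_add, map_add]
    rw [fderiv_fun_add (differentiableAt_evalAt p x) (differentiableAt_evalAt q x),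
      add_apply, hp, hq]
  | mul_X p j hp =>
    simp only [evalAt_mul, evalAt_X]
    have hx : HasFDerivAt (fun x : Euc d => ((x j : ℝ) : ℂ))
        (Complex.ofRealCLM.comp (EuclideanSpace.proj j : Euc d →L[ℝ] ℝ)) x :=
      (Complex.ofRealCLM.comp (EuclideanSpace.proj j : Euc d →L[ℝ] ℝ)).hasFDerivAt
    rw [((differentiableAt_evalAt p x).hasFDerivAt.fun_mul hx).fderiv]
    simp only [add_apply, smul_apply, hp, pderiv_mul,
      evalAt_add, evalAt_mul, evalAt_X, smul_eq_mul]
    rcases eq_or_ne j i with rfl | hj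
    · simp [evalAt]
      ring
    · simp [pderiv_X_of_ne hj, evalAt, hj]
      ring

@[fun_prop]
theorem continuous_evalAt (P : MvPolynomial (Fin d) ℂ) : Continuous (fun x => evalAt x P) :=
  (contDiff_evalAt P (n := 0)).continuous

/-- The rate `ε` is arbitrary so that the induction can split it in halves when a variable is
multiplied in. -/
theorem norm_evalAt_le (P : MvPolynomial (Fin d) ℂ) {ε : ℝ} (hε : 0 < ε) :
    ∃ C, 0 ≤ C ∧ ∀ x : Euc d, ‖evalAt x P‖ ≤ C * Real.exp (ε * ‖x‖) := by
  induction P using MvPolynomial.induction_on generalizing ε with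
  | C a =>
    refine ⟨‖a‖, norm_nonneg _, fun x => ?_⟩
    rw [evalAt_C]
    exact le_mul_of_one_le_right (norm_nonneg _) (Real.one_le_exp (by positivity))
  | add p q hp hq =>
    obtain ⟨C, hC, h⟩ := hp hε
    obtain ⟨C', hC', h'⟩ := hq hε
    refine ⟨C + C', by positivity, fun x => ?_⟩
    rw [evalAt_add, add_mul]
    exact (norm_add_le _ _).trans (add_le_add (h x) (h' x))
  | mul_X p j hp =>
    obtain ⟨C, hC, h⟩ := hp (half_pos hε)
    refine ⟨C * (2 / ε), by positivity, fun x => ?_⟩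
    have h1 : ‖((x j : ℝ) : ℂ)‖ ≤ 2 / ε * Real.exp (ε / 2 * ‖x‖) := by
      rw [Complex.norm_real]
      refine (PiLp.norm_apply_le x j).trans ?_
      have := Real.add_one_le_exp (ε / 2 * ‖x‖)
      rw [div_mul_eq_mul_div, le_div_iff₀ hε]
      linarith
    rw [evalAt_mul, evalAt_X, norm_mul]
    refine (mul_le_mul (h x) h1 (norm_nonneg _) (by positivity)).trans (le_of_eq ?_)
    rw [show ε * ‖x‖ = ε / 2 * ‖x‖ + ε / 2 * ‖x‖ by ring, Real.exp_add]
    ring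

/-! ### Gaussian integrals -/

/-- The Gaussian weight. -/
def gaussian (x : Euc d) : ℂ := (Real.exp (-‖x‖ ^ 2 / 2) : ℝ)

theorem hasFDerivAt_gaussian (x : Euc d) :
    HasFDerivAt (gaussian (d := d))
      ((Complex.ofRealCLM.comp (innerSL ℝ x)).smulRight (-gaussian x)) x := by
  have h1 : HasFDerivAt (fun x : Euc d => Real.exp (-‖x‖ ^ 2 / 2))
      (Real.exp (-‖x‖ ^ 2 / 2) • ((1 / 2 : ℝ) • -((2 : ℝ) • innerSL ℝ x))) x := by
    refine HasFDerivAt.exp ?_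
    have h2 : HasFDerivAt (fun x : Euc d => ‖x‖ ^ 2) ((2 : ℝ) • innerSL ℝ x) x := by
      simpa [two_smul] using (hasStrictFDerivAt_norm_sq x).hasFDerivAt
    refine (h2.neg.const_mul (1 / 2 : ℝ)).congr_of_eventuallyEq (Eventually.of_forall fun y => ?_)
    simp only [Pi.neg_apply]
    ring
  refine (Complex.ofRealCLM.hasFDerivAt.comp x h1).congr_fderiv ?_
  ext v
  simp [gaussian]
  ring

theorem integrable_evalAt_mul_gaussian (P : MvPolynomial (Fin d) ℂ) :
    Integrable fun x => evalAt x P * gaussian x := by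
  obtain ⟨C, hC, h⟩ := norm_evalAt_le P one_pos
  have h1 := (GaussianFourier.integrable_cexp_neg_mul_sq_norm_add (V := Euc d) (b := 1 / 4)
    (by norm_num) 0 0).norm.const_mul (C * Real.exp 1)
  have hg : Continuous (gaussian (d := d)) := by unfold gaussian; fun_prop
  refine h1.mono' (by fun_prop) (Eventually.of_forall fun x => ?_)
  rw [norm_mul, gaussian, Complex.norm_real, Real.norm_of_nonneg (Real.exp_pos _).le,
    Complex.norm_exp]
  refine (mul_le_mul_of_nonneg_right (h x) (Real.exp_pos _).le).trans ?_
  rw [mul_assoc, mul_assoc, ← Real.exp_add, ← Real.exp_add]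
  refine mul_le_mul_of_nonneg_left (Real.exp_le_exp.2 ?_) hC
  have : (-(1 / 4 : ℂ) * (‖x‖ : ℂ) ^ 2 + 0 * (inner ℝ (0 : Euc d) x : ℝ)).re = -‖x‖ ^ 2 / 4 := by
    rw [show (-(1 / 4 : ℂ) * (‖x‖ : ℂ) ^ 2 + 0 * (inner ℝ (0 : Euc d) x : ℝ)) =
      ((-‖x‖ ^ 2 / 4 : ℝ) : ℂ) by push_cast; ring, Complex.ofReal_re]
  rw [this]
  nlinarith [sq_nonneg (‖x‖ - 2)]

/-- Gaussian integrals of polynomials. -/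
def gaussInt (P : MvPolynomial (Fin d) ℂ) : ℂ := ∫ x : Euc d, evalAt x P * gaussian x

theorem gaussInt_add (P Q : MvPolynomial (Fin d) ℂ) :
    gaussInt (P + Q) = gaussInt P + gaussInt Q := by
  simp only [gaussInt, evalAt_add, add_mul]
  exact integral_add (integrable_evalAt_mul_gaussian P) (integrable_evalAt_mul_gaussian Q)

theorem gaussInt_C_mul (c : ℂ) (P : MvPolynomial (Fin d) ℂ) :
    gaussInt (C c * P) = c * gaussInt P := by
  simp only [gaussInt, evalAt_mul, evalAt_C, mul_assoc]
  exact integral_const_mul _ _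

theorem gaussInt_zero : gaussInt (0 : MvPolynomial (Fin d) ℂ) = 0 := by
  simp [gaussInt, evalAt_zero]

theorem gaussInt_sum {ι : Type*} (t : Finset ι) (P : ι → MvPolynomial (Fin d) ℂ) :
    gaussInt (∑ i ∈ t, P i) = ∑ i ∈ t, gaussInt (P i) := by
  classical
  induction t using Finset.induction_on with
  | empty => simp [gaussInt_zero]
  | insert a t ha ih => rw [Finset.sum_insert ha, Finset.sum_insert ha, gaussInt_add, ih]

/-- Integration by parts, since the Gaussian satisfies `∂ᵢg = -xᵢg`. -/
theorem gaussInt_X_mul (i : Fin d) (P : MvPolynomial (Fin d) ℂ) :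
    gaussInt (X i * P) = gaussInt (pderiv i P) := by
  have hg : ∀ x : Euc d, fderiv ℝ gaussian x (EuclideanSpace.single i 1) =
      -((x i : ℂ) * gaussian x) := fun x => by
    rw [(hasFDerivAt_gaussian x).fderiv]
    simp [EuclideanSpace.inner_single_right]
  have h1 : ∀ x : Euc d, evalAt x P * fderiv ℝ gaussian x (EuclideanSpace.single i 1) =
      -(evalAt x (X i * P) * gaussian x) := fun x => by
    rw [hg, evalAt_mul, evalAt_X]
    ring
  have := integral_mul_fderiv_eq_neg_fderiv_mul_of_integrable (μ := (volume : Measure (Euc d)))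
    (f := fun x => evalAt x P) (g := gaussian) (v := EuclideanSpace.single i 1)
    (by simpa only [fderiv_evalAt_single] using integrable_evalAt_mul_gaussian (pderiv i P))
    (by simpa only [h1] using! (integrable_evalAt_mul_gaussian (X i * P)).neg)
    (integrable_evalAt_mul_gaussian P)
    (fun x _ => differentiableAt_evalAt P x)
    (fun x _ => (hasFDerivAt_gaussian x).differentiableAt)
  simp only [h1, fderiv_evalAt_single, integral_neg, neg_inj] at this
  exact this

/-- Euler's identity `nP = ∑ xᵢ∂ᵢP` followed by integration by parts. This single relation drives
all moment computations below. -/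
theorem natCast_mul_gaussInt {n : ℕ} {P : MvPolynomial (Fin d) ℂ} (h : P.IsHomogeneous n) :
    n * gaussInt P = gaussInt (polyLap d P) := by
  rw [← gaussInt_C_mul, map_natCast, ← nsmul_eq_mul, ← h.sum_X_mul_pderiv, gaussInt_sum,
    polyLap_apply, gaussInt_sum]
  exact Finset.sum_congr rfl fun i _ => gaussInt_X_mul i _

theorem gaussInt_one_ne_zero : gaussInt (1 : MvPolynomial (Fin d) ℂ) ≠ 0 := by
  have h := integrable_evalAt_mul_gaussian (1 : MvPolynomial (Fin d) ℂ)
  have h1 : ∀ x : Euc d, evalAt x 1 * gaussian x = ((Real.exp (-‖x‖ ^ 2 / 2) : ℝ) : ℂ) :=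
    fun x => by rw [evalAt, map_one, one_mul, gaussian]
  rw [gaussInt]
  simp only [h1] at h ⊢
  rw [integral_complex_ofReal, Complex.ofReal_ne_zero]
  refine (integral_exp_pos ?_).ne'
  exact h.re

/-- The linear form `⟨Z, x⟩`. -/
def linForm (Z : Euc d) : MvPolynomial (Fin d) ℂ := ∑ i, C (Z i : ℂ) * X i

/-- The derivative in the direction `Z`. -/
def dirDeriv (Z : Euc d) (P : MvPolynomial (Fin d) ℂ) : MvPolynomial (Fin d) ℂ :=
  ∑ i, C (Z i : ℂ) * pderiv i P

theorem evalAt_linForm (Z x : Euc d) : evalAt x (linForm Z) = (inner ℝ Z x : ℝ) := by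
  simp [linForm, evalAt_sum, evalAt_mul, evalAt_C, evalAt_X, PiLp.inner_apply, mul_comm]

theorem isHomogeneous_linForm (Z : Euc d) : (linForm Z).IsHomogeneous 1 :=
  IsHomogeneous.sum _ _ _ fun i _ => by
    simpa using (isHomogeneous_C (Fin d) (Z i : ℂ)).mul (isHomogeneous_X ℂ i)

theorem pderiv_linForm (Z : Euc d) (i : Fin d) : pderiv i (linForm Z) = C (Z i : ℂ) := by
  classical
  simp [linForm, pderiv_X, Pi.single_apply]

/-- For `a = 0` the truncated exponent `a - 1` is harmless, because the factor `a` removes that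
term. -/
theorem polyLap_linForm_pow_mul (Z : Euc d) (a : ℕ) {H : MvPolynomial (Fin d) ℂ}
    (hH : polyLap d H = 0) : polyLap d (linForm Z ^ (a + 1) * H) =
      C ((a + 1) * a * (‖Z‖ : ℂ) ^ 2) * (linForm Z ^ (a - 1) * H) +
        C (2 * (a + 1) : ℂ) * (linForm Z ^ a * dirDeriv Z H) := by
  have h1 : ∀ (b : ℕ) (i : Fin d), pderiv i (linForm Z ^ b) =
      C (b : ℂ) * (linForm Z ^ (b - 1) * C (Z i : ℂ)) := fun b i => by
    rw [Derivation.leibniz_pow, pderiv_linForm, nsmul_eq_mul, smul_eq_mul, map_natCast]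
  have h2 : (∑ i, (C (Z i : ℂ) * C (Z i : ℂ) : MvPolynomial (Fin d) ℂ)) =
      C ((‖Z‖ : ℂ) ^ 2) := by
    rw [← evalAt_sqNorm, sqNorm, evalAt_sum, map_sum]
    refine Finset.sum_congr rfl fun i _ => ?_
    rw [evalAt_pow, evalAt_X, sq, C_mul]
  have h3 : polyLap d (linForm Z ^ (a + 1)) =
      C ((a + 1) * a * (‖Z‖ : ℂ) ^ 2) * linForm Z ^ (a - 1) := by
    rw [C_mul, ← h2, Finset.mul_sum, Finset.sum_mul, polyLap_apply]
    refine Finset.sum_congr rfl fun i _ => ?_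
    rw [h1, pderiv_C_mul, pderiv_mul, pderiv_C, Nat.add_sub_cancel, h1]
    push_cast
    simp only [map_mul, map_add, map_one]
    ring
  have h4 : ∑ i, pderiv i (linForm Z ^ (a + 1)) * pderiv i H =
      C ((a : ℂ) + 1) * (linForm Z ^ a * dirDeriv Z H) := by
    rw [dirDeriv, Finset.mul_sum, Finset.mul_sum]
    refine Finset.sum_congr rfl fun i _ => ?_
    rw [h1, Nat.add_sub_cancel]
    push_cast
    ring
  rw [polyLap_mul, h3, h4, hH, mul_zero, add_zero]
  simp only [map_mul, map_add, map_one, map_ofNat]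
  ring

theorem isHarmonicPoly_dirDeriv (Z : Euc d) {s : ℕ} {H : MvPolynomial (Fin d) ℂ}
    (h : IsHarmonicPoly s H) : IsHarmonicPoly (s - 1) (dirDeriv Z H) := by
  rw [isHarmonicPoly_iff] at h ⊢
  refine ⟨IsHomogeneous.sum _ _ _ fun i _ => ?_, ?_⟩
  · simpa using (isHomogeneous_C (Fin d) (Z i : ℂ)).mul (h.1.pderiv (i := i))
  · rw [dirDeriv, map_sum]
    refine Finset.sum_eq_zero fun i _ => ?_
    rw [C_mul', map_smul, polyLap_apply]
    have : ∀ j, pderiv j (pderiv j (pderiv i H)) = pderiv i (pderiv j (pderiv j H)) := fun j => by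
      rw [pderiv_comm j i H, pderiv_comm j i]
    simp only [this]
    rw [← map_sum, ← polyLap_apply, h.2, map_zero, smul_zero]

theorem evalAt_dirDeriv (Z : Euc d) {s : ℕ} {H : MvPolynomial (Fin d) ℂ}
    (h : H.IsHomogeneous s) : evalAt Z (dirDeriv Z H) = s * evalAt Z H := by
  have := congrArg (evalAt Z) h.sum_X_mul_pderiv
  rw [evalAt_sum, nsmul_eq_mul, evalAt_mul] at this
  rw [dirDeriv, evalAt_sum]
  simp only [evalAt_mul, evalAt_X, evalAt_C] at this ⊢
  rw [this]
  congr 1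
  simp [evalAt]

/-- Strong induction on the exponent: `natCast_mul_gaussInt` lowers it by two with the same `H`, or
by one with `H` replaced by its derivative along `Z`. Both moves preserve whether `a - s` is a
nonnegative even number, hence the dichotomy. -/
theorem gaussInt_linForm_pow_mul (Z : Euc d) (a : ℕ) :
    ∀ (s : ℕ) (H : MvPolynomial (Fin d) ℂ), IsHarmonicPoly s H →
      (∀ m, a = s + 2 * m → gaussInt (linForm Z ^ a * H) * (2 ^ m * m.factorial) =
        gaussInt (1 : MvPolynomial (Fin d) ℂ) * a.factorial * (‖Z‖ : ℂ) ^ (2 * m) * evalAt Z H) ∧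
      ((∀ m, a ≠ s + 2 * m) → gaussInt (linForm Z ^ a * H) = 0) := by
  induction a using Nat.strong_induction_on with
  | _ a ih =>
  intro s H hH'
  have hH := isHarmonicPoly_iff.1 hH'
  rcases a with _ | a
  · rw [pow_zero, one_mul]
    constructor
    · intro m hm
      obtain ⟨rfl, rfl⟩ : s = 0 ∧ m = 0 := by omega
      have h0 := hH.1
      rw [← totalDegree_zero_iff_isHomogeneous, totalDegree_eq_zero_iff_eq_C] at h0
      rw [h0, ← mul_one (C _), gaussInt_C_mul, mul_one, evalAt_C]
      simp
      ring
    · intro hs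
      have h1 := natCast_mul_gaussInt hH.1
      rw [hH.2, gaussInt_zero] at h1
      exact (mul_eq_zero.1 h1).resolve_left (Nat.cast_ne_zero.2 fun h => hs 0 (by omega))
  · have hhom : (linForm Z ^ (a + 1) * H).IsHomogeneous (a + 1 + s) := by
      simpa using ((isHomogeneous_linForm Z).pow (a + 1)).mul hH.1
    have key := natCast_mul_gaussInt hhom
    rw [polyLap_linForm_pow_mul Z a hH.2, gaussInt_add, gaussInt_C_mul, gaussInt_C_mul] at key
    have hD := ih a (Nat.lt_succ_self a) (s - 1) _ (isHarmonicPoly_dirDeriv Z hH')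
    have hD0 : s = 0 → dirDeriv Z H = 0 := fun hs => by
      subst hs
      simp [dirDeriv, pderiv_eq_zero_of_isHomogeneous_zero hH.1]
    constructor
    · intro m hm
      have e1 : (a : ℂ) * gaussInt (linForm Z ^ (a - 1) * H) * (‖Z‖ : ℂ) ^ 2 *
          (2 ^ m * m.factorial) = 2 * m * (gaussInt (1 : MvPolynomial (Fin d) ℂ) * a.factorial *
            (‖Z‖ : ℂ) ^ (2 * m) * evalAt Z H) := by
        rcases m with _ | m
        · rcases Nat.eq_zero_or_pos a with rfl | ha
          · simp
          · rw [(ih (a - 1) (by omega) s H hH').2 fun m h => by omega]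
            simp
        · have := (ih (a - 1) (by omega) s H hH').1 m (by omega)
          obtain ⟨b, rfl⟩ : ∃ b, a = b + 1 := ⟨a - 1, by omega⟩
          rw [Nat.add_sub_cancel] at this ⊢
          rw [Nat.factorial_succ, Nat.factorial_succ]
          push_cast
          linear_combination ((b : ℂ) + 1) * (‖Z‖ : ℂ) ^ 2 * 2 * (m + 1) * this
      have e2 : gaussInt (linForm Z ^ a * dirDeriv Z H) * (2 ^ m * m.factorial) =
          s * (gaussInt (1 : MvPolynomial (Fin d) ℂ) * a.factorial *
            (‖Z‖ : ℂ) ^ (2 * m) * evalAt Z H) := by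
        rcases Nat.eq_zero_or_pos s with hs | hs
        · rw [hD0 hs, mul_zero, gaussInt_zero, hs]
          simp
        · rw [hD.1 m (by omega), evalAt_dirDeriv Z hH.1]
          ring
      have hne : ((a + 1 + s : ℕ) : ℂ) ≠ 0 := Nat.cast_ne_zero.2 (by omega)
      -- The two contributions carry the factors `2m` and `2s`, and by this relation their sum is
      -- the degree `a + 1 + s` on the left.
      have hm' : (a : ℂ) + 1 = s + 2 * m := by exact_mod_cast hm
      refine mul_left_cancel₀ hne ?_
      rw [← mul_assoc, key, Nat.factorial_succ]
      push_cast
      linear_combination ((a : ℂ) + 1) * e1 + 2 * ((a : ℂ) + 1) * e2 -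
        ((a : ℂ) + 1) * gaussInt (1 : MvPolynomial (Fin d) ℂ) * a.factorial *
            (‖Z‖ : ℂ) ^ (2 * m) * evalAt Z H * hm'
    · intro hm
      have hne : ((a + 1 + s : ℕ) : ℂ) ≠ 0 := Nat.cast_ne_zero.2 (by omega)
      refine (mul_eq_zero.1 (key.trans ?_)).resolve_left hne
      have e1 : ((a : ℂ) + 1) * a * (‖Z‖ : ℂ) ^ 2 * gaussInt (linForm Z ^ (a - 1) * H) = 0 := by
        rcases Nat.eq_zero_or_pos a with rfl | ha
        · simp
        · rw [(ih (a - 1) (by omega) s H hH').2 fun m h => hm (m + 1) (by omega), mul_zero]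
      have e2 : gaussInt (linForm Z ^ a * dirDeriv Z H) = 0 := by
        rcases Nat.eq_zero_or_pos s with hs | hs
        · rw [hD0 hs, mul_zero, gaussInt_zero]
        · exact hD.2 fun m h => hm m (by omega)
      rw [e1, e2, mul_zero, add_zero]

end ZBall
end

noncomputable section
namespace ZBall
open MvPolynomial Filter Topology

/-! ### Integrals over the unit sphere -/

variable {d : ℕ}

/-- Radial Gaussian moments. -/
def radialMoment (d n : ℕ) : ℂ :=
  ∫ r, (r : ℂ) ^ n * (Real.exp (-r ^ 2 / 2) : ℝ) ∂radialMeasure (d - 1)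

theorem gaussInt_eq_radialMoment_mul (hd : 0 < d) {n : ℕ} {P : MvPolynomial (Fin d) ℂ}
    (h : P.IsHomogeneous n) :
    gaussInt P = radialMoment d n * ∫ u : Metric.sphere (0 : Euc d) 1, evalAt (u : Euc d) P
      ∂sphereMeasure d := by
  rw [gaussInt, integral_polar hd (integrable_evalAt_mul_gaussian P), radialMoment,
    ← integral_mul_const]
  refine integral_congr_ae (Eventually.of_forall fun r => ?_)
  simp only
  rw [← integral_const_mul]
  refine integral_congr_ae (Eventually.of_forall fun u => ?_)
  have hu : ‖(u : Euc d)‖ = 1 := norm_eq_of_mem_sphere u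
  simp only [evalAt_smul_of_isHomogeneous h, gaussian, norm_smul, hu, mul_one, Real.norm_eq_abs,
    sq_abs]
  ring

theorem isHarmonicPoly_C (c : ℂ) : IsHarmonicPoly 0 (C c : MvPolynomial (Fin d) ℂ) :=
  isHarmonicPoly_iff.2 ⟨isHomogeneous_C _ _, by simp [polyLap_apply]⟩

theorem sphereMeasure_real_univ_ne_zero (hd : 0 < d) : (sphereMeasure d).real univ ≠ 0 := by
  have := nontrivial_euc hd
  rw [measureReal_def, ENNReal.toReal_ne_zero]
  exact ⟨by rw [Ne, Measure.measure_univ_eq_zero]; exact Measure.toSphere_ne_zero _,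
    measure_ne_top _ _⟩

theorem gaussInt_sqNorm_pow (hd : 0 < d) (m : ℕ) :
    gaussInt (sqNorm d ^ m) = radialMoment d (2 * m) * (sphereMeasure d).real univ := by
  rw [gaussInt_eq_radialMoment_mul hd (isHomogeneous_sqNorm.pow m)]
  congr 1
  have : ∀ u : Metric.sphere (0 : Euc d) 1, evalAt (u : Euc d) (sqNorm d ^ m) = 1 := fun u => by
    have hu : ‖(u : Euc d)‖ = 1 := norm_eq_of_mem_sphere u
    rw [evalAt_pow, evalAt_sqNorm, hu]
    simp
  simp [this]

/-- `natCast_mul_gaussInt` applied to a power of `|x|²`, so the Gamma function need not be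
evaluated. -/
theorem radialMoment_succ (hd : 0 < d) (m : ℕ) :
    radialMoment d (2 * (m + 1)) = (2 * m + d) * radialMoment d (2 * m) := by
  have h1 := polyLap_sqNorm_pow_mul (isHarmonicPoly_C (d := d) 1) m
  have h2 := natCast_mul_gaussInt ((isHomogeneous_sqNorm (d := d)).pow (m + 1))
  simp only [C_1, mul_one] at h1
  rw [h1, gaussInt_C_mul, gaussInt_sqNorm_pow hd, gaussInt_sqNorm_pow hd] at h2
  have hne : ((2 * (m + 1) : ℕ) : ℂ) ≠ 0 := Nat.cast_ne_zero.2 (by omega)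
  have hS : ((sphereMeasure d).real univ : ℂ) ≠ 0 :=
    Complex.ofReal_ne_zero.2 (sphereMeasure_real_univ_ne_zero hd)
  refine mul_left_cancel₀ hne (mul_right_cancel₀ hS ?_)
  push_cast at h2 ⊢
  linear_combination h2

theorem integral_radialMeasure (n : ℕ) (f : ℝ → ℂ) :
    ∫ r, f r ∂radialMeasure n = ∫ r in Ioi (0 : ℝ), ((r : ℝ) : ℂ) ^ n * f r := by
  rw [radialMeasure, integral_withDensity_eq_integral_toReal_smul (by fun_prop)
    (Eventually.of_forall fun _ => ENNReal.ofReal_lt_top)]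
  refine setIntegral_congr_fun measurableSet_Ioi fun r hr => ?_
  have hr' : (0 : ℝ) < r := hr
  rw [ENNReal.toReal_ofReal (by positivity), Complex.real_smul]
  push_cast
  rfl

theorem radialMoment_ne_zero (n : ℕ) : radialMoment d n ≠ 0 := by
  have h : radialMoment d n = ((∫ r in Ioi (0 : ℝ),
      r ^ ((d - 1 + n : ℕ) : ℝ) * Real.exp (-(1 / 2) * r ^ (2 : ℝ)) : ℝ) : ℂ) := by
    rw [radialMoment, integral_radialMeasure, ← integral_complex_ofReal]
    refine setIntegral_congr_fun measurableSet_Ioi fun r hr => ?_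
    rw [Real.rpow_natCast, Real.rpow_two, pow_add, show -(1 / 2) * r ^ 2 = -r ^ 2 / 2 by ring]
    push_cast
    ring
  rw [h, Complex.ofReal_ne_zero, integral_rpow_mul_exp_neg_mul_rpow two_pos
    (neg_one_lt_zero.trans_le (Nat.cast_nonneg' _)) (by norm_num)]
  have := Real.Gamma_pos_of_pos (s := (((d - 1 + n : ℕ) : ℝ) + 1) / 2) (by positivity)
  positivity

/-- Source of the Bessel denominators: the moment ratios supply the factors `2j + 2s + d`, and `2ᵐ
m!` supplies the factors `2j + 2`. -/
theorem radialMoment_mul_factorial (hd : 0 < d) (s m : ℕ) :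
    radialMoment d (2 * (s + m)) * (2 ^ m * m.factorial) =
      radialMoment d (2 * s) * besselDenom (d - 1 + 2 * s) m := by
  induction m with
  | zero => simp [besselDenom_zero]
  | succ m ih =>
    rw [← add_assoc, radialMoment_succ hd, besselDenom_succ, Nat.factorial_succ]
    obtain ⟨e, rfl⟩ : ∃ e, d = e + 1 := ⟨d - 1, by omega⟩
    rw [Nat.add_sub_cancel] at ih ⊢
    push_cast
    linear_combination (2 * (m + 1) * (2 * ((s : ℂ) + m) + (e + 1))) * ih

theorem integral_sphere_linForm (hd : 0 < d) (Z : Euc d) {s : ℕ} {H : MvPolynomial (Fin d) ℂ}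
    (hH : IsHarmonicPoly s H) (m : ℕ) :
    (∫ u : Metric.sphere (0 : Euc d) 1, evalAt (u : Euc d) (linForm Z ^ (s + 2 * m) * H)
      ∂sphereMeasure d) * besselDenom (d - 1 + 2 * s) m =
    gaussInt (1 : MvPolynomial (Fin d) ℂ) / radialMoment d (2 * s) * (s + 2 * m).factorial *
      (‖Z‖ : ℂ) ^ (2 * m) * evalAt Z H := by
  have h1 := (gaussInt_linForm_pow_mul Z (s + 2 * m) s H hH).1 m rfl
  have hhom : (linForm Z ^ (s + 2 * m) * H).IsHomogeneous (2 * (s + m)) := by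
    have := ((isHomogeneous_linForm Z).pow (s + 2 * m)).mul hH.1
    rwa [show 1 * (s + 2 * m) + s = 2 * (s + m) by ring] at this
  rw [gaussInt_eq_radialMoment_mul hd hhom] at h1
  have h2 := radialMoment_mul_factorial hd s m
  have h3 := radialMoment_ne_zero (d := d) (2 * s)
  rw [div_mul_eq_mul_div, div_mul_eq_mul_div, div_mul_eq_mul_div, eq_div_iff h3, ← h1]
  linear_combination (-(∫ u : Metric.sphere (0 : Euc d) 1,
    evalAt (u : Euc d) (linForm Z ^ (s + 2 * m) * H) ∂sphereMeasure d)) * h2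

theorem integral_sphere_linForm_of_ne (hd : 0 < d) (Z : Euc d) {s : ℕ}
    {H : MvPolynomial (Fin d) ℂ} (hH : IsHarmonicPoly s H) {a : ℕ} (ha : ∀ m, a ≠ s + 2 * m) :
    ∫ u : Metric.sphere (0 : Euc d) 1, evalAt (u : Euc d) (linForm Z ^ a * H)
      ∂sphereMeasure d = 0 := by
  have h1 := (gaussInt_linForm_pow_mul Z a s H hH).2 ha
  rw [gaussInt_eq_radialMoment_mul hd (((isHomogeneous_linForm Z).pow a).mul hH.1)] at h1
  exact (mul_eq_zero.1 h1).resolve_left (radialMoment_ne_zero _)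

/-- The constant in the Funk–Hecke formula. -/
def funkHecke (d s : ℕ) : ℂ :=
  Complex.I ^ s * (gaussInt (1 : MvPolynomial (Fin d) ℂ) / radialMoment d (2 * s))

theorem funkHecke_ne_zero (s : ℕ) : funkHecke d s ≠ 0 :=
  mul_ne_zero (pow_ne_zero _ Complex.I_ne_zero)
    (div_ne_zero gaussInt_one_ne_zero (radialMoment_ne_zero _))

/-- Funk–Hecke formula. In the exponential series only the powers `s + 2m` of `⟨Z, u⟩` survive
against a harmonic of degree `s`, and what remains is the Bessel series times `H(Z)`. -/
theorem integral_sphere_exp_mul (hd : 0 < d) (Z : Euc d) {s : ℕ} {H : MvPolynomial (Fin d) ℂ}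
    (hH : IsHarmonicPoly s H) :
    ∫ u : Metric.sphere (0 : Euc d) 1, Complex.exp (Complex.I * (inner ℝ Z (u : Euc d) : ℝ)) *
      evalAt (u : Euc d) H ∂sphereMeasure d =
    funkHecke d s * bessel (d - 1 + 2 * s) (‖Z‖ ^ 2) * evalAt Z H := by
  have hsum : HasSum (fun a : ℕ => ∫ u : Metric.sphere (0 : Euc d) 1,
      Complex.I ^ a / a.factorial * evalAt (u : Euc d) (linForm Z ^ a * H) ∂sphereMeasure d)
      (∫ u : Metric.sphere (0 : Euc d) 1, Complex.exp (Complex.I * (inner ℝ Z (u : Euc d) : ℝ)) *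
        evalAt (u : Euc d) H ∂sphereMeasure d) := by
    refine hasSum_integral_of_dominated_convergence
      (fun a u => ‖Z‖ ^ a / a.factorial * ‖evalAt (u : Euc d) H‖) (fun a => ?_) (fun a => ?_)
      ?_ ?_ ?_
    · exact Continuous.aestronglyMeasurable (by fun_prop)
    · refine Eventually.of_forall fun u => ?_
      have hu : ‖(u : Euc d)‖ = 1 := norm_eq_of_mem_sphere u
      rw [evalAt_mul, evalAt_pow, evalAt_linForm, norm_mul, norm_mul, ← mul_assoc, norm_div,
        norm_pow, norm_pow, Complex.norm_I, one_pow, Complex.norm_natCast, Complex.norm_real,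
        div_mul_eq_mul_div, one_mul]
      have := norm_inner_le_norm (𝕜 := ℝ) Z (u : Euc d)
      rw [hu, mul_one] at this
      gcongr
    · exact Eventually.of_forall fun u => (Real.summable_pow_div_factorial ‖Z‖).mul_right _
    · simp only [tsum_mul_right]
      exact (Continuous.integrable_of_hasCompactSupport (by fun_prop)
        (HasCompactSupport.of_compactSpace _)).const_mul _
    · refine Eventually.of_forall fun u => ?_
      have h1 := NormedSpace.expSeries_div_hasSum_exp
        (Complex.I * ((inner ℝ Z (u : Euc d) : ℝ) : ℂ))
      rw [← Complex.exp_eq_exp_ℂ] at h1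
      refine (h1.mul_right (evalAt (u : Euc d) H)).congr_fun fun a => ?_
      rw [evalAt_mul, evalAt_pow, evalAt_linForm, mul_pow]
      ring
  have hinj : Function.Injective fun m : ℕ => s + 2 * m := fun a b h => by
    simp only at h
    omega
  rw [← hinj.hasSum_iff] at hsum
  · have h1 : HasSum (fun m : ℕ => funkHecke d s *
        (((-(‖Z‖ ^ 2)) ^ m / besselDenom (d - 1 + 2 * s) m : ℝ) : ℂ) * evalAt Z H)
        (funkHecke d s * bessel (d - 1 + 2 * s) (‖Z‖ ^ 2) * evalAt Z H) :=
      ((Complex.hasSum_ofReal.2 (summable_bessel (d - 1 + 2 * s) (‖Z‖ ^ 2)).hasSum).mul_left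
        _).mul_right _
    refine hsum.unique (h1.congr_fun fun m => ?_)
    have h2 := integral_sphere_linForm hd Z hH m
    have h3 : (besselDenom (d - 1 + 2 * s) m : ℂ) ≠ 0 :=
      Complex.ofReal_ne_zero.2 (besselDenom_pos _ m).ne'
    have h4 : ((s + 2 * m).factorial : ℂ) ≠ 0 := Nat.cast_ne_zero.2 (Nat.factorial_ne_zero _)
    simp only [Function.comp_apply]
    rw [integral_const_mul]
    rw [← eq_div_iff h3] at h2
    rw [h2, funkHecke, pow_add, pow_mul, Complex.I_sq, pow_mul (‖Z‖ : ℂ), neg_pow (‖Z‖ ^ 2)]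
    push_cast
    field_simp
  · intro a ha
    rw [integral_const_mul, integral_sphere_linForm_of_ne hd Z hH fun m hm => ha ⟨m, hm.symm⟩,
      mul_zero]

end ZBall
end

noncomputable section
namespace ZBall
open MvPolynomial Filter Topology

/-! ### Uniqueness of the decomposition into spherical harmonics -/

variable {d : ℕ}

theorem exists_eq_norm_smul (hd : 0 < d) (x : Euc d) : ∃ u : Euc d, ‖u‖ = 1 ∧ x = ‖x‖ • u := by
  have := nontrivial_euc hd
  rcases eq_or_ne x 0 with rfl | hx
  · obtain ⟨u, hu⟩ := exists_norm_eq (Euc d) zero_le_one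
    exact ⟨u, hu, by simp⟩
  · have hx' : ‖x‖ ≠ 0 := norm_ne_zero_iff.2 hx
    exact ⟨‖x‖⁻¹ • x, by rw [norm_smul, norm_inv, norm_norm, inv_mul_cancel₀ hx'],
      by rw [smul_smul, mul_inv_cancel₀ hx', one_smul]⟩

theorem sum_funkHecke_eq_zero (hd : 0 < d) {H : ℕ →₀ MvPolynomial (Fin d) ℂ}
    (hH : ∀ j, IsHarmonicPoly j (H j)) (h0 : ∀ u : Euc d, ‖u‖ = 1 → H.sum (fun _ h => evalAt u h) = 0)
    (Z : Euc d) :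
    ∑ j ∈ H.support, funkHecke d j * bessel (d - 1 + 2 * j) (‖Z‖ ^ 2) * evalAt Z (H j) = 0 := by
  have h1 : ∀ j, Integrable (fun u : Metric.sphere (0 : Euc d) 1 =>
      Complex.exp (Complex.I * (inner ℝ Z (u : Euc d) : ℝ)) * evalAt (u : Euc d) (H j))
      (sphereMeasure d) := fun j =>
    Continuous.integrable_of_hasCompactSupport (by fun_prop) (HasCompactSupport.of_compactSpace _)
  simp only [← integral_sphere_exp_mul hd Z (hH _)]
  rw [← integral_finsetSum _ fun j _ => h1 j]
  refine integral_eq_zero_of_ae (Eventually.of_forall fun u => ?_)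
  simp only
  rw [← Finset.mul_sum]
  exact mul_eq_zero_of_right _ (h0 u (norm_eq_of_mem_sphere u))

/-- By Funk–Hecke, a vanishing sum of harmonics on the sphere gives a vanishing sum of Bessel
functions times the same harmonics on the whole space. Along a ray these have different orders of
vanishing at the origin, so the lowest degree drops out first. -/
theorem evalAt_eq_zero_of_sum_eq_zero (hd : 0 < d) {H : ℕ →₀ MvPolynomial (Fin d) ℂ}
    (hH : ∀ j, IsHarmonicPoly j (H j)) (h0 : ∀ u : Euc d, ‖u‖ = 1 → H.sum (fun _ h => evalAt u h) = 0)
    (j : ℕ) (x : Euc d) : evalAt x (H j) = 0 := by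
  induction j using Nat.strong_induction_on generalizing x with
  | _ j ih =>
  suffices hu : ∀ u : Euc d, ‖u‖ = 1 → evalAt u (H j) = 0 by
    obtain ⟨u, hu1, hxu⟩ := exists_eq_norm_smul hd x
    rw [hxu, evalAt_smul_of_isHomogeneous (hH j).1, hu u hu1, mul_zero]
  intro u hu
  -- The transform along the ray of `u`, divided by `tʲ`. Truncation in `i - j` does not matter,
  -- because the terms with `i < j` vanish by induction. The value at `0` isolates degree `j`.
  let g : ℝ → ℂ := fun t => ∑ i ∈ H.support,
    funkHecke d i * bessel (d - 1 + 2 * i) (t ^ 2) * ((t : ℂ) ^ (i - j) * evalAt u (H i))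
  have hg : Continuous g := by
    unfold g
    fun_prop
  have hg0 : ∀ t, t ≠ 0 → g t = 0 := by
    intro t ht
    have h1 := sum_funkHecke_eq_zero hd hH h0 (t • u)
    have ht' : ((t : ℝ) : ℂ) ^ j ≠ 0 := pow_ne_zero _ (Complex.ofReal_ne_zero.2 ht)
    refine (mul_eq_zero.1 ((?_ : (t : ℂ) ^ j * g t = _).trans h1)).resolve_left ht'
    rw [Finset.mul_sum]
    refine Finset.sum_congr rfl fun i _ => ?_
    rw [evalAt_smul_of_isHomogeneous (hH i).1, norm_smul, hu, mul_one, Real.norm_eq_abs, sq_abs]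
    rcases lt_or_ge i j with hij | hij
    · rw [ih i hij]
      simp
    · obtain ⟨e, rfl⟩ := Nat.exists_eq_add_of_le hij
      rw [Nat.add_sub_cancel_left, pow_add]
      ring
  have hg00 : g 0 = 0 := by
    have := hg.ext_on (dense_compl_singleton (0 : ℝ)) continuous_const fun t ht => hg0 t ht
    exact congrFun this 0
  by_cases hj : j ∈ H.support
  · have h2 : g 0 = funkHecke d j * evalAt u (H j) := by
      unfold g
      rw [Finset.sum_eq_single_of_mem j hj]
      · simp [bessel_zero]
      · intro i _ hij
        rcases lt_or_gt_of_ne hij with h | h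
        · rw [ih i h]
          simp
        · rw [Complex.ofReal_zero, zero_pow (show i - j ≠ 0 by omega), zero_mul, mul_zero]
    rw [hg00] at h2
    exact (mul_eq_zero.1 h2.symm).resolve_left (funkHecke_ne_zero j)
  · rw [Finsupp.notMem_support_iff.1 hj, evalAt_zero]

theorem IsHarmonicPoly.zero (s : ℕ) : IsHarmonicPoly s (0 : MvPolynomial (Fin d) ℂ) :=
  isHarmonicPoly_iff.2 ⟨isHomogeneous_zero _ _ _, map_zero _⟩

theorem IsHarmonicPoly.add {s : ℕ} {P Q : MvPolynomial (Fin d) ℂ} (hP : IsHarmonicPoly s P)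
    (hQ : IsHarmonicPoly s Q) : IsHarmonicPoly s (P + Q) := by
  rw [isHarmonicPoly_iff] at *
  exact ⟨hP.1.add hQ.1, by rw [map_add, hP.2, hQ.2, add_zero]⟩

theorem IsHarmonicPoly.smul {s : ℕ} {P : MvPolynomial (Fin d) ℂ} (hP : IsHarmonicPoly s P)
    (c : ℂ) : IsHarmonicPoly s (c • P) := by
  rw [isHarmonicPoly_iff] at *
  exact ⟨(homogeneousSubmodule (Fin d) ℂ s).smul_mem c hP.1, by rw [map_smul, hP.2, smul_zero]⟩

theorem IsHarmonicPoly.sum {ι : Type*} (t : Finset ι) {s : ℕ} {P : ι → MvPolynomial (Fin d) ℂ}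
    (h : ∀ i ∈ t, IsHarmonicPoly s (P i)) : IsHarmonicPoly s (∑ i ∈ t, P i) :=
  Finset.sum_induction _ (IsHarmonicPoly s) (fun _ _ => IsHarmonicPoly.add) (.zero s) h

theorem isHarmonicPoly_harmProj (s : ℕ) (f : Euc d → ℂ) : IsHarmonicPoly s (harmProj s f) := by
  rw [harmProj]
  split_ifs with h
  · exact h.choose_spec.1 s
  · exact .zero s

/-- Uniqueness makes the chosen decomposition irrelevant, so any convenient one may be used. -/
theorem evalAt_harmProj (hd : 0 < d) {f : Euc d → ℂ} {H : ℕ →₀ MvPolynomial (Fin d) ℂ}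
    (hH : IsHarmonicDecomposition f H) (s : ℕ) (x : Euc d) :
    evalAt x (harmProj s f) = evalAt x (H s) := by
  have hex : ∃ H, IsHarmonicDecomposition f H := ⟨H, hH⟩
  rw [harmProj, dif_pos hex, ← sub_eq_zero, ← evalAt_sub, ← Finsupp.sub_apply]
  refine evalAt_eq_zero_of_sum_eq_zero hd (fun j => ?_) (fun u hu => ?_) s x
  · rw [Finsupp.sub_apply, sub_eq_add_neg, ← neg_one_smul ℂ (H j)]
    exact (hex.choose_spec.1 j).add ((hH.1 j).smul _)
  · rw [Finsupp.sum_sub_index fun _ => evalAt_sub u, ← hex.choose_spec.2 u hu, ← hH.2 u hu, sub_self]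

theorem evalAt_harmProj_sum (hd : 0 < d) {ι : Type} [Fintype ι] (c : ι → ℂ)
    (Q : ι → MvPolynomial (Fin d) ℂ) (s : ℕ) (x : Euc d) :
    evalAt x (harmProj s fun u => ∑ i, c i * evalAt u (Q i)) =
      ∑ i, c i * evalAt x (harmProj s fun u => evalAt u (Q i)) := by
  choose H hH using fun i => exists_decomposition hd (Q i)
  have hK : IsHarmonicDecomposition (fun u => ∑ i, c i * evalAt u (Q i)) (∑ i, c i • H i) := by
    refine ⟨fun j => ?_, fun u hu => ?_⟩
    · rw [Finsupp.finsetSum_apply]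
      exact IsHarmonicPoly.sum _ fun i _ => ((hH i).1 j).smul _
    · rw [← Finsupp.sum_finsetSum_index (fun _ => evalAt_zero u) (fun _ => evalAt_add u)]
      refine Finset.sum_congr rfl fun i _ => ?_
      have h1 : evalAt u (Q i) = (H i).sum fun _ h => evalAt u h := (hH i).2 u hu
      rw [h1, Finsupp.sum_smul_index' (fun _ => evalAt_zero u), Finsupp.mul_sum]
      simp only [evalAt_smul]
  rw [evalAt_harmProj hd hK, Finsupp.finsetSum_apply, evalAt_sum]
  refine Finset.sum_congr rfl fun i _ => ?_
  rw [Finsupp.smul_apply, evalAt_smul, evalAt_harmProj hd (hH i)]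

/-! ### Symbols -/

variable {k l m : ℕ}

/-- Functions on `ℝᵏ × ℝˡ` that are polynomials in both variables. -/
def IsBiPoly (f : Euc k → Euc l → ℂ) : Prop :=
  ∃ (ι : Type) (_ : Fintype ι) (P : ι → MvPolynomial (Fin k) ℂ) (Q : ι → MvPolynomial (Fin l) ℂ),
    ∀ X u, f X u = ∑ i, evalAt X (P i) * evalAt u (Q i)

theorem IsBiPoly.add {f g : Euc k → Euc l → ℂ} (hf : IsBiPoly f) (hg : IsBiPoly g) :
    IsBiPoly fun X u => f X u + g X u := by
  obtain ⟨ι, _, P, Q, h⟩ := hf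
  obtain ⟨ι', _, P', Q', h'⟩ := hg
  refine ⟨ι ⊕ ι', inferInstance, Sum.elim P P', Sum.elim Q Q', fun X u => ?_⟩
  simp [h, h']

theorem IsBiPoly.mul {f g : Euc k → Euc l → ℂ} (hf : IsBiPoly f) (hg : IsBiPoly g) :
    IsBiPoly fun X u => f X u * g X u := by
  obtain ⟨ι, _, P, Q, h⟩ := hf
  obtain ⟨ι', _, P', Q', h'⟩ := hg
  refine ⟨ι × ι', inferInstance, fun i => P i.1 * P' i.2, fun i => Q i.1 * Q' i.2, fun X u => ?_⟩
  simp only [h, h']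
  rw [Finset.sum_mul_sum, Fintype.sum_prod_type]
  refine Finset.sum_congr rfl fun i _ => Finset.sum_congr rfl fun j _ => ?_
  rw [evalAt_mul, evalAt_mul]
  ring

theorem isBiPoly_mul (P : MvPolynomial (Fin k) ℂ) (Q : MvPolynomial (Fin l) ℂ) :
    IsBiPoly fun X u => evalAt X P * evalAt u Q :=
  ⟨Unit, inferInstance, fun _ => P, fun _ => Q, fun X u => by simp⟩

theorem isBiPoly_const (c : ℂ) : IsBiPoly fun (_ : Euc k) (_ : Euc l) => c := by
  simpa only [evalAt_C, mul_one] using isBiPoly_mul (k := k) (l := l) (C c) (C 1)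

theorem IsBiPoly.pow {f : Euc k → Euc l → ℂ} (hf : IsBiPoly f) (n : ℕ) :
    IsBiPoly fun X u => f X u ^ n := by
  induction n with
  | zero => simpa using isBiPoly_const 1
  | succ n ih => simpa only [pow_succ] using ih.mul hf

theorem IsBiPoly.prod {ι : Type*} (t : Finset ι) {f : ι → Euc k → Euc l → ℂ}
    (hf : ∀ i, IsBiPoly (f i)) : IsBiPoly fun X u => ∏ i ∈ t, f i X u := by
  classical
  induction t using Finset.induction_on with
  | empty => simpa using isBiPoly_const 1
  | insert a t ha ih => simpa only [Finset.prod_insert ha] using (hf a).mul ih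

theorem IsBiPoly.sum {ι : Type*} (t : Finset ι) {f : ι → Euc k → Euc l → ℂ}
    (hf : ∀ i, IsBiPoly (f i)) : IsBiPoly fun X u => ∑ i ∈ t, f i X u := by
  classical
  induction t using Finset.induction_on with
  | empty => simpa using isBiPoly_const 0
  | insert a t ha ih => simpa only [Finset.sum_insert ha] using (hf a).add ih

theorem isBiPoly_inner (Q : Euc k) : IsBiPoly fun (X : Euc k) (_ : Euc l) => (inner ℝ Q X : ℂ) := by
  simpa only [evalAt_C, evalAt_linForm, mul_one] using isBiPoly_mul (l := l) (linForm Q) (C 1)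

theorem isBiPoly_inner_J (S : HTypeStructure k l) (Q : Euc k) :
    IsBiPoly fun X u => (inner ℝ (S.J u Q) X : ℂ) := by
  have h := IsBiPoly.sum Finset.univ fun j : Fin l =>
    isBiPoly_mul (linForm (S.J (EuclideanSpace.single j 1) Q)) (X j : MvPolynomial (Fin l) ℂ)
  convert h using 3 with Y u
  have hu : u = ∑ j, u j • EuclideanSpace.single j (1 : ℝ) := by
    conv_lhs => rw [← (EuclideanSpace.basisFun (Fin l) ℝ).sum_repr u]
    simp
  conv_lhs => rw [hu]
  simp only [map_sum, map_smul, LinearMap.sum_apply, LinearMap.smul_apply, sum_inner,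
    real_inner_smul_left, evalAt_linForm, evalAt_X]
  push_cast
  exact Finset.sum_congr rfl fun j _ => mul_comm _ _

theorem isBiPoly_twist (S : HTypeStructure k l) (B : Fin m → Euc k) (p q : Fin m → ℕ) :
    IsBiPoly (twist S B p q) := by
  have h1 : ∀ Q, IsBiPoly fun X u => theta S Q X u := fun Q =>
    (isBiPoly_inner Q).add ((isBiPoly_const Complex.I).mul (isBiPoly_inner_J S Q))
  have h2 : ∀ Q, IsBiPoly fun X u => (starRingEnd ℂ) (theta S Q X u) := fun Q => by
    have := (isBiPoly_inner Q).add ((isBiPoly_const (-Complex.I)).mul (isBiPoly_inner_J S Q))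
    simpa [theta] using this
  exact IsBiPoly.prod Finset.univ fun i => ((h1 (B i)).pow (p i)).mul ((h2 (B i)).pow (q i))

theorem isBiPoly_harmTwist (hk : 0 < k) (S : HTypeStructure k l) (n : ℕ) (B : Fin m → Euc k)
    (p q : Fin m → ℕ) : IsBiPoly (harmTwist S n B p q) := by
  obtain ⟨ι, _, P, Q, h⟩ := isBiPoly_twist S B p q
  refine ⟨ι, inferInstance, fun i => harmProj n fun Y => evalAt Y (P i), Q, fun X u => ?_⟩
  rw [harmTwist]
  simp only [h, mul_comm (evalAt _ (P _)), evalAt_harmProj_sum hk]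
  exact Finset.sum_congr rfl fun i _ => mul_comm _ _

/-- Finite sums of products of polynomials in `X` and harmonic polynomials of degree `s`. -/
def IsHarmonicSymbol (s : ℕ) (P : Euc k → Euc l → ℂ) : Prop :=
  ∃ (ι : Type) (_ : Fintype ι) (A : ι → MvPolynomial (Fin k) ℂ)
    (H : ι → MvPolynomial (Fin l) ℂ), (∀ i, IsHarmonicPoly s (H i)) ∧
    ∀ X u, P X u = ∑ i, evalAt X (A i) * evalAt u (H i)

/-- The projection in `u` is linear, so the polynomials in `X` pass through it as coefficients. -/
theorem isHarmonicSymbol_projSymbol (hl : 0 < l) (s : ℕ) (β : MvPolynomial (Fin l) ℂ)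
    {G : Euc k → Euc l → ℂ} (hG : IsBiPoly G) : IsHarmonicSymbol s (projSymbol s β G) := by
  obtain ⟨ι, _, P, Q, h⟩ := hG
  refine ⟨ι, inferInstance, P, fun i => harmProj s fun v => evalAt v (β * Q i),
    fun i => isHarmonicPoly_harmProj s _, fun X u => ?_⟩
  have h1 : (fun v => evalAt v β * G X v) = fun v => ∑ i, evalAt X (P i) * evalAt v (β * Q i) := by
    ext v
    rw [h, Finset.mul_sum]
    refine Finset.sum_congr rfl fun i _ => ?_
    rw [evalAt_mul]
    ring
  rw [projSymbol, h1, evalAt_harmProj_sum hl]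

theorem isHarmonicSymbol_of_mem (hk : 0 < k) (hl : 0 < l) (S : HTypeStructure k l) {n s : ℕ}
    {B : Fin m → Euc k} {P : Euc k → Euc l → ℂ} (hP : P ∈ phiSymbols S n s B ∪ xiSymbols S n s B) :
    IsHarmonicSymbol s P := by
  rcases hP with ⟨p, q, d, β, _, _, rfl⟩ | ⟨p, q, d, β, _, _, rfl⟩
  · exact isHarmonicSymbol_projSymbol hl s β (isBiPoly_twist S B p q)
  · exact isHarmonicSymbol_projSymbol hl s β (isBiPoly_harmTwist hk S n B p q)

theorem IsHarmonicSymbol.continuous {s : ℕ} {P : Euc k → Euc l → ℂ} (hP : IsHarmonicSymbol s P) :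
    Continuous fun w : Euc k × Euc l => P w.1 w.2 := by
  obtain ⟨ι, _, A, H, -, h⟩ := hP
  simp only [h]
  fun_prop

theorem IsHarmonicSymbol.exists_evalAt {s : ℕ} {P : Euc k → Euc l → ℂ}
    (hP : IsHarmonicSymbol s P) (X : Euc k) :
    ∃ H, IsHarmonicPoly s H ∧ ∀ u, P X u = evalAt u H := by
  obtain ⟨ι, _, A, H, hH, h⟩ := hP
  refine ⟨∑ i, evalAt X (A i) • H i, .sum _ fun i _ => (hH i).smul _, fun u => ?_⟩
  rw [h, evalAt_sum]
  simp only [evalAt_smul]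

theorem IsHarmonicSymbol.apply_smul {s : ℕ} {P : Euc k → Euc l → ℂ} (hP : IsHarmonicSymbol s P)
    (X : Euc k) (r : ℝ) (u : Euc l) : P X (r • u) = (r : ℂ) ^ s * P X u := by
  obtain ⟨H, hH, h⟩ := hP.exists_evalAt X
  rw [h, h, evalAt_smul_of_isHomogeneous hH.1]

theorem IsHarmonicSymbol.integral_exp_mul (hl : 0 < l) {s : ℕ} {P : Euc k → Euc l → ℂ}
    (hP : IsHarmonicSymbol s P) (X : Euc k) (Z : Euc l) :
    ∫ u : Metric.sphere (0 : Euc l) 1, Complex.exp (Complex.I * (inner ℝ Z (u : Euc l) : ℝ)) *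
      P X u ∂sphereMeasure l =
    funkHecke l s * bessel (l - 1 + 2 * s) (‖Z‖ ^ 2) * P X Z := by
  obtain ⟨H, hH, h⟩ := hP.exists_evalAt X
  simp only [h]
  exact integral_sphere_exp_mul hl Z hH

end ZBall
end

noncomputable section
namespace ZBall
open MvPolynomial Filter Topology

/-! ### The Laplacian of a radial function times a harmonic polynomial -/

variable {l : ℕ}

theorem hasFDerivAt_radial_mul {f : ℝ → ℂ} {f' : ℂ} {z : Euc l} (hf : HasDerivAt f f' (‖z‖ ^ 2))
    (Q : MvPolynomial (Fin l) ℂ) :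
    HasFDerivAt (fun y : Euc l => f (‖y‖ ^ 2) * evalAt y Q)
      (f (‖z‖ ^ 2) • fderiv ℝ (fun y => evalAt y Q) z +
        evalAt z Q • (((2 : ℝ) • innerSL ℝ z).smulRight f')) z := by
  have h1 : HasFDerivAt (fun y : Euc l => ‖y‖ ^ 2) ((2 : ℝ) • innerSL ℝ z) z := by
    simpa [two_smul] using (hasStrictFDerivAt_norm_sq z).hasFDerivAt
  have h2 : HasFDerivAt (fun y : Euc l => f (‖y‖ ^ 2)) (((2 : ℝ) • innerSL ℝ z).smulRight f') z := by
    refine (hf.hasFDerivAt.comp z h1).congr_fderiv ?_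
    ext v
    simp [mul_assoc]
  exact h2.fun_mul (differentiableAt_evalAt Q z).hasFDerivAt

theorem fderiv_radial_mul_single {f : ℝ → ℂ} {f' : ℂ} {z : Euc l}
    (hf : HasDerivAt f f' (‖z‖ ^ 2)) (Q : MvPolynomial (Fin l) ℂ) (i : Fin l) :
    fderiv ℝ (fun y : Euc l => f (‖y‖ ^ 2) * evalAt y Q) z (EuclideanSpace.single i 1) =
      f (‖z‖ ^ 2) * evalAt z (pderiv i Q) + f' * evalAt z (2 * X i * Q) := by
  rw [(hasFDerivAt_radial_mul hf Q).fderiv]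
  simp only [add_apply, smul_apply, fderiv_evalAt_single, ContinuousLinearMap.smulRight_apply,
    innerSL_apply_apply, EuclideanSpace.inner_single_right, evalAt_mul, evalAt_X]
  simp [evalAt]
  ring

/-- Harmonicity removes the term `f ΔH`, and Euler's identity turns `z · ∇H` into `sH`. The formula
is used in both directions: to verify eigenfunctions, and to extract the radial equation from a
given one. -/
theorem laplacian_radial_mul {f f' f'' : ℝ → ℂ} {z : Euc l}
    (hf : ∀ᶠ t in 𝓝 (‖z‖ ^ 2), HasDerivAt f (f' t) t) (hf' : HasDerivAt f' (f'' (‖z‖ ^ 2)) (‖z‖ ^ 2))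
    {s : ℕ} {H : MvPolynomial (Fin l) ℂ} (hH : IsHarmonicPoly s H)
    (hc : ContDiffAt ℝ 2 (fun y : Euc l => f (‖y‖ ^ 2) * evalAt y H) z) :
    Laplacian.laplacian (fun y : Euc l => f (‖y‖ ^ 2) * evalAt y H) z =
      (4 * (‖z‖ : ℂ) ^ 2 * f'' (‖z‖ ^ 2) + (2 * l + 4 * s) * f' (‖z‖ ^ 2)) * evalAt z H := by
  set u := fun y : Euc l => f (‖y‖ ^ 2) * evalAt y H with hu
  rw [isHarmonicPoly_iff] at hH
  have hlap := congrFun (InnerProductSpace.laplacian_eq_iteratedFDeriv_orthonormalBasis u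
    (EuclideanSpace.basisFun (Fin l) ℝ)) z
  rw [hlap]
  have hcont : Continuous fun y : Euc l => ‖y‖ ^ 2 := by fun_prop
  have h1 : ∀ i : Fin l, (fun y => fderiv ℝ u y (EuclideanSpace.single i 1)) =ᶠ[𝓝 z]
      fun y => f (‖y‖ ^ 2) * evalAt y (pderiv i H) + f' (‖y‖ ^ 2) * evalAt y (2 * X i * H) :=
    fun i => (hcont.continuousAt.eventually hf).mono fun y hy => fderiv_radial_mul_single hy H i
  have h2 : DifferentiableAt ℝ (fderiv ℝ u) z :=
    (hc.fderiv_right (m := 1) (by norm_num)).differentiableAt one_ne_zero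
  have hfz := hf.self_of_nhds
  have h3 : ∀ i : Fin l, iteratedFDeriv ℝ 2 u z ![EuclideanSpace.single i 1,
      EuclideanSpace.single i 1] =
      f (‖z‖ ^ 2) * evalAt z (pderiv i (pderiv i H)) +
        f' (‖z‖ ^ 2) * evalAt z (2 * H + 4 * (X i * pderiv i H)) +
        f'' (‖z‖ ^ 2) * evalAt z (4 * X i ^ 2 * H) := fun i => by
    rw [iteratedFDeriv_two_apply]
    have e1 : fderiv ℝ (fun y => fderiv ℝ u y (EuclideanSpace.single i 1)) z
        (EuclideanSpace.single i 1) = fderiv ℝ (fderiv ℝ u) z (EuclideanSpace.single i 1)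
        (EuclideanSpace.single i 1) := by
      rw [fderiv_clm_apply h2 (differentiableAt_const _)]
      simp
    have e2 := (hasFDerivAt_radial_mul hfz (pderiv i H)).differentiableAt
    have e3 := (hasFDerivAt_radial_mul hf' (2 * X i * H)).differentiableAt
    simp only [Matrix.cons_val_zero, Matrix.cons_val_one]
    rw [← e1, (h1 i).fderiv_eq, fderiv_fun_add e2 e3, add_apply, fderiv_radial_mul_single hfz,
      fderiv_radial_mul_single hf']
    have e4 : pderiv i (2 * X i * H) = 2 * H + 2 * (X i * pderiv i H) := by
      rw [pderiv_mul, show (2 : MvPolynomial (Fin l) ℂ) = C 2 from (map_ofNat C 2).symm,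
        pderiv_C_mul, pderiv_X_self]
      ring
    rw [e4]
    simp only [evalAt_add, evalAt_mul, evalAt_pow]
    have e5 : evalAt z (4 : MvPolynomial (Fin l) ℂ) = 2 * evalAt z 2 := by
      simp [evalAt]; norm_num
    have e6 : evalAt z (2 : MvPolynomial (Fin l) ℂ) = 2 := by
      simp [evalAt]
    rw [e5, e6]
    ring
  simp only [EuclideanSpace.basisFun_apply, h3, Finset.sum_add_distrib, ← Finset.mul_sum]
  have e1 : ∑ i, (2 * H + 4 * (X i * pderiv i H)) = C (2 * l + 4 * s : ℂ) * H := by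
    rw [Finset.sum_add_distrib, ← Finset.mul_sum, ← Finset.mul_sum _ _ (4 : MvPolynomial (Fin l) ℂ),
      hH.1.sum_X_mul_pderiv, Finset.sum_const,
      Finset.card_univ, Fintype.card_fin, nsmul_eq_mul, nsmul_eq_mul]
    simp only [map_add, map_mul, map_natCast, map_ofNat]
    ring
  have e2 : ∑ i, (4 * X i ^ 2 * H) = C 4 * sqNorm l * H := by
    rw [← Finset.sum_mul, ← Finset.mul_sum, sqNorm, map_ofNat]
  rw [← evalAt_sum, ← polyLap_apply, hH.2, evalAt_zero, mul_zero, zero_add, ← evalAt_sum,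
    ← evalAt_sum, e1, e2, evalAt_mul, evalAt_mul, evalAt_mul, evalAt_sqNorm, evalAt_C, evalAt_C]
  ring

/-! ### Eigenfunctions -/

theorem hasDerivAt_radial_line (p s : ℕ) (lam r : ℝ) (c : ℂ) :
    HasDerivAt (fun t : ℝ => (t : ℂ) ^ s * (bessel p (lam * t ^ 2) : ℂ) * c)
      ((s * (r : ℂ) ^ (s - 1) * (bessel p (lam * r ^ 2) : ℂ) +
        (r : ℂ) ^ s * ((2 * lam * r * besselDeriv p (lam * r ^ 2) : ℝ) : ℂ)) * c) r := by
  have h1 : HasDerivAt (fun t : ℝ => (t : ℂ) ^ s) (s * (r : ℂ) ^ (s - 1)) r := by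
    simpa using (hasDerivAt_pow s (r : ℂ)).comp_ofReal
  exact (h1.mul (hasDerivAt_bessel_sq p lam r).ofReal_comp).mul_const c

/-- Multiplication by `r` absorbs `r ^ (s - 1)`, so that `s = 0` needs no separate formula. -/
theorem bdry_radial_line (p s : ℕ) (bc : BoundaryCondition) (lam : ℝ) {r : ℝ} (c : ℂ) :
    (r : ℂ) * ((bc.a : ℂ) * ((r : ℂ) ^ s * (bessel p (lam * r ^ 2) : ℂ) * c) +
      bc.b * ((s * (r : ℂ) ^ (s - 1) * (bessel p (lam * r ^ 2) : ℂ) +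
        (r : ℂ) ^ s * ((2 * lam * r * besselDeriv p (lam * r ^ 2) : ℝ) : ℂ)) * c)) =
    (r : ℂ) ^ s * c * (bdryFun p (bc.a * r + bc.b * s) bc.b (lam * r ^ 2) : ℝ) := by
  rw [bdryFun]
  have : (s : ℂ) * (r : ℂ) ^ (s - 1) * r = s * (r : ℂ) ^ s := by
    rcases s with _ | s
    · simp
    · rw [Nat.add_sub_cancel, pow_succ]
      ring
  push_cast
  linear_combination bc.b * (bessel p (lam * r ^ 2) : ℂ) * c * this

theorem holdsOn_bessel_mul (p : ℕ) {s : ℕ} (bc : BoundaryCondition) {lam r : ℝ} (hr : 0 < r)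
    (h0 : bdryFun p (bc.a * r + bc.b * s) bc.b (lam * r ^ 2) = 0) {H : MvPolynomial (Fin l) ℂ}
    (hH : H.IsHomogeneous s) :
    bc.HoldsOn r fun z => (bessel p (lam * ‖z‖ ^ 2) : ℂ) * evalAt z H := by
  intro v hv
  have h1 : (fun t : ℝ => (bessel p (lam * ‖t • v‖ ^ 2) : ℂ) * evalAt (t • v) H) =
      fun t : ℝ => (t : ℂ) ^ s * (bessel p (lam * t ^ 2) : ℂ) * evalAt v H := by
    ext t
    rw [evalAt_smul_of_isHomogeneous hH, norm_smul, hv, mul_one, Real.norm_eq_abs, sq_abs]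
    ring
  refine ⟨_, h1 ▸ hasDerivAt_radial_line p s lam r (evalAt v H), ?_⟩
  have h2 := bdry_radial_line p s bc lam (r := r) (evalAt v H)
  rw [h0, Complex.ofReal_zero, mul_zero, ← congrFun h1 r] at h2
  exact (mul_eq_zero.1 h2).resolve_left (Complex.ofReal_ne_zero.2 hr.ne')

/-- In dimension at least two take `(x₀ + i x₁)ˢ`, harmonic because the gradient of the linear form
is isotropic. On the line only degrees `0` and `1` carry nonzero harmonics, which is where the
restriction on `s` originates. -/
theorem exists_isHarmonicPoly (hl : 0 < l) {s : ℕ} (hs : 2 ≤ l ∨ s ≤ 1) :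
    ∃ (H : MvPolynomial (Fin l) ℂ) (e : Euc l), IsHarmonicPoly s H ∧ ‖e‖ = 1 ∧ evalAt e H ≠ 0 := by
  by_cases h2 : 2 ≤ l
  · obtain ⟨i0, i1, hne⟩ : ∃ i0 i1 : Fin l, i0 ≠ i1 :=
      ⟨⟨0, hl⟩, ⟨1, h2⟩, Fin.ext_iff.not.2 zero_ne_one⟩
    let L : MvPolynomial (Fin l) ℂ := X i0 + C Complex.I * X i1
    have hL : L.IsHomogeneous 1 := (isHomogeneous_X _ _).add (by
      simpa using (isHomogeneous_C (Fin l) Complex.I).mul (isHomogeneous_X ℂ i1))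
    have hd : ∀ i, pderiv i L = C ((if i = i0 then 1 else 0) + if i = i1 then Complex.I else 0) := by
      intro i
      simp only [L, map_add, pderiv_C_mul]
      by_cases h0 : i = i0
      · subst h0
        simp [hne, pderiv_X_of_ne hne.symm]
      · by_cases h1 : i = i1
        · subst h1
          simp [h0, pderiv_X_of_ne hne]
        · simp [h0, h1, pderiv_X_of_ne (Ne.symm h0), pderiv_X_of_ne (Ne.symm h1)]
    have hd2 : ∀ (i : Fin l) (n : ℕ), pderiv i (L ^ n) = n * L ^ (n - 1) * pderiv i L := fun i n => by
      rw [Derivation.leibniz_pow, nsmul_eq_mul, smul_eq_mul, mul_assoc]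
    have hsum : ∑ i, pderiv i L * pderiv i L = 0 := by
      simp only [hd, ← C_mul, ← map_sum]
      rw [← Finset.sum_subset (Finset.subset_univ {i0, i1})]
      · rw [Finset.sum_pair hne]
        simp [hne, hne.symm]
      · intro i _ hi
        simp only [Finset.mem_insert, Finset.mem_singleton, not_or] at hi
        simp [hi.1, hi.2]
    refine ⟨L ^ s, EuclideanSpace.single i0 1,
      isHarmonicPoly_iff.2 ⟨by simpa using hL.pow s, ?_⟩, by simp, ?_⟩
    · rw [polyLap_apply]
      have : ∀ i, pderiv i (pderiv i (L ^ s)) =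
          s * ((s - 1 : ℕ) * L ^ (s - 1 - 1)) * (pderiv i L * pderiv i L) := fun i => by
        rw [hd2, hd i, pderiv_mul, pderiv_C, mul_zero, add_zero, pderiv_mul, hd2, ← map_natCast C,
          pderiv_C, hd i]
        ring
      simp only [this]
      rw [← Finset.mul_sum, hsum, mul_zero]
    · rw [evalAt_pow]
      refine pow_ne_zero _ ?_
      simp [L, evalAt_add, evalAt_mul, evalAt_C, evalAt_X, hne.symm]
  · let e : Euc l := EuclideanSpace.single ⟨0, hl⟩ 1
    have he : ‖e‖ = 1 := by simp [e]
    rcases Nat.le_one_iff_eq_zero_or_eq_one.1 (hs.resolve_left h2) with rfl | rfl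
    · exact ⟨C 1, e, isHarmonicPoly_C 1, he, by simp [evalAt]⟩
    · refine ⟨X ⟨0, hl⟩, e, isHarmonicPoly_iff.2 ⟨isHomogeneous_X _ _, ?_⟩, he, ?_⟩
      · exact polyLap_eq_zero_of_lt (isHomogeneous_X _ _) (by norm_num)
      · simp [evalAt_X, e]

end ZBall
end

noncomputable section
namespace ZBall
open MvPolynomial Filter Topology

/-! ### The spectrum of a ball -/

variable {l : ℕ}

theorem evalAt_eq_norm_pow_mul {s : ℕ} {H : MvPolynomial (Fin l) ℂ} (hH : H.IsHomogeneous s)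
    (z : Euc l) : evalAt z H = (‖z‖ : ℂ) ^ s * evalAt (‖z‖⁻¹ • z) H := by
  rw [← evalAt_smul_of_isHomogeneous hH, smul_smul]
  rcases eq_or_ne z 0 with rfl | hz
  · simp
  · rw [mul_inv_cancel₀ (norm_ne_zero_iff.2 hz), one_smul]

theorem _root_.ContDiffAt.deriv_one {f : ℝ → ℂ} {x : ℝ} (h : ContDiffAt ℝ 2 f x) :
    ContDiffAt ℝ 1 (deriv f) x :=
  (h.fderiv_right (m := 1) (by norm_num)).clm_apply contDiffAt_const

theorem isEigenvalue_of_bdryFun_eq_zero (hl : 0 < l) {s : ℕ} (hs : 2 ≤ l ∨ s ≤ 1)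
    (bc : BoundaryCondition) {r lam : ℝ} (hr : 0 < r)
    (h0 : bdryFun (l - 1 + 2 * s) (bc.a * r + bc.b * s) bc.b (lam * r ^ 2) = 0) :
    IsEigenvalue l s bc r lam := by
  obtain ⟨H, e, hH, he, hHe⟩ := exists_isHarmonicPoly hl hs
  set p := l - 1 + 2 * s with hp
  have hE : ContDiff ℝ 2 (bessel p) := by exact_mod_cast contDiff_bessel p (n := 2)
  have hcd : ContDiff ℝ 2 fun z : Euc l => (bessel p (lam * ‖z‖ ^ 2) : ℂ) * evalAt z H :=
    (Complex.ofRealCLM.contDiff.comp (hE.comp (contDiff_const.mul (contDiff_norm_sq ℝ)))).mul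
      (contDiff_evalAt H)
  refine ⟨fun z => (bessel p (lam * ‖z‖ ^ 2) : ℂ) * evalAt z H,
    fun x => (bessel p (lam * x ^ 2) : ℂ) * (x : ℂ) ^ s, H, hH, fun z _ => ?_,
    fun z _ => hcd.contDiffAt, ?_, fun z _ => ?_, holdsOn_bessel_mul p bc hr h0 hH.1⟩
  · simp only
    rw [evalAt_eq_norm_pow_mul hH.1 z]
    ring
  -- Nonvanishing is seen near the origin, where `E` is close to `1`, along the direction `e`.
  · have h1 : ∀ᶠ x in 𝓝 (0 : ℝ), bessel p (lam * x ^ 2) ≠ 0 := by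
      have hc : Continuous fun x => bessel p (lam * x ^ 2) := by fun_prop
      exact hc.continuousAt.eventually_ne (by simp [bessel_zero])
    have h2 : ∀ᶠ x in 𝓝[>] (0 : ℝ), bessel p (lam * x ^ 2) ≠ 0 ∧ x ∈ Ioo 0 r :=
      (h1.filter_mono nhdsWithin_le_nhds).and (Ioo_mem_nhdsGT hr)
    obtain ⟨x, hx, hx0, hxr⟩ := h2.exists
    have hn : ‖x • e‖ = x := by rw [norm_smul, he, mul_one, Real.norm_of_nonneg hx0.le]
    refine ⟨x • e, by simpa [hn] using hxr, ?_⟩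
    simp only
    rw [hn, evalAt_smul_of_isHomogeneous hH.1]
    exact mul_ne_zero (Complex.ofReal_ne_zero.2 hx)
      (mul_ne_zero (pow_ne_zero _ (Complex.ofReal_ne_zero.2 hx0.ne')) hHe)
  · have hf : ∀ t : ℝ, HasDerivAt (fun t : ℝ => (bessel p (lam * t) : ℂ))
        (lam * besselDeriv p (lam * t) : ℂ) t := fun t => by
      have := ((hasDerivAt_bessel' p (lam * t)).comp t
        ((hasDerivAt_id t).const_mul lam)).ofReal_comp
      refine this.congr_deriv ?_
      push_cast
      ring
    have hf' : ∀ t : ℝ, HasDerivAt (fun t : ℝ => (lam * besselDeriv p (lam * t) : ℂ))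
        (lam ^ 2 * besselDeriv₂ p (lam * t) : ℂ) t := fun t => by
      have := (((hasDerivAt_besselDeriv p (lam * t)).comp t
        ((hasDerivAt_id t).const_mul lam)).ofReal_comp).const_mul (lam : ℂ)
      refine this.congr_deriv ?_
      push_cast
      ring
    have hlap := laplacian_radial_mul (z := z) (f := fun t => (bessel p (lam * t) : ℂ))
      (f' := fun t => (lam * besselDeriv p (lam * t) : ℂ))
      (f'' := fun t => (lam ^ 2 * besselDeriv₂ p (lam * t) : ℂ))
      (Eventually.of_forall hf) (hf' _) hH hcd.contDiffAt
    rw [hlap]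
    have ode := congrArg (Complex.ofReal) (bessel_ode p (lam * ‖z‖ ^ 2))
    have hpc : (p : ℂ) + 1 = l + 2 * s := by
      rw [hp]
      exact_mod_cast (by omega : l - 1 + 2 * s + 1 = l + 2 * s)
    push_cast at ode
    rw [hpc] at ode
    linear_combination (-(lam : ℂ) * evalAt z H) * ode

/-- Along a ray on which `H` does not vanish, the eigenfunction divided by `xˢH(e)` solves the
radial equation. Its `C²` regularity at the centre supplies the two limits of `radial_unique`, so it
is a multiple of `E(λx²)`; the boundary condition is then read at `r`. -/
theorem bdryFun_eq_zero_of_isEigenvalue (hl : 0 < l) {s : ℕ}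
    {bc : BoundaryCondition} {r lam : ℝ} (hr : 0 < r) (h : IsEigenvalue l s bc r lam) :
    bdryFun (l - 1 + 2 * s) (bc.a * r + bc.b * s) bc.b (lam * r ^ 2) = 0 := by
  obtain ⟨u, y, H, hH, huy, hcd, ⟨z₀, hz₀, hne⟩, hlap, hbc⟩ := h
  set p := l - 1 + 2 * s with hp
  have hnt := nontrivial_euc hl
  -- a direction in which the eigenfunction does not vanish
  obtain ⟨z₁, hz₁, hz₁0, hne₁⟩ : ∃ z ∈ Metric.ball (0 : Euc l) r, z ≠ 0 ∧ u z ≠ 0 := by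
    have h1 : ∀ᶠ z in 𝓝 z₀, u z ≠ 0 :=
      (hcd z₀ (Metric.ball_subset_closedBall hz₀)).continuousAt.eventually_ne hne
    have h2 : ∀ᶠ z in 𝓝[≠] z₀, u z ≠ 0 ∧ z ∈ Metric.ball (0 : Euc l) r ∧ z ≠ z₀ :=
      ((h1.and (Metric.isOpen_ball.mem_nhds hz₀)).filter_mono nhdsWithin_le_nhds).and
        self_mem_nhdsWithin |>.mono fun z hz => ⟨hz.1.1, hz.1.2, hz.2⟩
    rcases eq_or_ne z₀ 0 with rfl | h0
    · obtain ⟨z, hz⟩ := h2.exists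
      exact ⟨z, hz.2.1, hz.2.2, hz.1⟩
    · exact ⟨z₀, hz₀, h0, hne⟩
  set x₁ := ‖z₁‖ with hx₁
  have hx₁0 : 0 < x₁ := norm_pos_iff.2 hz₁0
  have hx₁r : x₁ < r := by simpa using hz₁
  set e := x₁⁻¹ • z₁ with he_def
  have he : ‖e‖ = 1 := by
    rw [he_def, norm_smul, norm_inv, Real.norm_of_nonneg hx₁0.le, ← hx₁, inv_mul_cancel₀ hx₁0.ne']
  have hez : x₁ • e = z₁ := by rw [he_def, smul_smul, mul_inv_cancel₀ hx₁0.ne', one_smul]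
  have hHe : evalAt e H ≠ 0 := by
    rw [huy z₁ (Metric.ball_subset_closedBall hz₁)] at hne₁
    exact right_ne_zero_of_mul hne₁
  have hnorm : ∀ {x : ℝ}, 0 ≤ x → ‖x • e‖ = x := fun hx => by
    rw [norm_smul, he, mul_one, Real.norm_of_nonneg hx]
  clear_value e
  -- the profile
  set U : ℝ → ℂ := fun x => u (x • e) with hU
  have hUcd : ∀ x, |x| ≤ r → ContDiffAt ℝ 2 U x := fun x hx => by
    have h1 : ContDiffAt ℝ 2 u (x • e) := hcd _ (by
      rw [mem_closedBall_zero_iff, norm_smul, he, mul_one]; exact hx)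
    exact h1.comp x (contDiffAt_id.smul contDiffAt_const)
  have hyU : ∀ x, 0 < x → x ≤ r → y x = U x / evalAt e H := fun x hx hxr => by
    have := huy (x • e) (by rw [mem_closedBall_zero_iff, hnorm hx.le]; exact hxr)
    rw [hnorm hx.le, smul_smul, inv_mul_cancel₀ hx.ne', one_smul] at this
    rw [eq_div_iff hHe, ← this]
  set v : ℝ → ℂ := fun x => U x / ((x : ℂ) ^ s * evalAt e H) with hv
  -- The profile as a function of `|z|²`, the form in which `laplacian_radial_mul` is stated.
  set f : ℝ → ℂ := fun t => v √t with hf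
  have huf : ∀ z ∈ Metric.ball (0 : Euc l) r, z ≠ 0 → u z = f (‖z‖ ^ 2) * evalAt z H := by
    intro z hz hz0
    have hzn : 0 < ‖z‖ := norm_pos_iff.2 hz0
    have hzr : ‖z‖ < r := by simpa using hz
    rw [huy z (Metric.ball_subset_closedBall hz), hyU _ hzn hzr.le, evalAt_eq_norm_pow_mul hH.1 z,
      hf]
    simp only
    rw [Real.sqrt_sq hzn.le, hv]
    have : (‖z‖ : ℂ) ^ s ≠ 0 := pow_ne_zero _ (Complex.ofReal_ne_zero.2 hzn.ne')
    field_simp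
  have hvcd : ∀ x ∈ Ioo 0 r, ContDiffAt ℝ 2 v x := fun x hx => by
    simp only [hv, div_eq_mul_inv]
    exact (hUcd x (by rw [abs_of_pos hx.1]; exact hx.2.le)).mul
      (((Complex.ofRealCLM.contDiff.contDiffAt.pow s).mul contDiffAt_const).inv
        (mul_ne_zero (pow_ne_zero _ (Complex.ofReal_ne_zero.2 hx.1.ne')) hHe))
  have hfcd : ∀ t ∈ Ioo 0 (r ^ 2), ContDiffAt ℝ 2 f t := fun t ht =>
    (hvcd √t ⟨Real.sqrt_pos.2 ht.1, (Real.sqrt_lt' hr).2 ht.2⟩).comp t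
      (Real.contDiffAt_sqrt ht.1.ne')
  have hf1 : ∀ t ∈ Ioo 0 (r ^ 2), HasDerivAt f (deriv f t) t := fun t ht =>
    ((hfcd t ht).differentiableAt two_ne_zero).hasDerivAt
  have hf2 : ∀ t ∈ Ioo 0 (r ^ 2), HasDerivAt (deriv f) (deriv (deriv f) t) t := fun t ht => by
    exact ((hfcd t ht).deriv_one.differentiableAt one_ne_zero).hasDerivAt
  have hsq : ∀ {x : ℝ}, x ∈ Ioo 0 r → x ^ 2 ∈ Ioo 0 (r ^ 2) := fun hx =>
    ⟨pow_pos hx.1 2, pow_lt_pow_left₀ hx.2 hx.1.le two_ne_zero⟩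
  have hpc : (p : ℂ) + 1 = l + 2 * s := by
    rw [hp]
    exact_mod_cast (by omega : l - 1 + 2 * s + 1 = l + 2 * s)
  have ode : ∀ x ∈ Ioo 0 r, 4 * (x : ℂ) ^ 2 * deriv (deriv f) (x ^ 2) +
      2 * (p + 1) * deriv f (x ^ 2) = -lam * f (x ^ 2) := by
    intro x hx
    have hxb : x • e ∈ Metric.ball (0 : Euc l) r := by
      rw [mem_ball_zero_iff, hnorm hx.1.le]; exact hx.2
    have hx0 : x • e ≠ 0 := norm_pos_iff.1 (by rw [hnorm hx.1.le]; exact hx.1)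
    have heq : u =ᶠ[𝓝 (x • e)] fun z => f (‖z‖ ^ 2) * evalAt z H := by
      filter_upwards [Metric.isOpen_ball.mem_nhds hxb, isOpen_ne.mem_nhds hx0] with z hz hz0
      exact huf z hz hz0
    have h1 := hlap _ hxb
    have h2 := laplacian_radial_mul (z := x • e) (f := f) (f' := deriv f) (f'' := deriv (deriv f))
      (by rw [hnorm hx.1.le]
          filter_upwards [isOpen_Ioo.mem_nhds (hsq hx)] with t ht using hf1 t ht)
      (by rw [hnorm hx.1.le]; exact hf2 _ (hsq hx)) hH
      ((hcd _ (Metric.ball_subset_closedBall hxb)).congr_of_eventuallyEq heq.symm)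
    rw [(InnerProductSpace.laplacian_congr_nhds heq).self_of_nhds, h2, huf _ hxb hx0,
      hnorm hx.1.le] at h1
    have hHx : evalAt (x • e) H ≠ 0 := by
      rw [evalAt_smul_of_isHomogeneous hH.1]
      exact mul_ne_zero (pow_ne_zero _ (Complex.ofReal_ne_zero.2 hx.1.ne')) hHe
    refine mul_right_cancel₀ hHx ?_
    linear_combination -h1 + 2 * deriv f (x ^ 2) * evalAt (x • e) H * hpc
  have hFU : ∀ x, 0 < x → U x = f (x ^ 2) * ((x : ℂ) ^ s * evalAt e H) := fun x hx => by
    have : (x : ℂ) ^ s * evalAt e H ≠ 0 :=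
      mul_ne_zero (pow_ne_zero _ (Complex.ofReal_ne_zero.2 hx.ne')) hHe
    simp only [hf, hv, Real.sqrt_sq hx.le]
    rw [div_mul_cancel₀ _ this]
  have hF : ∀ x ∈ Ioo 0 r, HasDerivAt (fun x : ℝ => f (x ^ 2)) (2 * x * deriv f (x ^ 2)) x :=
    fun x hx => by
    refine (HasDerivAt.scomp (h := fun x : ℝ => x ^ 2) x (hf1 _ (hsq hx)) (hasDerivAt_pow 2 x)).congr_deriv ?_
    rw [Complex.real_smul]
    push_cast
    ring
  have hpow : ∀ (n : ℕ) (x : ℝ), HasDerivAt (fun t : ℝ => (t : ℂ) ^ n) (n * (x : ℂ) ^ (n - 1)) x :=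
    fun n x => by simpa using (hasDerivAt_pow n (x : ℂ)).comp_ofReal
  have hdU : ∀ x ∈ Ioo 0 r, deriv U x = (2 * x * deriv f (x ^ 2) * (x : ℂ) ^ s +
      f (x ^ 2) * (s * (x : ℂ) ^ (s - 1))) * evalAt e H := fun x hx => by
    have h1 := (hF x hx).mul ((hpow s x).mul_const (evalAt e H))
    have h2 : U =ᶠ[𝓝 x] (fun x : ℝ => f (x ^ 2)) * fun t : ℝ => (t : ℂ) ^ s * evalAt e H := by
      filter_upwards [isOpen_Ioo.mem_nhds hx] with t ht using hFU t ht.1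
    rw [h2.deriv_eq, h1.deriv]
    ring
  have hU0 : ContDiffAt ℝ 2 U 0 := hUcd 0 (by simpa using hr.le)
  have hdU0 : ContinuousAt (deriv U) 0 := hU0.deriv_one.continuousAt
  have hUzero : s ≠ 0 → U 0 = 0 := fun hs => by
    have h1 : evalAt (0 : Euc l) H = 0 := by
      have := evalAt_smul_of_isHomogeneous hH.1 0 (0 : Euc l)
      simpa [hs] using this
    have := huy 0 (by simpa using hr.le)
    rw [smul_zero, h1, mul_zero] at this
    simpa [hU] using this
  -- For `s = 0` the profile is even. On the line this fact and `hUzero` are indispensable: there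
  -- the flux at the origin is `U'(0)` for `s = 0` and contains `U(0)` for `s = 1`, with no power of
  -- `x` to suppress them.
  have hdUzero : s = 0 → deriv U 0 = 0 := fun hs => by
    subst hs
    have hconst : ∀ z : Euc l, evalAt z H = evalAt 0 H := fun z => by
      have := evalAt_smul_of_isHomogeneous hH.1 0 z
      simpa using this.symm
    have heven : (fun x => U (-x)) =ᶠ[𝓝 0] U := by
      filter_upwards [Ioo_mem_nhds (neg_lt_zero.2 hr) hr] with x hx
      have hxr : |x| ≤ r := abs_le.2 ⟨hx.1.le, hx.2.le⟩
      simp only [hU]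
      rw [huy (-x • e) (by rw [mem_closedBall_zero_iff, norm_smul, he, mul_one, norm_neg]
                           exact hxr),
        huy (x • e) (by rw [mem_closedBall_zero_iff, norm_smul, he, mul_one]; exact hxr), hconst,
        hconst (_ • x • e), neg_smul, norm_neg]
    have h1 := deriv_comp_neg U 0
    rw [heven.deriv_eq, neg_zero] at h1
    exact CharZero.eq_neg_self_iff.1 h1
  obtain ⟨C, hC⟩ := radial_unique p lam hr (v := fun x => f (x ^ 2))
    (v' := fun x => 2 * x * deriv f (x ^ 2)) hF (fun x hx => by
      have h1 : HasDerivAt (fun x : ℝ => deriv f (x ^ 2)) (2 * x * deriv (deriv f) (x ^ 2)) x := by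
        refine (HasDerivAt.scomp (h := fun x : ℝ => x ^ 2) x (hf2 _ (hsq hx)) (hasDerivAt_pow 2 x)).congr_deriv ?_
        rw [Complex.real_smul]
        push_cast
        ring
      have h2 := ((hpow (p + 1) x).mul h1).const_mul 2
      refine (h2.congr_of_eventuallyEq (Eventually.of_forall fun t => ?_)).congr_deriv ?_
      · simp only [Complex.real_smul, Pi.mul_apply]
        push_cast
        ring
      · rw [Complex.real_smul, Nat.add_sub_cancel]
        push_cast
        linear_combination (x : ℂ) ^ p * ode x hx) (by
      -- The flux `xᵖ v'` of `v = U / (xˢ H(e))`, written with nonnegative powers of `x` only.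
      have h1 : Tendsto (fun x : ℝ => ((x : ℂ) ^ (l - 1 + s) * deriv U x -
          s * ((x : ℂ) ^ (l + s - 2) * U x)) / evalAt e H) (𝓝[>] 0)
          (𝓝 ((((0 : ℝ) : ℂ) ^ (l - 1 + s) * deriv U 0 -
            s * (((0 : ℝ) : ℂ) ^ (l + s - 2) * U 0)) / evalAt e H)) := by
        have hc : ∀ n : ℕ, ContinuousAt (fun x : ℝ => (x : ℂ) ^ n) 0 := fun n => by fun_prop
        exact (((((hc _).mul hdU0).sub (continuousAt_const.mul
          ((hc _).mul hU0.continuousAt))).div_const _).tendsto.mono_left nhdsWithin_le_nhds)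
      have h2 : (((0 : ℝ) : ℂ) ^ (l - 1 + s) * deriv U 0 -
            s * (((0 : ℝ) : ℂ) ^ (l + s - 2) * U 0)) / evalAt e H = 0 := by
        rcases eq_or_ne s 0 with hs | hs
        · rw [hdUzero hs, hs]
          simp
        · rw [hUzero hs, Complex.ofReal_zero, zero_pow (by omega)]
          simp
      rw [h2] at h1
      refine h1.congr' ?_
      filter_upwards [Ioo_mem_nhdsGT hr] with x hx
      rw [hdU x hx, hFU x hx.1, Complex.real_smul, div_eq_iff hHe]
      rcases s with _ | s
      · simp [hp]
        ring
      · obtain ⟨n, rfl⟩ : ∃ n, l = n + 1 := ⟨l - 1, by omega⟩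
        simp only [hp, show n + 1 + (s + 1) - 2 = n + s by omega, Nat.add_sub_cancel]
        push_cast
        ring) (by
      have h1 : Tendsto (fun x : ℝ => (x : ℂ) ^ (l + s) * U x / evalAt e H) (𝓝[>] 0)
          (𝓝 (((0 : ℝ) : ℂ) ^ (l + s) * U 0 / evalAt e H)) := by
        have hc : ∀ n : ℕ, ContinuousAt (fun x : ℝ => (x : ℂ) ^ n) 0 := fun n => by fun_prop
        exact ((((hc _).mul hU0.continuousAt).div_const _).tendsto.mono_left nhdsWithin_le_nhds)
      rw [Complex.ofReal_zero, zero_pow (by omega), zero_mul, zero_div] at h1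
      refine h1.congr' ?_
      filter_upwards [Ioo_mem_nhdsGT hr] with x hx
      rw [hFU x hx.1, Complex.real_smul, div_eq_iff hHe,
        show p + 1 = l + s + s by rw [hp]; omega]
      push_cast
      ring)
  set W : ℝ → ℂ := fun t => (t : ℂ) ^ s * (bessel p (lam * t ^ 2) : ℂ) * (C * evalAt e H) with hW
  have hUW : ∀ x ∈ Ioo 0 r, U x = W x := fun x hx => by
    rw [hFU x hx.1, (hC x hx).1, hW, Complex.real_smul]
    ring
  have hC0 : C * evalAt e H ≠ 0 := by
    have h1 := hUW x₁ ⟨hx₁0, hx₁r⟩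
    simp only [hU, hez] at h1
    rw [h1, hW] at hne₁
    exact right_ne_zero_of_mul hne₁
  obtain ⟨u', hu', hb⟩ := hbc e he
  have hW' := hasDerivAt_radial_line p s lam r (C * evalAt e H)
  have hmem : Ioo 0 r ∈ 𝓝[<] r := Ioo_mem_nhdsLT hr
  have hev : U =ᶠ[𝓝[<] r] W := by filter_upwards [hmem] with x hx using hUW x hx
  have hUr : U r = W r := by
    refine tendsto_nhds_unique (hu'.continuousAt.tendsto.mono_left nhdsWithin_le_nhds)
      (((hW'.continuousAt.tendsto).mono_left nhdsWithin_le_nhds).congr' hev.symm)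
  -- Outside the ball nothing is known about the profile, so the radial derivative at `r` is
  -- identified as a left derivative.
  have hder : u' = _ := (uniqueDiffWithinAt_Iio r).eq_deriv _ hu'.hasDerivWithinAt
    (hW'.hasDerivWithinAt.congr_of_eventuallyEq hev hUr)
  have hfin := bdry_radial_line p s bc lam (r := r) (C * evalAt e H)
  rw [← hder] at hfin
  change (bc.a : ℂ) * U r + _ = 0 at hb
  rw [hUr] at hb
  rw [hb, mul_zero] at hfin
  have h3 : (r : ℂ) ^ s * (C * evalAt e H) ≠ 0 :=
    mul_ne_zero (pow_ne_zero _ (Complex.ofReal_ne_zero.2 hr.ne')) hC0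
  exact Complex.ofReal_eq_zero.1 ((mul_eq_zero.1 hfin.symm).resolve_left h3)

theorem isEigenvalue_iff (hl : 0 < l) {s : ℕ} (hs : 2 ≤ l ∨ s ≤ 1) (bc : BoundaryCondition)
    {r lam : ℝ} (hr : 0 < r) : IsEigenvalue l s bc r lam ↔
      bdryFun (l - 1 + 2 * s) (bc.a * r + bc.b * s) bc.b (lam * r ^ 2) = 0 :=
  ⟨bdryFun_eq_zero_of_isEigenvalue hl hr, isEigenvalue_of_bdryFun_eq_zero hl hs bc hr⟩

/-- Exactly `j` members of a strictly increasing enumeration lie below its `j`-th one, so counting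
recovers the index. In particular the infimum defining `eigenvalue` is taken over a singleton. -/
theorem isNthEigenvalue_iff (hl : 0 < l) {s : ℕ} (hs : 2 ≤ l ∨ s ≤ 1) (bc : BoundaryCondition)
    {r : ℝ} (hr : 0 < r) {e : ℕ → ℝ} (he : StrictMono e)
    (hiff : ∀ lam, bdryFun (l - 1 + 2 * s) (bc.a * r + bc.b * s) bc.b (lam * r ^ 2) = 0 ↔
      ∃ i, e i = lam) (i : ℕ) (lam : ℝ) : IsNthEigenvalue l s bc i r lam ↔ lam = e i := by
  have hset : ∀ j, {μ | IsEigenvalue l s bc r μ ∧ μ < e j} = e '' Iio j := fun j => by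
    ext μ
    simp only [mem_ofPred_eq, isEigenvalue_iff hl hs bc hr, hiff, mem_image, mem_Iio]
    constructor
    · rintro ⟨⟨a, rfl⟩, h⟩
      exact ⟨a, he.lt_iff_lt.1 h, rfl⟩
    · rintro ⟨a, h, rfl⟩
      exact ⟨⟨a, rfl⟩, he.lt_iff_lt.2 h⟩
  have hcard : ∀ j, {μ | IsEigenvalue l s bc r μ ∧ μ < e j}.encard = j := fun j => by
    rw [hset, he.injective.encard_image, ← Finset.coe_Iio, encard_coe_eq_coe_finsetCard,
      Nat.card_Iio]
  rw [IsNthEigenvalue, isEigenvalue_iff hl hs bc hr, hiff]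
  constructor
  · rintro ⟨⟨j, rfl⟩, h⟩
    rw [hcard, Nat.cast_inj] at h
    rw [h]
  · rintro rfl
    exact ⟨⟨i, rfl⟩, hcard i⟩

theorem eigenvalue_eq (hl : 0 < l) {s : ℕ} (hs : 2 ≤ l ∨ s ≤ 1) (bc : BoundaryCondition)
    {r : ℝ} (hr : 0 < r) {e : ℕ → ℝ} (he : StrictMono e)
    (hiff : ∀ lam, bdryFun (l - 1 + 2 * s) (bc.a * r + bc.b * s) bc.b (lam * r ^ 2) = 0 ↔
      ∃ i, e i = lam) (i : ℕ) : eigenvalue l s bc i r = e i := by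
  rw [eigenvalue]
  simp only [isNthEigenvalue_iff hl hs bc hr he hiff]
  simp

theorem bdryFun_eq_zero_iff_eigenvalue (hl : 0 < l) {s : ℕ} (hs : 2 ≤ l ∨ s ≤ 1)
    (bc : BoundaryCondition) {r : ℝ} (hr : 0 < r) (lam : ℝ) :
    bdryFun (l - 1 + 2 * s) (bc.a * r + bc.b * s) bc.b (lam * r ^ 2) = 0 ↔
      ∃ i, eigenvalue l s bc i r = lam := by
  obtain ⟨e, he, -⟩ := exists_eigenvalue_branches (l - 1 + 2 * s) s bc
  simp only [eigenvalue_eq hl hs bc hr (he r hr).1 (he r hr).2]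
  exact (he r hr).2 lam

theorem isNthEigenvalue_eigenvalue (hl : 0 < l) {s : ℕ} (hs : 2 ≤ l ∨ s ≤ 1)
    (bc : BoundaryCondition) {r : ℝ} (hr : 0 < r) (i : ℕ) :
    IsNthEigenvalue l s bc i r (eigenvalue l s bc i r) := by
  obtain ⟨e, he, -⟩ := exists_eigenvalue_branches (l - 1 + 2 * s) s bc
  rw [isNthEigenvalue_iff hl hs bc hr (he r hr).1 (he r hr).2,
    eigenvalue_eq hl hs bc hr (he r hr).1 (he r hr).2]

theorem contDiffOn_eigenvalue (hl : 0 < l) {s : ℕ} (hs : 2 ≤ l ∨ s ≤ 1)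
    (bc : BoundaryCondition) (i : ℕ) : ContDiffOn ℝ ∞ (eigenvalue l s bc i) (Ioi 0) := by
  obtain ⟨e, he, hsm⟩ := exists_eigenvalue_branches (l - 1 + 2 * s) s bc
  exact (hsm i).congr fun r hr => eigenvalue_eq hl hs bc hr (he r hr).1 (he r hr).2 i

theorem BoundaryCondition.coeff_pos (bc : BoundaryCondition) {r : ℝ} (hr : 0 < r) (s : ℕ) :
    0 ≤ bc.a * r + bc.b * s ∧ 0 < bc.a * r + bc.b * s + bc.b ∧
      (s ≠ 0 → 0 < bc.a * r + bc.b * s) := by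
  have ha := bc.a_nonneg
  have hb := bc.b_nonneg
  have hs : (0 : ℝ) ≤ s := Nat.cast_nonneg' s
  refine ⟨by positivity, ?_, fun h0 => ?_⟩
  · rcases hb.eq_or_lt with h | h
    · have : 0 < bc.a := by linarith [bc.pos]
      rw [← h]
      positivity
    · positivity
  · have hs' : (0 : ℝ) < s := Nat.cast_pos.2 (Nat.pos_of_ne_zero h0)
    rcases hb.eq_or_lt with h | h
    · have : 0 < bc.a := by linarith [bc.pos]
      rw [← h]
      positivity
    · positivity

theorem eigenvalue_nonneg (hl : 0 < l) {s : ℕ} (hs : 2 ≤ l ∨ s ≤ 1)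
    (bc : BoundaryCondition) {r : ℝ} (hr : 0 < r) (i : ℕ) :
    0 ≤ eigenvalue l s bc i r := by
  have h := (bdryFun_eq_zero_iff_eigenvalue hl hs bc hr _).2 ⟨i, rfl⟩
  have h1 := nonneg_of_bdryFun_eq_zero
    (add_nonneg (mul_nonneg bc.a_nonneg hr.le) (mul_nonneg bc.b_nonneg (Nat.cast_nonneg' s)))
    bc.b_nonneg (bc.coeff_pos hr s).2.1 h
  exact nonneg_of_mul_nonneg_left h1 (pow_pos hr 2)

/-- For `s ≠ 0` the boundary function at `0` is `ar + bs > 0`. This keeps the factor `√λˢ` of the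
twisted functions from vanishing. -/
theorem eigenvalue_pos (hl : 0 < l) {s : ℕ} (hs : 2 ≤ l ∨ s ≤ 1)
    (bc : BoundaryCondition) {r : ℝ} (hr : 0 < r) (i : ℕ) (hs0 : s ≠ 0) :
    0 < eigenvalue l s bc i r := by
  have h1 := bc.coeff_pos hr s
  refine (eigenvalue_nonneg hl hs bc hr i).lt_of_ne fun h => ?_
  have h2 := (bdryFun_eq_zero_iff_eigenvalue hl hs bc hr _).2 ⟨i, rfl⟩
  rw [← h, zero_mul, bdryFun_zero] at h2
  exact (h1.2.2 hs0).ne' h2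

end ZBall
end

noncomputable section
namespace ZBall
open MvPolynomial Filter Topology

/-! ### The twisted functions -/

variable {k l : ℕ}

theorem inner_smul_eq (Z : Euc l) (a : ℝ) (u : Euc l) : inner ℝ Z (a • u) = inner ℝ (a • Z) u := by
  rw [real_inner_smul_left, real_inner_smul_right]

theorem IsHarmonicSymbol.integral_exp_smul (hl : 0 < l) {s : ℕ} {P : Euc k → Euc l → ℂ}
    (hP : IsHarmonicSymbol s P) (X : Euc k) (Z : Euc l) (a : ℝ) :
    ∫ u : Metric.sphere (0 : Euc l) 1,
      Complex.exp (Complex.I * (inner ℝ Z (a • (u : Euc l)) : ℝ)) * P X u ∂sphereMeasure l =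
    funkHecke l s * bessel (l - 1 + 2 * s) (a ^ 2 * ‖Z‖ ^ 2) * ((a : ℂ) ^ s * P X Z) := by
  simp only [inner_smul_eq]
  rw [hP.integral_exp_mul hl X, hP.apply_smul, norm_smul, mul_pow, Real.norm_eq_abs, sq_abs]

/-- The constant in front of the twisted functions. -/
def twistConst (l s : ℕ) : ℂ := ((sphereMeasure l).real univ : ℂ)⁻¹ * funkHecke l s

theorem twistConst_ne_zero (hl : 0 < l) (s : ℕ) : twistConst l s ≠ 0 :=
  mul_ne_zero (inv_ne_zero (Complex.ofReal_ne_zero.2 (sphereMeasure_real_univ_ne_zero hl)))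
    (funkHecke_ne_zero s)

/-- Funk–Hecke separates the symbol, now evaluated at `Z` itself, from a factor depending on `|X|`
and `|Z|` only. -/
theorem sphereTransform_eq (hl : 0 < l) {s : ℕ} {P : Euc k → Euc l → ℂ}
    (hP : IsHarmonicSymbol s P) (lam : ℝ → ℝ) (φ : ℝ → ℂ) (w : Euc k × Euc l) :
    sphereTransform lam φ P w = twistConst l s * φ (‖w.1‖ ^ 2) *
      (√(lam (‖w.1‖ ^ 2)) : ℂ) ^ s *
      bessel (l - 1 + 2 * s) (√(lam (‖w.1‖ ^ 2)) ^ 2 * ‖w.2‖ ^ 2) * P w.1 w.2 := by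
  have h := hP.integral_exp_smul hl w.1 w.2 √(lam (‖w.1‖ ^ 2))
  rw [sphereTransform, average_eq]
  have h1 : ∀ u : Metric.sphere (0 : Euc l) 1,
      Complex.exp (Complex.I * (inner ℝ w.2 (√(lam (‖w.1‖ ^ 2)) • (u : Euc l)) : ℝ)) *
        φ (‖w.1‖ ^ 2) * P w.1 u = φ (‖w.1‖ ^ 2) *
      (Complex.exp (Complex.I * (inner ℝ w.2 (√(lam (‖w.1‖ ^ 2)) • (u : Euc l)) : ℝ)) * P w.1 u) :=
    fun u => by ring
  simp only [h1]
  rw [integral_const_mul, h, Complex.real_smul, twistConst, Complex.ofReal_inv]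
  ring

theorem enorm_sq_eq (X : Euc k) : ENNReal.ofReal (‖X‖ ^ 2) = ‖X‖ₑ ^ 2 := by
  rw [ENNReal.ofReal_pow (norm_nonneg X), ofReal_norm]

theorem norm_sq_mem_baseSet {RX : ℝ≥0∞} {X : Euc k} (hX : ‖X‖ₑ < RX) : ‖X‖ ^ 2 ∈ baseSet RX := by
  refine ⟨sq_nonneg _, ?_⟩
  rw [enorm_sq_eq]
  exact ENNReal.pow_lt_pow_left two_ne_zero hX

theorem holdsOn_sphereTransform (hl : 0 < l) {s : ℕ} (hs : 2 ≤ l ∨ s ≤ 1)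
    {P : Euc k → Euc l → ℂ} (hP : IsHarmonicSymbol s P) (bc : BoundaryCondition) {R : ℝ → ℝ}
    (i : ℕ) (φ : ℝ → ℂ) {X : Euc k} (hR : 0 < R (‖X‖ ^ 2)) :
    bc.HoldsOn (R (‖X‖ ^ 2)) fun Z : Euc l =>
      sphereTransform (fun t => eigenvalue l s bc i (R t)) φ P (X, Z) := by
  obtain ⟨H, hH, h⟩ := hP.exists_evalAt X
  set lam := eigenvalue l s bc i (R (‖X‖ ^ 2)) with hlam
  have h0 := (bdryFun_eq_zero_iff_eigenvalue hl hs bc hR lam).2 ⟨i, rfl⟩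
  have h1 := holdsOn_bessel_mul _ bc hR h0
    ((hH.smul (twistConst l s * φ (‖X‖ ^ 2) * (√lam : ℂ) ^ s)).1)
  convert h1 using 2 with Z
  rw [sphereTransform_eq hl hP]
  simp only
  rw [← hlam, Real.sq_sqrt (eigenvalue_nonneg hl hs bc hR i), evalAt_smul, h]
  ring

theorem isOpen_domain {RX : ℝ≥0∞} {R : ℝ → ℝ} (hR : ContinuousOn R (baseSet RX)) :
    IsOpen (domain k l RX R) := by
  have hA : IsOpen {w : Euc k × Euc l | ‖w.1‖ₑ < RX} :=
    isOpen_lt (by fun_prop) continuous_const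
  have hc : ContinuousOn (fun w : Euc k × Euc l => R (‖w.1‖ ^ 2) - ‖w.2‖)
      {w : Euc k × Euc l | ‖w.1‖ₑ < RX} := by
    refine ContinuousOn.sub (hR.comp (by fun_prop) fun w hw => norm_sq_mem_baseSet hw) (by fun_prop)
  have := hc.isOpen_inter_preimage hA (isOpen_Ioi (a := (0 : ℝ)))
  convert this using 1
  ext w
  simp [domain]

/-- A frontier point lies over the X-sphere, where `φ` vanishes, or over the open X-ball with `|Z| =
R(|X|²)`, where the Dirichlet condition applies. -/
theorem sphereTransform_eq_zero_of_mem_frontier (hl : 0 < l) {s : ℕ} (hs : 2 ≤ l ∨ s ≤ 1)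
    {P : Euc k → Euc l → ℂ} (hP : IsHarmonicSymbol s P) (bc : BoundaryCondition) {RX : ℝ≥0∞}
    {R : ℝ → ℝ} (hRpos : ∀ t ∈ baseSet RX, 0 < R t) (hR : ContinuousOn R (baseSet RX)) (i : ℕ)
    {φ : ℝ → ℂ} (hb : bc.b = 0) (hφ : ∀ X : Euc k, ‖X‖ₑ = RX → φ (‖X‖ ^ 2) = 0)
    {w : Euc k × Euc l} (hw : w ∈ frontier (domain k l RX R)) :
    sphereTransform (fun t => eigenvalue l s bc i (R t)) φ P w = 0 := by
  have hopen := isOpen_domain (k := k) (l := l) hR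
  rw [hopen.frontier_eq] at hw
  obtain ⟨hcl, hnot⟩ := hw
  have h1 : ‖w.1‖ₑ ≤ RX := by
    have hc : IsClosed {w : Euc k × Euc l | ‖w.1‖ₑ ≤ RX} :=
      isClosed_le (by fun_prop) continuous_const
    exact hc.closure_subset_iff.2 (fun w hw => hw.1.le) hcl
  rcases h1.eq_or_lt with h2 | h2
  · rw [sphereTransform_eq hl hP, hφ _ h2]
    simp
  · have hle : ‖w.2‖ ≤ R (‖w.1‖ ^ 2) := by
      have hA : IsOpen {w : Euc k × Euc l | ‖w.1‖ₑ < RX} :=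
        isOpen_lt (by fun_prop) continuous_const
      have hca : ContinuousAt (fun w : Euc k × Euc l => R (‖w.1‖ ^ 2) - ‖w.2‖) w := by
        refine ContinuousOn.continuousAt (s := {w : Euc k × Euc l | ‖w.1‖ₑ < RX}) ?_
          (hA.mem_nhds h2)
        exact ContinuousOn.sub (hR.comp (by fun_prop) fun w hw => norm_sq_mem_baseSet hw)
          (by fun_prop)
      rw [← sub_nonneg]
      have hf : ∃ᶠ v in 𝓝 w, (0 : ℝ) ≤ R (‖v.1‖ ^ 2) - ‖v.2‖ :=
        (mem_closure_iff_frequently.1 hcl).mono fun v hv => sub_nonneg.2 hv.2.le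
      exact isClosed_Ici.mem_of_frequently_of_tendsto hf hca.tendsto
    have hge : R (‖w.1‖ ^ 2) ≤ ‖w.2‖ := not_lt.1 fun h => hnot ⟨h2, h⟩
    have heq : ‖w.2‖ = R (‖w.1‖ ^ 2) := le_antisymm hle hge
    have hpos : 0 < R (‖w.1‖ ^ 2) := hRpos _ (norm_sq_mem_baseSet h2)
    have hn : ‖w.2‖ ≠ 0 := (heq ▸ hpos).ne'
    obtain ⟨u', -, h3⟩ := holdsOn_sphereTransform hl hs hP bc i φ hpos (‖w.2‖⁻¹ • w.2)
      (by rw [norm_smul, norm_inv, norm_norm, inv_mul_cancel₀ hn])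
    have ha : (bc.a : ℂ) ≠ 0 := Complex.ofReal_ne_zero.2 (by have := bc.pos; rw [hb] at this; linarith)
    rw [hb, Complex.ofReal_zero, zero_mul, add_zero, ← heq, smul_smul, mul_inv_cancel₀ hn,
      one_smul] at h3
    exact (mul_eq_zero.1 h3).resolve_left ha

end ZBall
end

noncomputable section
namespace ZBall
open Filter Topology

/-! ### Completeness over a family of balls -/

theorem bessel_complete_complex (p : ℕ) {r c b : ℝ} (hr : 0 < r) (hc : 0 ≤ c) (hb : 0 ≤ b)
    (hcb : 0 < c + b) {G : ℝ → ℂ} (hG : MemLp G 2 (volume.restrict (Ioo 0 r)))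
    (horth : ∀ lam, bdryFun p c b (lam * r ^ 2) = 0 →
      ∫ x in Ioo 0 r, ((√(x ^ p) * bessel p (lam * x ^ 2) : ℝ) : ℂ) * G x = 0) :
    G =ᵐ[volume.restrict (Ioo 0 r)] 0 := by
  have hint : ∀ lam, Integrable (fun x => ((√(x ^ p) * bessel p (lam * x ^ 2) : ℝ) : ℂ) * G x)
      (volume.restrict (Ioo 0 r)) := fun lam => by
    have hw : Continuous fun x : ℝ => ((√(x ^ p) * bessel p (lam * x ^ 2) : ℝ) : ℂ) := by fun_prop
    obtain ⟨M, hM⟩ := isCompact_Icc.exists_bound_of_continuousOn (s := Icc 0 r) hw.continuousOn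
    have h2 : MemLp (fun x : ℝ => ((√(x ^ p) * bessel p (lam * x ^ 2) : ℝ) : ℂ)) 2
        (volume.restrict (Ioo 0 r)) := by
      refine MemLp.of_bound hw.aestronglyMeasurable M ?_
      filter_upwards [ae_restrict_mem measurableSet_Ioo] with x hx using hM x (Ioo_subset_Icc_self hx)
    exact h2.integrable_mul hG
  have hre := bessel_complete p hr hc hb hcb hG.re fun lam h => by
    have h1 := (Complex.reCLM.integral_comp_comm (hint lam)).trans
      (congrArg Complex.reCLM (horth lam h))
    simpa using h1
  have him := bessel_complete p hr hc hb hcb hG.im fun lam h => by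
    have h1 := (Complex.imCLM.integral_comp_comm (hint lam)).trans
      (congrArg Complex.imCLM (horth lam h))
    simpa using h1
  filter_upwards [hre, him] with x h1 h2
  exact Complex.ext h1 h2

theorem lintegral_radialMeasure (n : ℕ) {f : ℝ → ℝ≥0∞} (hf : Measurable f) :
    ∫⁻ r, f r ∂radialMeasure n = ∫⁻ r in Ioi (0 : ℝ), ENNReal.ofReal (r ^ n) * f r := by
  rw [radialMeasure, lintegral_withDensity_eq_lintegral_mul _ (by fun_prop) hf]
  rfl

theorem radialMeasure_absolutelyContinuous (n : ℕ) :
    radialMeasure n ≪ volume.restrict (Ioi 0) :=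
  withDensity_absolutelyContinuous _ _

/-- Multiplication by `√(xᵖ)` carries the weighted problem to `bessel_complete_complex`, and that
factor is nonzero for `x > 0`. -/
theorem ae_eq_zero_of_fibre (p : ℕ) {r c b : ℝ} (hr : 0 < r) (hc : 0 ≤ c) (hb : 0 ≤ b)
    (hcb : 0 < c + b) {g : ℝ → ℂ} (hg : Measurable g)
    (hfin : ∫⁻ x, (Iio r).indicator (fun x => ‖g x‖ₑ ^ 2) x ∂radialMeasure p < ⊤)
    (horth : ∀ lam, bdryFun p c b (lam * r ^ 2) = 0 →
      ∫ x, (Iio r).indicator (fun x => (bessel p (lam * x ^ 2) : ℂ) * g x) x ∂radialMeasure p = 0) :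
    ∀ᵐ x ∂radialMeasure p, x < r → g x = 0 := by
  have hsq : ∀ {x : ℝ}, 0 < x → (√(x ^ p) : ℂ) * √(x ^ p) = (x : ℂ) ^ p := fun hx => by
    rw [← Complex.ofReal_mul, Real.mul_self_sqrt (by positivity), Complex.ofReal_pow]
  have hG : MemLp (fun x => (√(x ^ p) : ℂ) * g x) 2 (volume.restrict (Ioo 0 r)) := by
    refine ⟨(Measurable.mul (by fun_prop) hg).aestronglyMeasurable, ?_⟩
    rw [eLpNorm_lt_top_iff_lintegral_rpow_enorm_lt_top two_ne_zero ENNReal.ofNat_ne_top]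
    rw [lintegral_radialMeasure p (Measurable.indicator (by fun_prop) measurableSet_Iio)] at hfin
    refine lt_of_le_of_lt (le_of_eq ?_) hfin
    have h1 : ∀ x : ℝ, ENNReal.ofReal (x ^ p) * (Iio r).indicator (fun x => ‖g x‖ₑ ^ 2) x =
        (Iio r).indicator (fun x => ENNReal.ofReal (x ^ p) * ‖g x‖ₑ ^ 2) x := fun x => by
      by_cases hx : x ∈ Iio r <;> simp [hx]
    simp only [h1]
    rw [setLIntegral_indicator measurableSet_Iio, inter_comm, Ioi_inter_Iio]
    refine setLIntegral_congr_fun measurableSet_Ioo fun x hx => ?_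
    have hx0 : 0 < x := hx.1
    simp only [ENNReal.toReal_ofNat, ENNReal.rpow_ofNat, enorm_mul, mul_pow]
    congr 1
    rw [← ofReal_norm, Complex.norm_real, Real.norm_of_nonneg (Real.sqrt_nonneg _),
      ← ENNReal.ofReal_pow (Real.sqrt_nonneg _), Real.sq_sqrt (by positivity)]
  have h := bessel_complete_complex p hr hc hb hcb hG fun lam hlam => by
    rw [← horth lam hlam, integral_radialMeasure]
    have h1 : ∀ x : ℝ, (x : ℂ) ^ p *
        (Iio r).indicator (fun x => (bessel p (lam * x ^ 2) : ℂ) * g x) x =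
        (Iio r).indicator (fun x : ℝ => (x : ℂ) ^ p * ((bessel p (lam * x ^ 2) : ℂ) * g x)) x :=
      fun x => by by_cases hx : x ∈ Iio r <;> simp [hx]
    simp only [h1]
    rw [setIntegral_indicator measurableSet_Iio, Ioi_inter_Iio]
    refine setIntegral_congr_fun measurableSet_Ioo fun x hx => ?_
    rw [← hsq hx.1]
    push_cast
    ring
  refine (radialMeasure_absolutelyContinuous p).ae_le ?_
  change ∀ᵐ x ∂volume.restrict (Ioi 0), x < r → g x = 0
  rw [Filter.EventuallyEq, ae_restrict_iff' measurableSet_Ioo] at h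
  rw [ae_restrict_iff' measurableSet_Ioi]
  filter_upwards [h] with x hx hx0 hxr
  have h0 : (0 : ℝ) < x := hx0
  exact (mul_eq_zero.1 (hx ⟨hx0, hxr⟩)).resolve_left
    (Complex.ofReal_ne_zero.2 (Real.sqrt_pos.2 (by positivity)).ne')

/-- The region `0 < r < R t`, with the measure `rᵖ dr dν(t)`. -/
def fibredMeasure (ν : Measure ℝ) (p : ℕ) (R : ℝ → ℝ) : Measure (ℝ × ℝ) :=
  (ν.prod (radialMeasure p)).restrict {q | q.2 < R q.1}

/-- The test functions in `t` localize: for each `i` the pairing over the fibre vanishes for almost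
every `t`. As there are countably many `i`, one null set serves all of them, and completeness on a
single fibre applies. -/
theorem ae_eq_zero_of_orthogonal {l s : ℕ} (hl : 0 < l) (hs : 2 ≤ l ∨ s ≤ 1)
    (bc : BoundaryCondition) {U T : Set ℝ} (hU : IsOpen U) (hTU : T ⊆ U) {ν : Measure ℝ} [SFinite ν]
    (hν : ∀ᵐ t ∂ν, t ∈ T) {R : ℝ → ℝ} (hR : Measurable R) (hRpos : ∀ t ∈ T, 0 < R t)
    {e : ℕ → ℝ → ℝ} (he : ∀ i, Measurable (e i))
    (heig : ∀ i, ∀ t ∈ T, e i t = eigenvalue l s bc i (R t))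
    {D : ℕ → ℝ → ℂ} (hD : ∀ i, Measurable (D i)) (hD0 : ∀ i, ∀ t ∈ T, D i t ≠ 0)
    {g : ℝ × ℝ → ℂ} (hgm : Measurable g)
    (hg : MemLp g 2 (fibredMeasure ν (l - 1 + 2 * s) R))
    (hc : ∀ i, ∀ ψ : ℝ → ℝ, ContDiff ℝ ∞ ψ → HasCompactSupport ψ → tsupport ψ ⊆ U →
      MemLp (fun q : ℝ × ℝ => (ψ q.1 : ℂ) * D i q.1 *
        (bessel (l - 1 + 2 * s) (e i q.1 * q.2 ^ 2) : ℂ)) 2 (fibredMeasure ν (l - 1 + 2 * s) R))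
    (horth : ∀ i, ∀ ψ : ℝ → ℝ, ContDiff ℝ ∞ ψ → HasCompactSupport ψ → tsupport ψ ⊆ U →
      ∫ q, ((ψ q.1 : ℂ) * D i q.1 * (bessel (l - 1 + 2 * s) (e i q.1 * q.2 ^ 2) : ℂ)) * g q
        ∂fibredMeasure ν (l - 1 + 2 * s) R = 0) :
    g =ᵐ[fibredMeasure ν (l - 1 + 2 * s) R] 0 := by
  set p := l - 1 + 2 * s with hp
  have hS : MeasurableSet {q : ℝ × ℝ | q.2 < R q.1} :=
    measurableSet_lt measurable_snd (hR.comp measurable_fst)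
  set b : ℕ → ℝ → ℂ := fun i t => ∫ x,
    (Iio (R t)).indicator (fun x => (bessel p (e i t * x ^ 2) : ℂ) * g (t, x)) x ∂radialMeasure p
    with hb
  have hind : ∀ (f : ℝ × ℝ → ℂ) (t x : ℝ), {q : ℝ × ℝ | q.2 < R q.1}.indicator f (t, x) =
      (Iio (R t)).indicator (fun x => f (t, x)) x := fun f t x => by
    by_cases hx : x < R t <;> simp [hx]
  have hbm : ∀ i, StronglyMeasurable (b i) := fun i => by
    have h1 : Measurable ({q : ℝ × ℝ | q.2 < R q.1}.indicator
        fun q : ℝ × ℝ => (bessel p (e i q.1 * q.2 ^ 2) : ℂ) * g q) := by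
      refine Measurable.indicator (Measurable.mul ?_ hgm) hS
      have := he i
      have hE : Measurable (bessel p) := (by fun_prop : Continuous (bessel p)).measurable
      exact Complex.measurable_ofReal.comp (hE.comp (by fun_prop))
    have h2 := h1.stronglyMeasurable.integral_prod_right' (ν := radialMeasure p)
    simpa only [hind] using h2
  have hpair : ∀ i, ∀ ψ : ℝ → ℝ, ContDiff ℝ ∞ ψ → HasCompactSupport ψ → tsupport ψ ⊆ U →
      Integrable (fun t => ψ t • (D i t * b i t)) ν ∧ ∫ t, ψ t • (D i t * b i t) ∂ν = 0 := by
    intro i ψ h1 h2 h3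
    have hint : Integrable (fun q : ℝ × ℝ => ((ψ q.1 : ℂ) * D i q.1 *
        (bessel p (e i q.1 * q.2 ^ 2) : ℂ)) * g q) (fibredMeasure ν p R) :=
      (hc i ψ h1 h2 h3).integrable_mul hg
    have h0 := horth i ψ h1 h2 h3
    rw [fibredMeasure, ← IntegrableOn, ← integrable_indicator_iff hS] at hint
    rw [fibredMeasure, ← integral_indicator hS] at h0
    have hsec : ∀ t, ∫ x, {q : ℝ × ℝ | q.2 < R q.1}.indicator
        (fun q => ((ψ q.1 : ℂ) * D i q.1 * (bessel p (e i q.1 * q.2 ^ 2) : ℂ)) * g q) (t, x)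
        ∂radialMeasure p = ψ t • (D i t * b i t) := by
      intro t
      rw [hb]
      simp only [hind]
      rw [Complex.real_smul, ← mul_assoc, ← integral_const_mul]
      refine integral_congr_ae (Eventually.of_forall fun x => ?_)
      by_cases hx : x < R t <;> simp [hx]
      ring
    have h4 := hint.integral_prod_left
    rw [integral_prod _ hint] at h0
    simp only [hsec] at h4 h0
    exact ⟨h4, h0⟩
  have hb0 : ∀ i, ∀ᵐ t ∂ν, t ∈ T → b i t = 0 := by
    intro i
    have hfm : StronglyMeasurable fun t => D i t * b i t :=
      (hD i).stronglyMeasurable.mul (hbm i)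
    -- The pairing is known to be integrable only after multiplication by a test function; where `ψ
    -- > 1/2`, that bounds the pairing itself.
    have hloc : LocallyIntegrableOn (fun t => D i t * b i t) U ν := by
      intro x hx
      obtain ⟨ψ, h1, h2, h3, -, h5⟩ := exists_contDiff_tsupport_subset (n := ⊤) (hU.mem_nhds hx)
      have hW : {t | 1 / 2 < ψ t} ∈ 𝓝 x :=
        (isOpen_lt continuous_const h3.continuous).mem_nhds (by
          rw [mem_ofPred_eq, h5]; norm_num)
      refine ⟨{t | 1 / 2 < ψ t}, mem_nhdsWithin_of_mem_nhds hW, ?_⟩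
      have hi := ((hpair i ψ h3 h2 h1).1.norm.const_mul 2).integrableOn (s := {t | 1 / 2 < ψ t})
      refine hi.mono' hfm.aestronglyMeasurable ?_
      filter_upwards [ae_restrict_mem (isOpen_lt continuous_const h3.continuous).measurableSet]
        with t ht
      have ht' : 1 / 2 < ψ t := ht
      rw [norm_smul, Real.norm_of_nonneg (by linarith)]
      nlinarith [norm_nonneg (D i t * b i t)]
    have h6 := hU.ae_eq_zero_of_integral_contDiff_smul_eq_zero hloc fun ψ h1 h2 h3 =>
      (hpair i ψ h1 h2 h3).2
    filter_upwards [h6] with t ht htT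
    exact (mul_eq_zero.1 (ht (hTU htT))).resolve_left (hD0 i t htT)
  have hfin : ∀ᵐ t ∂ν, ∫⁻ x, (Iio (R t)).indicator (fun x => ‖g (t, x)‖ₑ ^ 2) x
      ∂radialMeasure p < ⊤ := by
    have h1 := hg.2
    rw [eLpNorm_lt_top_iff_lintegral_rpow_enorm_lt_top two_ne_zero ENNReal.ofNat_ne_top,
      fibredMeasure, ← lintegral_indicator hS] at h1
    have hm : Measurable ({q : ℝ × ℝ | q.2 < R q.1}.indicator
        fun q => ‖g q‖ₑ ^ (2 : ℝ≥0∞).toReal) := Measurable.indicator (by fun_prop) hS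
    rw [lintegral_prod _ hm.aemeasurable] at h1
    filter_upwards [ae_lt_top hm.lintegral_prod_right' h1.ne] with t ht
    refine lt_of_le_of_lt (le_of_eq (lintegral_congr fun x => ?_)) ht
    by_cases hx : x < R t <;> simp [hx]
  rw [Filter.EventuallyEq, fibredMeasure, ae_restrict_iff' hS]
  have hmeas : MeasurableSet {q : ℝ × ℝ | q ∈ {q : ℝ × ℝ | q.2 < R q.1} → g q = 0} := by
    have : MeasurableSet {q : ℝ × ℝ | g q = 0} := hgm (measurableSet_singleton 0)
    exact hS.imp this
  refine (Measure.ae_prod_iff_ae_ae hmeas).2 ?_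
  filter_upwards [hν, ae_all_iff.2 hb0, hfin] with t ht h1 h2
  have hr := hRpos t ht
  have h3 := bc.coeff_pos hr s
  refine ae_eq_zero_of_fibre p hr h3.1 bc.b_nonneg h3.2.1 (hgm.comp (by fun_prop)) h2
    fun lam hlam => ?_
  obtain ⟨i, rfl⟩ := (bdryFun_eq_zero_iff_eigenvalue hl hs bc hr lam).1 hlam
  rw [← heig i t ht]
  exact h1 i ht

end ZBall
end

noncomputable section
namespace ZBall
open Filter Topology

/-! ### Radial coordinates on the domain -/

variable {k l : ℕ}

/-- The measure `m ⊗ dZ` on the set of all `(X, Z)` with `|Z| < R(|X|²)`. -/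
def bundleMeasure (m : Measure (Euc k)) (l : ℕ) (R : ℝ → ℝ) : Measure (Euc k × Euc l) :=
  (m.prod volume).restrict {w | ‖w.2‖ < R (‖w.1‖ ^ 2)}

/-- The map `(X, Z) ↦ (|X|², |Z|)`. -/
def radialMap (w : Euc k × Euc l) : ℝ × ℝ := (‖w.1‖ ^ 2, ‖w.2‖)

theorem measurable_radialMap : Measurable (radialMap (k := k) (l := l)) := by
  unfold radialMap
  fun_prop

/-- The square integral of a symbol over the unit sphere. -/
def symbolDensity (P : Euc k → Euc l → ℂ) (X : Euc k) : ℝ≥0∞ :=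
  ∫⁻ u : Metric.sphere (0 : Euc l) 1, ‖P X u‖ₑ ^ 2 ∂sphereMeasure l

/-- The image of `m`, weighted with the square integrals of a symbol over the unit sphere,
under `X ↦ |X|²`. -/
def symbolMeasure (m : Measure (Euc k)) (P : Euc k → Euc l → ℂ) : Measure ℝ :=
  (m.withDensity (symbolDensity P)).map fun X => ‖X‖ ^ 2

instance (m : Measure (Euc k)) [SFinite m] (P : Euc k → Euc l → ℂ) :
    SFinite (symbolMeasure m P) := by
  unfold symbolMeasure
  infer_instance

theorem measurable_symbolDensity {s : ℕ} {P : Euc k → Euc l → ℂ} (hP : IsHarmonicSymbol s P) :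
    Measurable (symbolDensity P) := by
  have h : Measurable fun q : Euc k × Metric.sphere (0 : Euc l) 1 => ‖P q.1 q.2‖ₑ ^ 2 := by
    have : Measurable fun q : Euc k × Metric.sphere (0 : Euc l) 1 => P q.1 q.2 :=
      hP.continuous.measurable.comp (measurable_fst.prodMk (measurable_subtype_coe.comp
        measurable_snd))
    exact this.enorm.pow_const 2
  exact h.lintegral_prod_right'

theorem measurableSet_bundle {R : ℝ → ℝ} (hR : Measurable R) :
    MeasurableSet {w : Euc k × Euc l | ‖w.2‖ < R (‖w.1‖ ^ 2)} :=
  measurableSet_lt (by fun_prop) (hR.comp (by fun_prop))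

/-- In polar coordinates `|P(X, ru)|² = r²ˢ |P(X, u)|²`. Together with the density `rˡ⁻¹` this gives
exactly the exponent `l - 1 + 2s` of the Bessel equation; the integral over the sphere goes into
`symbolMeasure`. -/
theorem lintegral_radialMap_mul (hl : 0 < l) {s : ℕ} {P : Euc k → Euc l → ℂ}
    (hP : IsHarmonicSymbol s P) (m : Measure (Euc k)) [SFinite m] {R : ℝ → ℝ} (hR : Measurable R)
    {F : ℝ × ℝ → ℝ≥0∞} (hF : Measurable F) :
    ∫⁻ w, F (radialMap w) * ‖P w.1 w.2‖ₑ ^ 2 ∂bundleMeasure m l R =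
      ∫⁻ q, F q ∂fibredMeasure (symbolMeasure m P) (l - 1 + 2 * s) R := by
  have hS : MeasurableSet {q : ℝ × ℝ | q.2 < R q.1} :=
    measurableSet_lt measurable_snd (hR.comp measurable_fst)
  set G : ℝ × ℝ → ℝ≥0∞ := {q : ℝ × ℝ | q.2 < R q.1}.indicator F with hG
  have hGm : Measurable G := hF.indicator hS
  have hPm : Measurable fun w : Euc k × Euc l => ‖P w.1 w.2‖ₑ ^ 2 := by
    have := hP.continuous.measurable
    fun_prop
  have h1 : ∫⁻ w, F (radialMap w) * ‖P w.1 w.2‖ₑ ^ 2 ∂bundleMeasure m l R =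
      ∫⁻ X, (∫⁻ Z : Euc l, G (‖X‖ ^ 2, ‖Z‖) * ‖P X Z‖ₑ ^ 2) ∂m := by
    rw [bundleMeasure, ← lintegral_indicator (measurableSet_bundle hR)]
    have h2 : ({w : Euc k × Euc l | ‖w.2‖ < R (‖w.1‖ ^ 2)}.indicator fun w =>
        F (radialMap w) * ‖P w.1 w.2‖ₑ ^ 2) = fun w => G (radialMap w) * ‖P w.1 w.2‖ₑ ^ 2 := by
      ext w
      by_cases hw : ‖w.2‖ < R (‖w.1‖ ^ 2) <;> simp [hG, radialMap, hw]
    rw [h2, lintegral_prod]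
    · rfl
    · exact ((hGm.comp measurable_radialMap).mul hPm).aemeasurable
  have h3 : ∀ X : Euc k, ∫⁻ Z : Euc l, G (‖X‖ ^ 2, ‖Z‖) * ‖P X Z‖ₑ ^ 2 =
      symbolDensity P X * ∫⁻ r, G (‖X‖ ^ 2, r) ∂radialMeasure (l - 1 + 2 * s) := by
    intro X
    have hGX : Measurable fun r => G (‖X‖ ^ 2, r) := hGm.comp (by fun_prop)
    have hPX : Measurable fun Z : Euc l => ‖P X Z‖ₑ ^ 2 := hPm.comp measurable_prodMk_left
    have hmeas : Measurable fun Z : Euc l => G (‖X‖ ^ 2, ‖Z‖) * ‖P X Z‖ₑ ^ 2 :=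
      (hGX.comp measurable_norm).mul hPX
    rw [lintegral_polar hl hmeas, lintegral_radialMeasure, lintegral_radialMeasure _ hGX,
      ← lintegral_const_mul]
    · refine setLIntegral_congr_fun measurableSet_Ioi fun r hr => ?_
      have hr0 : (0 : ℝ) < r := hr
      have h4 : ∀ u : Metric.sphere (0 : Euc l) 1,
          G (‖X‖ ^ 2, ‖r • (u : Euc l)‖) * ‖P X (r • (u : Euc l))‖ₑ ^ 2 =
          G (‖X‖ ^ 2, r) * ENNReal.ofReal (r ^ (2 * s)) * ‖P X u‖ₑ ^ 2 := fun u => by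
        rw [norm_smul, norm_eq_of_mem_sphere, mul_one, Real.norm_of_nonneg hr0.le, hP.apply_smul,
          enorm_mul, mul_pow, ← mul_assoc]
        congr 2
        rw [← ofReal_norm, norm_pow, Complex.norm_real, Real.norm_of_nonneg hr0.le,
          ← ENNReal.ofReal_pow (by positivity), ← pow_mul, mul_comm s 2]
      simp only [h4]
      rw [lintegral_const_mul, pow_add, ENNReal.ofReal_mul (by positivity), symbolDensity]
      · ring
      · exact hPX.comp measurable_subtype_coe
    · exact (Measurable.ennreal_ofReal (by fun_prop)).mul hGX
    · have : Measurable fun q : ℝ × Metric.sphere (0 : Euc l) 1 =>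
          G (‖X‖ ^ 2, ‖q.1 • (q.2 : Euc l)‖) * ‖P X (q.1 • (q.2 : Euc l))‖ₑ ^ 2 :=
        hmeas.comp (by fun_prop)
      exact this.lintegral_prod_right'
  have h5 : Measurable fun t => ∫⁻ r, G (t, r) ∂radialMeasure (l - 1 + 2 * s) :=
    hGm.lintegral_prod_right'
  have h6 : Measurable fun X : Euc k =>
      ∫⁻ r, G (‖X‖ ^ 2, r) ∂radialMeasure (l - 1 + 2 * s) := h5.comp (by fun_prop)
  rw [h1, fibredMeasure, ← lintegral_indicator hS, lintegral_prod _ hGm.aemeasurable,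
    symbolMeasure, lintegral_map h5 (by fun_prop),
    lintegral_withDensity_eq_lintegral_mul _ (measurable_symbolDensity hP) h6]
  simp only [h3]
  rfl

theorem measurePreserving_radialMap (hl : 0 < l) {s : ℕ} {P : Euc k → Euc l → ℂ}
    (hP : IsHarmonicSymbol s P) (m : Measure (Euc k)) [SFinite m] {R : ℝ → ℝ}
    (hR : Measurable R) :
    MeasurePreserving radialMap ((bundleMeasure m l R).withDensity fun w => ‖P w.1 w.2‖ₑ ^ 2)
      (fibredMeasure (symbolMeasure m P) (l - 1 + 2 * s) R) := by
  have hPm : Measurable fun w : Euc k × Euc l => ‖P w.1 w.2‖ₑ ^ 2 := by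
    have := hP.continuous.measurable
    fun_prop
  refine ⟨measurable_radialMap, ?_⟩
  ext A hA
  rw [Measure.map_apply measurable_radialMap hA, withDensity_apply _ (measurable_radialMap hA),
    ← lintegral_indicator (measurable_radialMap hA), ← lintegral_indicator_one hA,
    ← lintegral_radialMap_mul hl hP m hR (measurable_one.indicator hA)]
  refine lintegral_congr fun w => ?_
  by_cases hw : radialMap w ∈ A <;> simp [hw]

/-- The weighted measure ignores the zeros of `P`, but there both products vanish. -/
theorem ae_eq_radialMap_mul (hl : 0 < l) {s : ℕ} {P : Euc k → Euc l → ℂ}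
    (hP : IsHarmonicSymbol s P) (m : Measure (Euc k)) [SFinite m] {R : ℝ → ℝ}
    (hR : Measurable R) {c c' : ℝ × ℝ → ℂ}
    (h : c =ᵐ[fibredMeasure (symbolMeasure m P) (l - 1 + 2 * s) R] c') :
    (fun w => c (radialMap w) * P w.1 w.2) =ᵐ[bundleMeasure m l R]
      fun w => c' (radialMap w) * P w.1 w.2 := by
  have hPm : Measurable fun w : Euc k × Euc l => ‖P w.1 w.2‖ₑ ^ 2 := by
    have := hP.continuous.measurable
    fun_prop
  have h1 := (measurePreserving_radialMap hl hP m hR).quasiMeasurePreserving.ae_eq_comp h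
  rw [Filter.EventuallyEq, ae_withDensity_iff hPm] at h1
  filter_upwards [h1] with w hw
  by_cases h0 : P w.1 w.2 = 0
  · rw [h0, mul_zero, mul_zero]
  · have := hw (by simpa using h0)
    simp only [Function.comp_apply] at this
    rw [this]

theorem eLpNorm_radialMap_mul (hl : 0 < l) {s : ℕ} {P : Euc k → Euc l → ℂ}
    (hP : IsHarmonicSymbol s P) (m : Measure (Euc k)) [SFinite m] {R : ℝ → ℝ}
    (hR : Measurable R) {c : ℝ × ℝ → ℂ} (hc : Measurable c) :
    eLpNorm (fun w => c (radialMap w) * P w.1 w.2) 2 (bundleMeasure m l R) =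
      eLpNorm c 2 (fibredMeasure (symbolMeasure m P) (l - 1 + 2 * s) R) := by
  rw [eLpNorm_eq_lintegral_rpow_enorm_toReal two_ne_zero ENNReal.ofNat_ne_top,
    eLpNorm_eq_lintegral_rpow_enorm_toReal two_ne_zero ENNReal.ofNat_ne_top]
  congr 1
  simp only [ENNReal.toReal_ofNat, ENNReal.rpow_ofNat, enorm_mul, mul_pow]
  exact lintegral_radialMap_mul hl hP m hR (F := fun q => ‖c q‖ₑ ^ 2) (by fun_prop)

theorem memLp_radialMap_mul_iff (hl : 0 < l) {s : ℕ} {P : Euc k → Euc l → ℂ}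
    (hP : IsHarmonicSymbol s P) (m : Measure (Euc k)) [SFinite m] {R : ℝ → ℝ}
    (hR : Measurable R) {c : ℝ × ℝ → ℂ} (hc : Measurable c) :
    MemLp (fun w => c (radialMap w) * P w.1 w.2) 2 (bundleMeasure m l R) ↔
      MemLp c 2 (fibredMeasure (symbolMeasure m P) (l - 1 + 2 * s) R) := by
  have h1 : Measurable fun w : Euc k × Euc l => c (radialMap w) * P w.1 w.2 :=
    (hc.comp measurable_radialMap).mul hP.continuous.measurable
  rw [MemLp, MemLp, eLpNorm_radialMap_mul hl hP m hR hc]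
  exact ⟨fun h => ⟨hc.aestronglyMeasurable, h.2⟩, fun h => ⟨h1.aestronglyMeasurable, h.2⟩⟩

/-- The isometry `c ↦ c(|X|², |Z|) P(X, Z)`. -/
def symbolEmbedding (hl : 0 < l) {s : ℕ} {P : Euc k → Euc l → ℂ}
    (hP : IsHarmonicSymbol s P) (m : Measure (Euc k)) [SFinite m] {R : ℝ → ℝ}
    (hR : Measurable R) :
    Lp ℂ 2 (fibredMeasure (symbolMeasure m P) (l - 1 + 2 * s) R) →L[ℂ]
      Lp ℂ 2 (bundleMeasure m l R) :=
  LinearMap.mkContinuous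
    { toFun := fun c => ((memLp_radialMap_mul_iff hl hP m hR (Lp.stronglyMeasurable c).measurable).2
        (Lp.memLp c)).toLp _
      map_add' := fun c c' => by
        rw [← MemLp.toLp_add, MemLp.toLp_eq_toLp_iff]
        refine (ae_eq_radialMap_mul hl hP m hR (Lp.coeFn_add c c')).trans ?_
        exact Eventually.of_forall fun w => by simp [add_mul]
      map_smul' := fun a c => by
        rw [RingHom.id_apply, ← MemLp.toLp_const_smul, MemLp.toLp_eq_toLp_iff]
        refine (ae_eq_radialMap_mul hl hP m hR (Lp.coeFn_smul a c)).trans ?_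
        exact Eventually.of_forall fun w => by simp [mul_assoc] }
    1 fun c => by
      rw [one_mul]
      change ‖((memLp_radialMap_mul_iff hl hP m hR (Lp.stronglyMeasurable c).measurable).2
        (Lp.memLp c)).toLp _‖ ≤ _
      rw [Lp.norm_toLp, eLpNorm_radialMap_mul hl hP m hR (Lp.stronglyMeasurable c).measurable,
        Lp.norm_def]

theorem symbolEmbedding_toLp (hl : 0 < l) {s : ℕ} {P : Euc k → Euc l → ℂ}
    (hP : IsHarmonicSymbol s P) (m : Measure (Euc k)) [SFinite m] {R : ℝ → ℝ}
    (hR : Measurable R) {c : ℝ × ℝ → ℂ}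
    (hc : MemLp c 2 (fibredMeasure (symbolMeasure m P) (l - 1 + 2 * s) R))
    (hcP : MemLp (fun w => c (radialMap w) * P w.1 w.2) 2 (bundleMeasure m l R)) :
    symbolEmbedding hl hP m hR (hc.toLp c) = hcP.toLp _ := by
  change ((memLp_radialMap_mul_iff hl hP m hR
    (Lp.stronglyMeasurable (hc.toLp c)).measurable).2 (Lp.memLp (hc.toLp c))).toLp _ = _
  rw [MemLp.toLp_eq_toLp_iff]
  exact ae_eq_radialMap_mul hl hP m hR hc.coeFn_toLp

/-! ### Completeness of the twisted functions with smooth profiles -/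

theorem measurableSet_baseSet (RX : ℝ≥0∞) : MeasurableSet (baseSet RX) :=
  (measurableSet_le measurable_const measurable_id).inter
    (measurableSet_lt ENNReal.measurable_ofReal measurable_const)

theorem measurable_indicator_baseSet {RX : ℝ≥0∞} {f : ℝ → ℝ} (hf : ContinuousOn f (baseSet RX)) :
    Measurable ((baseSet RX).indicator f) := by
  classical
  rw [← piecewise_eq_indicator]
  exact hf.measurable_piecewise continuousOn_const (measurableSet_baseSet RX)

theorem isOpen_ofReal_lt (RX : ℝ≥0∞) : IsOpen {t : ℝ | ENNReal.ofReal t < RX ^ 2} :=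
  isOpen_lt ENNReal.continuous_ofReal continuous_const

/-- The eigenvalue functions, extended by zero. -/
def eigenFun (l s : ℕ) (bc : BoundaryCondition) (RX : ℝ≥0∞) (R : ℝ → ℝ) (i : ℕ) : ℝ → ℝ :=
  (baseSet RX).indicator fun t => eigenvalue l s bc i (R t)

theorem measurable_eigenFun (hl : 0 < l) {s : ℕ} (hs : 2 ≤ l ∨ s ≤ 1) (bc : BoundaryCondition)
    {RX : ℝ≥0∞} {R : ℝ → ℝ} (hRpos : ∀ t ∈ baseSet RX, 0 < R t)
    (hR : ContinuousOn R (baseSet RX)) (i : ℕ) : Measurable (eigenFun l s bc RX R i) :=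
  measurable_indicator_baseSet ((contDiffOn_eigenvalue hl hs bc i).continuousOn.comp hR hRpos)

/-- The radial part of a twisted function. -/
def twistRadial (l s : ℕ) (bc : BoundaryCondition) (RX : ℝ≥0∞) (R : ℝ → ℝ) (i : ℕ) (φ : ℝ → ℂ)
    (q : ℝ × ℝ) : ℂ :=
  φ q.1 * (twistConst l s * (√(eigenFun l s bc RX R i q.1) : ℂ) ^ s) *
    (bessel (l - 1 + 2 * s) (eigenFun l s bc RX R i q.1 * q.2 ^ 2) : ℂ)

theorem sphereTransform_eq_twistRadial (hl : 0 < l) {s : ℕ} (hs : 2 ≤ l ∨ s ≤ 1)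
    (bc : BoundaryCondition) {RX : ℝ≥0∞} {R : ℝ → ℝ} (hRpos : ∀ t ∈ baseSet RX, 0 < R t)
    {P : Euc k → Euc l → ℂ} (hP : IsHarmonicSymbol s P) (i : ℕ) (φ : ℝ → ℂ) {w : Euc k × Euc l}
    (hw : ‖w.1‖ₑ < RX) :
    sphereTransform (fun t => eigenvalue l s bc i (R t)) φ P w =
      twistRadial l s bc RX R i φ (radialMap w) * P w.1 w.2 := by
  have ht := norm_sq_mem_baseSet hw
  rw [sphereTransform_eq hl hP, twistRadial, eigenFun, radialMap]
  simp only [indicator_of_mem ht]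
  rw [Real.sq_sqrt (eigenvalue_nonneg hl hs bc (hRpos _ ht) i)]
  ring

theorem ae_bundleMeasure {m : Measure (Euc k)} [SFinite m] {RX : ℝ≥0∞}
    (hm : ∀ᵐ X ∂m, ‖X‖ₑ < RX) (R : ℝ → ℝ) : ∀ᵐ w ∂bundleMeasure m l R, ‖w.1‖ₑ < RX := by
  refine ae_restrict_of_ae ?_
  exact Measure.quasiMeasurePreserving_fst.ae hm

/-- Pull `h` back by the adjoint of the isometry. The pullback is orthogonal to all radial parts
with smooth profile, hence zero by `ae_eq_zero_of_orthogonal`, and so `h` is orthogonal to the whole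
range of the isometry. -/
theorem inner_eq_zero_of_orthogonal_smooth (hl : 0 < l) {s : ℕ} (hs : 2 ≤ l ∨ s ≤ 1)
    (bc : BoundaryCondition) {RX : ℝ≥0∞} {R : ℝ → ℝ} (hRpos : ∀ t ∈ baseSet RX, 0 < R t)
    (hR : ContinuousOn R (baseSet RX)) {R' : ℝ → ℝ} (hRm : Measurable R')
    (hR' : ∀ t ∈ baseSet RX, R' t = R t)
    {P : Euc k → Euc l → ℂ} (hP : IsHarmonicSymbol s P) (m : Measure (Euc k)) [SFinite m]
    (hm : ∀ᵐ X ∂m, ‖X‖ₑ < RX)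
    (hF : ∀ (i : ℕ) (ψ : ℝ → ℝ), ContDiff ℝ ∞ ψ → HasCompactSupport ψ →
      tsupport ψ ⊆ {t | ENNReal.ofReal t < RX ^ 2} →
      MemLp (sphereTransform (fun t => eigenvalue l s bc i (R t)) (fun t => (ψ t : ℂ)) P) 2
        (bundleMeasure m l R'))
    {h : Lp ℂ 2 (bundleMeasure m l R')}
    (horth : ∀ (i : ℕ) (ψ : ℝ → ℝ) (h1 : ContDiff ℝ ∞ ψ) (h2 : HasCompactSupport ψ)
      (h3 : tsupport ψ ⊆ {t | ENNReal.ofReal t < RX ^ 2}),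
      inner ℂ ((hF i ψ h1 h2 h3).toLp _) h = 0)
    {c : ℝ × ℝ → ℂ} (hc : Measurable c)
    (hcP : MemLp (fun w => c (radialMap w) * P w.1 w.2) 2
      (bundleMeasure m l R')) :
    inner ℂ (hcP.toLp _) h = 0 := by
  let V := symbolEmbedding hl hP m hRm
  obtain ⟨g, hg⟩ : ∃ g, g = ContinuousLinearMap.adjoint V h := ⟨_, rfl⟩
  have hem := measurable_eigenFun hl hs bc hRpos hR
  have hE : Measurable (bessel (l - 1 + 2 * s)) :=
    (by fun_prop : Continuous (bessel (l - 1 + 2 * s))).measurable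
  have hradm : ∀ i (ψ : ℝ → ℝ), ContDiff ℝ ∞ ψ → Measurable (twistRadial l s bc RX R i
      fun t => (ψ t : ℂ)) := fun i ψ h1 => by
    have := hem i
    have := h1.continuous.measurable
    unfold twistRadial
    fun_prop
  have hν : ∀ᵐ t ∂symbolMeasure m P, t ∈ baseSet RX := by
    refine (ae_map_iff (by fun_prop : Measurable fun X : Euc k => ‖X‖ ^ 2).aemeasurable
      (measurableSet_baseSet RX)).2 ?_
    refine (withDensity_absolutelyContinuous _ _).ae_le ?_
    filter_upwards [hm] with X hX using norm_sq_mem_baseSet hX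
  have haeF : ∀ i (ψ : ℝ → ℝ), sphereTransform (fun t => eigenvalue l s bc i (R t))
      (fun t => (ψ t : ℂ)) P =ᵐ[bundleMeasure m l R'] fun w =>
      twistRadial l s bc RX R i (fun t => (ψ t : ℂ)) (radialMap w) * P w.1 w.2 := fun i ψ => by
    filter_upwards [ae_bundleMeasure hm R'] with w hw
    exact sphereTransform_eq_twistRadial hl hs bc hRpos hP i _ hw
  have hmem : ∀ i (ψ : ℝ → ℝ), ContDiff ℝ ∞ ψ → HasCompactSupport ψ →
      tsupport ψ ⊆ {t | ENNReal.ofReal t < RX ^ 2} →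
      MemLp (twistRadial l s bc RX R i fun t => (ψ t : ℂ)) 2
        (fibredMeasure (symbolMeasure m P) (l - 1 + 2 * s) R') := fun i ψ h1 h2 h3 =>
    (memLp_radialMap_mul_iff hl hP m hRm (hradm i ψ h1)).1
      ((memLp_congr_ae (haeF i ψ)).1 (hF i ψ h1 h2 h3))
  -- The inner product conjugates its first argument. Since `ψ` and the Bessel factor are real, this
  -- affects only the nonvanishing coefficient, which is absorbed in `D`.
  have hconj : ∀ i (ψ : ℝ → ℝ) (q : ℝ × ℝ), (ψ q.1 : ℂ) *
      (starRingEnd ℂ) (twistConst l s * (√(eigenFun l s bc RX R i q.1) : ℂ) ^ s) *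
      (bessel (l - 1 + 2 * s) (eigenFun l s bc RX R i q.1 * q.2 ^ 2) : ℂ) =
      (starRingEnd ℂ) (twistRadial l s bc RX R i (fun t => (ψ t : ℂ)) q) := fun i ψ q => by
    simp only [twistRadial, map_mul, Complex.conj_ofReal]
  have hg0 : (g : ℝ × ℝ → ℂ) =ᵐ[fibredMeasure (symbolMeasure m P) (l - 1 + 2 * s) R'] 0 := by
    refine ae_eq_zero_of_orthogonal hl hs bc (isOpen_ofReal_lt RX) (T := baseSet RX)
      (fun t ht => ht.2) hν hRm (fun t ht => ?_) (e := eigenFun l s bc RX R) hem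
      (fun i t ht => ?_)
      (D := fun i t => (starRingEnd ℂ) (twistConst l s * (√(eigenFun l s bc RX R i t) : ℂ) ^ s))
      (fun i => ?_) (fun i t ht => ?_) (Lp.stronglyMeasurable g).measurable (Lp.memLp g)
      (fun i ψ h1 h2 h3 => ?_) (fun i ψ h1 h2 h3 => ?_)
    · rw [hR' t ht]
      exact hRpos t ht
    · rw [hR' t ht, eigenFun, indicator_of_mem ht]
    · have := hem i
      exact Complex.continuous_conj.measurable.comp (by fun_prop)
    · rw [Ne, map_eq_zero]
      refine mul_ne_zero (twistConst_ne_zero hl s) ?_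
      rcases eq_or_ne s 0 with hs0 | hs0
      · rw [hs0, pow_zero]
        exact one_ne_zero
      · rw [eigenFun, indicator_of_mem ht]
        exact pow_ne_zero _ (Complex.ofReal_ne_zero.2 (Real.sqrt_pos.2 (eigenvalue_pos hl hs bc (hRpos t ht) i hs0)).ne')
    · simp only [hconj]
      exact (hmem i ψ h1 h2 h3).star
    · have h4 := horth i ψ h1 h2 h3
      have h5 : (hF i ψ h1 h2 h3).toLp _ = V ((hmem i ψ h1 h2 h3).toLp _) := by
        rw [symbolEmbedding_toLp hl hP m hRm (hmem i ψ h1 h2 h3)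
          ((memLp_congr_ae (haeF i ψ)).1 (hF i ψ h1 h2 h3)), MemLp.toLp_eq_toLp_iff]
        exact haeF i ψ
      rw [h5, ← ContinuousLinearMap.adjoint_inner_right, ← hg, L2.inner_def] at h4
      rw [← h4]
      refine integral_congr_ae ?_
      filter_upwards [(hmem i ψ h1 h2 h3).coeFn_toLp] with q hq
      rw [hconj, hq, RCLike.inner_apply, mul_comm]
  have hcm := (memLp_radialMap_mul_iff hl hP m hRm hc).1 hcP
  have hgz : g = 0 := by
    rw [Lp.eq_zero_iff_ae_eq_zero]
    exact hg0
  rw [← symbolEmbedding_toLp hl hP m hRm hcm hcP, ← ContinuousLinearMap.adjoint_inner_right,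
    ← hg, hgz, inner_zero_right]

end ZBall
end

noncomputable section
namespace ZBall
open Filter Topology

variable {k l : ℕ}

/-! ### Square integrability of the twisted functions with compactly supported profiles -/

theorem memLp_of_bounded_of_eq_zero {α : Type*} [MeasurableSpace α] {μ : Measure α} {p : ℝ≥0∞}
    {F : α → ℂ} (hF : AEStronglyMeasurable F μ) {A : Set α} (hA : MeasurableSet A) (hμ : μ A ≠ ⊤)
    (C : ℝ) (hC : ∀ x ∈ A, ‖F x‖ ≤ C) (h0 : ∀ x ∉ A, F x = 0) : MemLp F p μ := by
  have h1 : F = A.indicator F := by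
    ext x
    by_cases hx : x ∈ A
    · rw [indicator_of_mem hx]
    · rw [indicator_of_notMem hx, h0 x hx]
  rw [h1, memLp_indicator_iff_restrict hA]
  have : IsFiniteMeasure (μ.restrict A) := ⟨by rw [Measure.restrict_apply_univ]; exact hμ.lt_top⟩
  exact MemLp.of_bound hF.restrict C ((ae_restrict_iff' hA).2 (Eventually.of_forall hC))

/-- On the nonnegative part of the compact support `R` is continuous, hence bounded, so the set sits
in a product of two bounded balls. -/
theorem bundleMeasure_preimage_tsupport_ne_top (m : Measure (Euc k)) [SFinite m]
    [IsFiniteMeasureOnCompacts m] {RX : ℝ≥0∞} {R R' : ℝ → ℝ} (hR : ContinuousOn R (baseSet RX))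
    (hR' : ∀ t ∈ baseSet RX, R' t = R t) {ψ : ℝ → ℝ} (h2 : HasCompactSupport ψ)
    (h3 : tsupport ψ ⊆ {t | ENNReal.ofReal t < RX ^ 2}) :
    bundleMeasure m l R' {w | ‖w.1‖ ^ 2 ∈ tsupport ψ} ≠ ⊤ := by
  have hK : IsCompact (tsupport ψ ∩ Ici 0) := h2.isCompact.inter_right isClosed_Ici
  obtain ⟨C, hC⟩ := hK.exists_bound_of_continuousOn (f := R) (hR.mono fun t ht => ⟨ht.2, h3 ht.1⟩)
  obtain ⟨D, hD⟩ := h2.isCompact.isBounded.exists_norm_le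
  have hm : MeasurableSet {w : Euc k × Euc l | ‖w.1‖ ^ 2 ∈ tsupport ψ} :=
    ((isClosed_tsupport ψ).preimage (by fun_prop : Continuous fun w : Euc k × Euc l =>
      ‖w.1‖ ^ 2)).measurableSet
  rw [bundleMeasure, Measure.restrict_apply hm]
  refine ne_top_of_le_ne_top (b := m.prod volume
    (Metric.closedBall (0 : Euc k) √D ×ˢ Metric.ball (0 : Euc l) C)) ?_ (measure_mono ?_)
  · rw [Measure.prod_prod]
    exact ENNReal.mul_ne_top (isCompact_closedBall _ _).measure_ne_top measure_ball_lt_top.ne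
  · rintro w ⟨hw1, hw2⟩
    have hw1' : ‖w.1‖ ^ 2 ∈ tsupport ψ := hw1
    have hw2' : ‖w.2‖ < R' (‖w.1‖ ^ 2) := hw2
    rw [hR' _ ⟨sq_nonneg _, h3 hw1'⟩] at hw2'
    refine ⟨?_, ?_⟩
    · rw [mem_closedBall_zero_iff]
      exact Real.le_sqrt_of_sq_le ((le_abs_self _).trans (hD _ hw1'))
    · rw [mem_ball_zero_iff]
      exact hw2'.trans_le ((le_abs_self _).trans (hC _ ⟨hw1', mem_Ici.2 (sq_nonneg _)⟩))

/-- The kernel of the twisted Z-Fourier transforms: for a symbol `P` of order `s`, the integral of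
`e^{i⟨Z, ru⟩} P(X, u)` over the unit sphere is `hankelKernel l s r |Z| * P(X, Z)`. -/
def hankelKernel (l s : ℕ) (r z : ℝ) : ℂ :=
  funkHecke l s * bessel (l - 1 + 2 * s) (r ^ 2 * z ^ 2) * (r : ℂ) ^ s

theorem continuous_hankelKernel {α : Type*} [TopologicalSpace α] (l s : ℕ) {f g : α → ℝ}
    (hf : Continuous f) (hg : Continuous g) :
    Continuous fun x => hankelKernel l s (f x) (g x) := by
  unfold hankelKernel
  fun_prop

theorem IsHarmonicSymbol.integral_exp_smul_eq (hl : 0 < l) {s : ℕ} {P : Euc k → Euc l → ℂ}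
    (hP : IsHarmonicSymbol s P) (X : Euc k) (Z : Euc l) (r : ℝ) :
    ∫ u : Metric.sphere (0 : Euc l) 1,
      Complex.exp (Complex.I * (inner ℝ Z (r • (u : Euc l)) : ℝ)) * P X u ∂sphereMeasure l =
    hankelKernel l s r ‖Z‖ * P X Z := by
  rw [hP.integral_exp_smul hl, hankelKernel]
  ring

/-- Read backwards as a sphere integral, the product is bounded by the supremum of the symbol times
the total mass, uniformly in `r` and `Z`; the Bessel expression hides this. -/
theorem IsHarmonicSymbol.exists_bound (hl : 0 < l) {s : ℕ} {P : Euc k → Euc l → ℂ}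
    (hP : IsHarmonicSymbol s P) {K : Set ℝ} (hK : IsCompact K) :
    ∃ C : ℝ, 0 ≤ C ∧ ∀ X : Euc k, ‖X‖ ^ 2 ∈ K → ∀ (r : ℝ) (Z : Euc l),
      ‖hankelKernel l s r ‖Z‖ * P X Z‖ ≤ C := by
  obtain ⟨D, hD⟩ := hK.isBounded.exists_norm_le
  obtain ⟨C, hC⟩ := ((isCompact_closedBall (0 : Euc k) √D).prod
    (isCompact_closedBall (0 : Euc l) 1)).exists_bound_of_continuousOn hP.continuous.continuousOn
  refine ⟨|C * (sphereMeasure l).real univ|, abs_nonneg _, fun X hX r Z => ?_⟩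
  rw [← hP.integral_exp_smul_eq hl]
  refine (norm_integral_le_of_norm_le_const (C := C) (Eventually.of_forall fun u => ?_)).trans
    (le_abs_self _)
  rw [norm_mul, mul_comm Complex.I, Complex.norm_exp_ofReal_mul_I, one_mul]
  refine hC (X, u) ⟨?_, ?_⟩
  · rw [mem_closedBall_zero_iff]
    exact Real.le_sqrt_of_sq_le ((le_abs_self _).trans (hD _ hX))
  · rw [mem_closedBall_zero_iff, norm_eq_of_mem_sphere]

theorem sphereTransform_eq_hankelKernel (hl : 0 < l) {s : ℕ} {P : Euc k → Euc l → ℂ}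
    (hP : IsHarmonicSymbol s P) (lam : ℝ → ℝ) (φ : ℝ → ℂ) (w : Euc k × Euc l) :
    sphereTransform lam φ P w = ((sphereMeasure l).real univ : ℂ)⁻¹ * (φ (‖w.1‖ ^ 2) *
      (hankelKernel l s √(lam (‖w.1‖ ^ 2)) ‖w.2‖ * P w.1 w.2)) := by
  rw [sphereTransform_eq hl hP, twistConst, hankelKernel]
  ring

theorem measurable_twistRadial (hl : 0 < l) {s : ℕ} (hs : 2 ≤ l ∨ s ≤ 1) (bc : BoundaryCondition)
    {RX : ℝ≥0∞} {R : ℝ → ℝ} (hRpos : ∀ t ∈ baseSet RX, 0 < R t)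
    (hR : ContinuousOn R (baseSet RX)) (i : ℕ) {φ : ℝ → ℂ} (hφ : Measurable φ) :
    Measurable (twistRadial l s bc RX R i φ) := by
  have := measurable_eigenFun hl hs bc hRpos hR i
  have hE : Measurable (bessel (l - 1 + 2 * s)) :=
    (by fun_prop : Continuous (bessel (l - 1 + 2 * s))).measurable
  unfold twistRadial
  fun_prop

theorem sphereTransform_ae_eq (hl : 0 < l) {s : ℕ} (hs : 2 ≤ l ∨ s ≤ 1)
    (bc : BoundaryCondition) {RX : ℝ≥0∞} {R : ℝ → ℝ} (hRpos : ∀ t ∈ baseSet RX, 0 < R t)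
    {P : Euc k → Euc l → ℂ} (hP : IsHarmonicSymbol s P) {m : Measure (Euc k)} [SFinite m]
    (hm : ∀ᵐ X ∂m, ‖X‖ₑ < RX) (R' : ℝ → ℝ) (i : ℕ) (φ : ℝ → ℂ) :
    sphereTransform (fun t => eigenvalue l s bc i (R t)) φ P =ᵐ[bundleMeasure m l R'] fun w =>
      twistRadial l s bc RX R i φ (radialMap w) * P w.1 w.2 := by
  filter_upwards [ae_bundleMeasure hm R'] with w hw
  exact sphereTransform_eq_twistRadial hl hs bc hRpos hP i _ hw

theorem measurableSet_preimage_tsupport (ψ : ℝ → ℝ) :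
    MeasurableSet {w : Euc k × Euc l | ‖w.1‖ ^ 2 ∈ tsupport ψ} :=
  ((isClosed_tsupport ψ).preimage (by fun_prop : Continuous fun w : Euc k × Euc l =>
    ‖w.1‖ ^ 2)).measurableSet

theorem memLp_sphereTransform (hl : 0 < l) {s : ℕ} (hs : 2 ≤ l ∨ s ≤ 1)
    (bc : BoundaryCondition) {RX : ℝ≥0∞} {R : ℝ → ℝ} (hRpos : ∀ t ∈ baseSet RX, 0 < R t)
    (hR : ContinuousOn R (baseSet RX)) {R' : ℝ → ℝ} (hR' : ∀ t ∈ baseSet RX, R' t = R t)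
    {P : Euc k → Euc l → ℂ} (hP : IsHarmonicSymbol s P) (m : Measure (Euc k)) [SFinite m]
    [IsFiniteMeasureOnCompacts m] (hm : ∀ᵐ X ∂m, ‖X‖ₑ < RX) (i : ℕ) {ψ : ℝ → ℝ}
    (h1 : Continuous ψ) (h2 : HasCompactSupport ψ)
    (h3 : tsupport ψ ⊆ {t | ENNReal.ofReal t < RX ^ 2}) :
    MemLp (sphereTransform (fun t => eigenvalue l s bc i (R t)) (fun t => (ψ t : ℂ)) P) 2
      (bundleMeasure m l R') := by
  obtain ⟨C, -, hC⟩ := hP.exists_bound hl h2.isCompact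
  obtain ⟨D, hD⟩ := h2.exists_bound_of_continuous h1
  refine memLp_of_bounded_of_eq_zero ?_ (measurableSet_preimage_tsupport ψ)
    (bundleMeasure_preimage_tsupport_ne_top m hR hR' h2 h3)
    (‖((sphereMeasure l).real univ : ℂ)⁻¹‖ * (D * C)) (fun w hw => ?_) fun w hw => ?_
  · refine AEStronglyMeasurable.congr ?_ (sphereTransform_ae_eq hl hs bc hRpos hP hm R' i _).symm
    have hφ : Measurable fun t => (ψ t : ℂ) := by fun_prop
    exact (((measurable_twistRadial hl hs bc hRpos hR i hφ).comp measurable_radialMap).mul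
      hP.continuous.measurable).aestronglyMeasurable
  · rw [sphereTransform_eq_hankelKernel hl hP, norm_mul, norm_mul]
    have h4 := hC w.1 hw √(eigenvalue l s bc i (R (‖w.1‖ ^ 2))) w.2
    have h5 := hD (‖w.1‖ ^ 2)
    rw [Complex.norm_real]
    gcongr
    exact (norm_nonneg _).trans h5
  · rw [sphereTransform_eq_hankelKernel hl hP, image_eq_zero_of_notMem_tsupport hw]
    simp

/-! ### Z-Fourier transforms -/

/-- The radial part of a Z-Fourier transform. -/
def hankelRadial (l s : ℕ) (φ : ℝ → ℝ → ℂ) (q : ℝ × ℝ) : ℂ :=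
  ∫ r, φ √q.1 r * hankelKernel l s r q.2 ∂radialMeasure (l - 1)

theorem measurable_hankelRadial (l s : ℕ) {φ : ℝ → ℝ → ℂ}
    (hφ : Measurable (Function.uncurry φ)) : Measurable (hankelRadial l s φ) := by
  have h1 : Measurable fun x : (ℝ × ℝ) × ℝ => φ √x.1.1 x.2 * hankelKernel l s x.2 x.1.2 := by
    refine Measurable.mul ?_ ?_
    · exact hφ.comp (by fun_prop : Measurable fun x : (ℝ × ℝ) × ℝ => (√x.1.1, x.2))
    · exact (continuous_hankelKernel l s continuous_snd (by fun_prop)).measurable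
  have h2 := h1.stronglyMeasurable.integral_prod_right' (ν := radialMeasure (l - 1))
  exact h2.measurable

theorem zFourier_eq (hl : 0 < l) {s : ℕ} {P : Euc k → Euc l → ℂ} (hP : IsHarmonicSymbol s P)
    {φ : ℝ → ℝ → ℂ} (hφ : IsProfile l φ) (w : Euc k × Euc l) :
    zFourier φ P w = hankelRadial l s φ (radialMap w) * P w.1 w.2 := by
  obtain ⟨C, hC⟩ := (isCompact_closedBall (0 : Euc l) 1).exists_bound_of_continuousOn
    (f := P w.1) (hP.continuous.comp (by fun_prop : Continuous fun Z : Euc l =>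
      (w.1, Z))).continuousOn
  have hPm : Measurable (P w.1) := hP.continuous.measurable.comp measurable_prodMk_left
  have hint : Integrable fun K : Euc l => Complex.exp (Complex.I * (inner ℝ w.2 K : ℝ)) *
      φ ‖w.1‖ ‖K‖ * P w.1 (‖K‖⁻¹ • K) := by
    have h1 : Integrable fun K : Euc l => Complex.exp (Complex.I * (inner ℝ w.2 K : ℝ)) *
        φ ‖w.1‖ ‖K‖ := by
      refine (hφ.2 ‖w.1‖).1.bdd_mul (c := 1) (by fun_prop) (Eventually.of_forall fun K => ?_)
      rw [mul_comm, Complex.norm_exp_ofReal_mul_I]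
    refine h1.mul_bdd (c := C) ?_ (Eventually.of_forall fun K => ?_)
    · exact (hPm.comp (by fun_prop)).aestronglyMeasurable
    · refine hC _ ?_
      rw [mem_closedBall_zero_iff, norm_smul, norm_inv, norm_norm]
      exact inv_mul_le_one
  rw [zFourier, integral_polar hl hint, hankelRadial, ← integral_mul_const, integral_radialMeasure,
    integral_radialMeasure]
  refine setIntegral_congr_fun measurableSet_Ioi fun r hr => ?_
  have hr0 : (0 : ℝ) < r := hr
  have h2 : ∀ u : Metric.sphere (0 : Euc l) 1,
      Complex.exp (Complex.I * (inner ℝ w.2 (r • (u : Euc l)) : ℝ)) *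
      φ ‖w.1‖ ‖r • (u : Euc l)‖ * P w.1 (‖r • (u : Euc l)‖⁻¹ • r • (u : Euc l)) = φ ‖w.1‖ r *
      (Complex.exp (Complex.I * (inner ℝ w.2 (r • (u : Euc l)) : ℝ)) * P w.1 u) := fun u => by
    rw [norm_smul, norm_eq_of_mem_sphere, mul_one, Real.norm_of_nonneg hr0.le,
      inv_smul_smul₀ hr0.ne']
    ring
  simp only [h2, radialMap]
  rw [integral_const_mul, hP.integral_exp_smul_eq hl, Real.sqrt_sq (norm_nonneg _)]
  ring

/-- Profiles supported in thin shells around the spheres of radius `√(e(|X|²))`. -/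
def shell (l : ℕ) (e : ℝ → ℝ) (ψ : ℝ → ℝ) (δ : ℝ) (x r : ℝ) : ℂ :=
  (Ioc (√(e (x ^ 2)) + δ) (√(e (x ^ 2)) + δ * 2)).indicator
    (fun r => ((ψ (x ^ 2) * δ⁻¹ * (r ^ (l - 1))⁻¹ : ℝ) : ℂ)) r

/-- The shell starts at distance `δ` outside the sphere, so `r ≥ δ` on it and `r ^ (l - 1)` stays
away from zero even when the eigenvalue is `0`. -/
theorem isProfile_shell (l : ℕ) {e : ℝ → ℝ} (he : Measurable e) {ψ : ℝ → ℝ} (hψ : Measurable ψ)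
    {δ : ℝ} (hδ : 0 < δ) : IsProfile l (shell l e ψ δ) := by
  have hm : Measurable (Function.uncurry (shell l e ψ δ)) := by
    have h1 : Function.uncurry (shell l e ψ δ) =
        {q : ℝ × ℝ | √(e (q.1 ^ 2)) + δ < q.2 ∧ q.2 ≤ √(e (q.1 ^ 2)) + δ * 2}.indicator
          fun q => ((ψ (q.1 ^ 2) * δ⁻¹ * (q.2 ^ (l - 1))⁻¹ : ℝ) : ℂ) := by
      ext q
      simp only [Function.uncurry, shell, indicator, mem_Ioc, mem_ofPred_eq]
    rw [h1]
    refine Measurable.indicator (by fun_prop) ?_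
    have h2 : Measurable fun q : ℝ × ℝ => √(e (q.1 ^ 2)) := by fun_prop
    exact (measurableSet_lt (h2.add_const δ) measurable_snd).inter
      (measurableSet_le measurable_snd (h2.add_const (δ * 2)))
  have h2 : ∀ (x : ℝ) (p : ℝ≥0∞), MemLp (fun K : Euc l => shell l e ψ δ x ‖K‖) p := fun x p => by
    refine memLp_of_bounded_of_eq_zero ?_ (measurableSet_closedBall (x := (0 : Euc l))
      (ε := √(e (x ^ 2)) + δ * 2)) measure_closedBall_lt_top.ne
      (|ψ (x ^ 2)| * δ⁻¹ * (δ ^ (l - 1))⁻¹) (fun K _ => ?_) fun K hK => ?_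
    · exact (hm.comp (by fun_prop : Measurable fun K : Euc l => (x, ‖K‖))).aestronglyMeasurable
    · rw [shell, indicator]
      split_ifs with h
      · have h3 : δ ≤ ‖K‖ := (le_add_of_nonneg_left (Real.sqrt_nonneg _)).trans h.1.le
        rw [Complex.norm_real, norm_mul, norm_mul, Real.norm_eq_abs, Real.norm_of_nonneg
          (inv_nonneg.2 hδ.le), norm_inv, norm_pow, norm_norm]
        gcongr
      · rw [norm_zero]
        positivity
    · rw [mem_closedBall_zero_iff] at hK
      exact indicator_of_notMem (fun h => hK h.2) _
  exact ⟨hm, fun x => ⟨memLp_one_iff_integrable.1 (h2 x 1), h2 x 2⟩⟩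

/-- The inverse power in the profile cancels the radial density, and `r = √e + δy` rescales the
shell to `[1, 2]`. The result is an average of the kernel that converges as `δ → 0`. -/
theorem hankelRadial_shell (l s : ℕ) (e ψ : ℝ → ℝ) {δ : ℝ} (hδ : 0 < δ) {q : ℝ × ℝ}
    (hq : 0 ≤ q.1) : hankelRadial l s (shell l e ψ δ) q =
      ψ q.1 * ∫ y in (1 : ℝ)..2, hankelKernel l s (√(e q.1) + δ * y) q.2 := by
  have ha := Real.sqrt_nonneg (e q.1)
  have h1 : ∀ r : ℝ, r ∈ Ioi (0 : ℝ) →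
      (r : ℂ) ^ (l - 1) * (shell l e ψ δ √q.1 r * hankelKernel l s r q.2) =
      (Ioc (√(e q.1) + δ) (√(e q.1) + δ * 2)).indicator
        (fun r => ((ψ q.1 * δ⁻¹ : ℝ) : ℂ) * hankelKernel l s r q.2) r := fun r hr => by
    have hr0 : (r : ℂ) ≠ 0 := Complex.ofReal_ne_zero.2 (ne_of_gt hr)
    rw [shell, Real.sq_sqrt hq, indicator, indicator]
    split_ifs
    · push_cast
      field_simp
    · simp
  rw [hankelRadial, integral_radialMeasure, setIntegral_congr_fun measurableSet_Ioi h1,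
    setIntegral_indicator measurableSet_Ioc, inter_eq_self_of_subset_right,
    ← intervalIntegral.integral_of_le (by linarith), intervalIntegral.integral_const_mul,
    intervalIntegral.integral_comp_add_mul (fun r => hankelKernel l s r q.2) hδ.ne', mul_one]
  · rw [Complex.real_smul]
    push_cast
    ring
  · intro r hr
    exact (by linarith [hr.1] : (0 : ℝ) < r)

theorem tendsto_hankelRadial_shell (l s : ℕ) (e ψ : ℝ → ℝ) {q : ℝ × ℝ}
    (hq : 0 ≤ q.1) {δ : ℕ → ℝ} (hδ : ∀ n, 0 < δ n) (hlim : Tendsto δ atTop (𝓝 0)) :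
    Tendsto (fun n => hankelRadial l s (shell l e ψ (δ n)) q) atTop
      (𝓝 (ψ q.1 * hankelKernel l s √(e q.1) q.2)) := by
  simp only [hankelRadial_shell l s e ψ (hδ _) hq]
  refine Tendsto.const_mul _ ?_
  have hc : Continuous fun d : ℝ => ∫ y in (1 : ℝ)..2, hankelKernel l s (√(e q.1) + d * y) q.2 := by
    refine intervalIntegral.continuous_parametric_intervalIntegral_of_continuous' ?_ 1 2
    exact continuous_hankelKernel l s (by fun_prop) continuous_const
  have := (hc.tendsto 0).comp hlim
  simp only [zero_mul, add_zero, intervalIntegral.integral_const] at this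
  norm_num at this
  exact this

theorem norm_hankelRadial_shell_mul_le {s : ℕ} (e ψ : ℝ → ℝ) {δ : ℝ} (hδ : 0 < δ)
    {P : Euc k → Euc l → ℂ} {w : Euc k × Euc l} {C : ℝ}
    (hC : ∀ r : ℝ, ‖hankelKernel l s r ‖w.2‖ * P w.1 w.2‖ ≤ C) :
    ‖hankelRadial l s (shell l e ψ δ) (radialMap w) * P w.1 w.2‖ ≤ |ψ (‖w.1‖ ^ 2)| * C := by
  rw [hankelRadial_shell l s e ψ hδ (q := radialMap w) (sq_nonneg _), mul_assoc,
    ← intervalIntegral.integral_mul_const, norm_mul, Complex.norm_real]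
  refine mul_le_mul_of_nonneg_left ?_ (abs_nonneg _)
  have := intervalIntegral.norm_integral_le_of_norm_le_const (a := (1 : ℝ)) (b := 2) (C := C)
    (f := fun y => hankelKernel l s (√(e (radialMap w).1) + δ * y) (radialMap w).2 * P w.1 w.2)
    fun y _ => hC _
  refine this.trans (le_of_eq ?_)
  norm_num

/-- Shell profiles give Z-Fourier transforms converging pointwise to the twisted function times the
area of the unit sphere. They are uniformly bounded and vanish off a set of finite measure, so
orthogonality passes to the limit by dominated convergence. -/
theorem inner_sphereTransform_eq_zero (hl : 0 < l) {s : ℕ} (hs : 2 ≤ l ∨ s ≤ 1)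
    (bc : BoundaryCondition) {RX : ℝ≥0∞} {R : ℝ → ℝ} (hRpos : ∀ t ∈ baseSet RX, 0 < R t)
    (hR : ContinuousOn R (baseSet RX)) {R' : ℝ → ℝ} (hR' : ∀ t ∈ baseSet RX, R' t = R t)
    {P : Euc k → Euc l → ℂ} (hP : IsHarmonicSymbol s P) (m : Measure (Euc k)) [SFinite m]
    [IsFiniteMeasureOnCompacts m] {h : Lp ℂ 2 (bundleMeasure m l R')}
    (horth : ∀ φ, IsProfile l φ → ∀ hφ : MemLp (zFourier φ P) 2 (bundleMeasure m l R'),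
      inner ℂ (hφ.toLp _) h = 0) (i : ℕ) {ψ : ℝ → ℝ}
    (h1 : Continuous ψ) (h2 : HasCompactSupport ψ)
    (h3 : tsupport ψ ⊆ {t | ENNReal.ofReal t < RX ^ 2})
    (hF : MemLp (sphereTransform (fun t => eigenvalue l s bc i (R t)) (fun t => (ψ t : ℂ)) P) 2
      (bundleMeasure m l R')) :
    inner ℂ (hF.toLp _) h = 0 := by
  obtain ⟨C, hC0, hC⟩ := hP.exists_bound hl h2.isCompact
  obtain ⟨D, hD⟩ := h2.exists_bound_of_continuous h1
  have hA := measurableSet_preimage_tsupport (k := k) (l := l) ψ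
  have hAfin := bundleMeasure_preimage_tsupport_ne_top (l := l) m hR hR' h2 h3
  set A := {w : Euc k × Euc l | ‖w.1‖ ^ 2 ∈ tsupport ψ} with hAdef
  set e := eigenFun l s bc RX R i with he
  have hem : Measurable e := measurable_eigenFun hl hs bc hRpos hR i
  obtain ⟨δ, -, hδ, hlim⟩ := exists_seq_strictAnti_tendsto (0 : ℝ)
  have hpr : ∀ n, IsProfile l (shell l e ψ (δ n)) := fun n =>
    isProfile_shell l hem h1.measurable (hδ n)
  have hbd : ∀ n, ∀ w ∈ A, ‖zFourier (shell l e ψ (δ n)) P w‖ ≤ D * C := fun n w hw => by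
    rw [zFourier_eq hl hP (hpr n)]
    refine (norm_hankelRadial_shell_mul_le e ψ (hδ n) (C := C) fun r => hC _ hw r _).trans ?_
    gcongr
    exact hD _
  have hz : ∀ n, ∀ w ∉ A, zFourier (shell l e ψ (δ n)) P w = 0 := fun n w hw => by
    rw [zFourier_eq hl hP (hpr n),
      hankelRadial_shell l s e ψ (hδ n) (q := radialMap w) (sq_nonneg _), radialMap,
      image_eq_zero_of_notMem_tsupport hw]
    simp
  have hmeas : ∀ n, Measurable (zFourier (shell l e ψ (δ n)) P) := fun n => by
    rw [show zFourier (shell l e ψ (δ n)) P = _ from funext fun w => zFourier_eq hl hP (hpr n) w]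
    exact ((measurable_hankelRadial l s (hpr n).1).comp measurable_radialMap).mul
      hP.continuous.measurable
  have hmem : ∀ n, MemLp (zFourier (shell l e ψ (δ n)) P) 2 (bundleMeasure m l R') := fun n =>
    memLp_of_bounded_of_eq_zero (hmeas n).aestronglyMeasurable hA hAfin _ (hbd n) (hz n)
  set σ : ℂ := ((sphereMeasure l).real univ : ℂ) with hσ
  have hσ0 : σ ≠ 0 := Complex.ofReal_ne_zero.2 (sphereMeasure_real_univ_ne_zero hl)
  set F := sphereTransform (fun t => eigenvalue l s bc i (R t)) (fun t => (ψ t : ℂ)) P with hFdef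
  have hpt : ∀ w, Tendsto (fun n => zFourier (shell l e ψ (δ n)) P w) atTop (𝓝 (σ * F w)) := by
    intro w
    by_cases hw : w ∈ A
    · have h4 : ‖w.1‖ ^ 2 ∈ baseSet RX := ⟨sq_nonneg _, h3 hw⟩
      have h5 : σ * F w = ψ (radialMap w).1 * hankelKernel l s √(e (radialMap w).1)
          (radialMap w).2 * P w.1 w.2 := by
        rw [hFdef, sphereTransform_eq_hankelKernel hl hP, mul_inv_cancel_left₀ hσ0, ← mul_assoc]
        simp only [radialMap, he, eigenFun, indicator_of_mem h4]
      rw [h5]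
      simp only [zFourier_eq hl hP (hpr _)]
      exact (tendsto_hankelRadial_shell l s e ψ (sq_nonneg _) hδ hlim).mul_const _
    · have h5 : F w = 0 := by
        rw [hFdef, sphereTransform_eq_hankelKernel hl hP, image_eq_zero_of_notMem_tsupport hw]
        simp
      simp only [hz _ w hw, h5, mul_zero]
      exact tendsto_const_nhds
  have hlim1 : Tendsto (fun n => ∫ w, inner ℂ (zFourier (shell l e ψ (δ n)) P w) (h w)
      ∂bundleMeasure m l R') atTop
      (𝓝 (∫ w, inner ℂ (σ * F w) (h w) ∂bundleMeasure m l R')) := by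
    refine tendsto_integral_of_dominated_convergence
      (fun w => A.indicator (fun _ => D * C) w * ‖h w‖) (fun n => ?_) ?_ (fun n => ?_) ?_
    · exact (hmeas n).aestronglyMeasurable.inner (Lp.aestronglyMeasurable h)
    · have h6 : MemLp (A.indicator fun _ => D * C) 2 (bundleMeasure m l R') :=
        memLp_indicator_const 2 hA _ (Or.inr hAfin)
      exact h6.integrable_mul (Lp.memLp h).norm
    · refine Eventually.of_forall fun w => (norm_inner_le_norm _ _).trans ?_
      refine mul_le_mul_of_nonneg_right ?_ (norm_nonneg _)
      by_cases hw : w ∈ A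
      · rw [indicator_of_mem hw]
        exact hbd n w hw
      · rw [indicator_of_notMem hw, hz n w hw, norm_zero]
    · exact Eventually.of_forall fun w => (hpt w).inner tendsto_const_nhds
  have hzero : ∀ n, ∫ w, inner ℂ (zFourier (shell l e ψ (δ n)) P w) (h w)
      ∂bundleMeasure m l R' = 0 := fun n => by
    rw [← horth _ (hpr n) (hmem n), L2.inner_def]
    refine integral_congr_ae ?_
    filter_upwards [(hmem n).coeFn_toLp] with w hw
    rw [hw]
  simp only [hzero] at hlim1
  have h7 := tendsto_nhds_unique hlim1 tendsto_const_nhds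
  have h8 : ∫ w, inner ℂ (σ * F w) (h w) ∂bundleMeasure m l R' =
      (starRingEnd ℂ) σ * inner ℂ (hF.toLp _) h := by
    rw [L2.inner_def, ← integral_const_mul]
    refine integral_congr_ae ?_
    filter_upwards [hF.coeFn_toLp] with w hw
    rw [hw, ← smul_eq_mul σ, inner_smul_left]
  rw [h8] at h7
  exact (mul_eq_zero.1 h7).resolve_left ((map_ne_zero _).2 hσ0)

/-! ### Equality of the closed spans -/

/-- In a Hilbert space the closed span is the double orthogonal complement. -/
theorem closedSpan_le_of_orthogonal {μ : Measure (Euc k × Euc l)} {A B : Set (Euc k × Euc l → ℂ)}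
    (H : ∀ F ∈ A, ∀ (hF : MemLp F 2 μ) (h : Lp ℂ 2 μ),
      (∀ G ∈ B, ∀ hG : MemLp G 2 μ, inner ℂ (hG.toLp G) h = 0) → inner ℂ (hF.toLp F) h = 0) :
    closedSpan μ A ≤ closedSpan μ B := by
  refine Submodule.topologicalClosure_minimal _ (Submodule.span_le.2 ?_)
    (Submodule.isClosed_topologicalClosure _)
  rintro _ ⟨F, hF, hFA, rfl⟩
  rw [closedSpan, ← Submodule.orthogonal_orthogonal_eq_closure]
  refine (Submodule.mem_orthogonal' _ _).2 fun h hh => H F hFA hF h fun G hG hG2 => ?_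
  exact (Submodule.mem_orthogonal _ _).1 hh _ (Submodule.subset_span ⟨G, hG2, hG, rfl⟩)

/-- Both inclusions go through the smooth compactly supported profiles. Orthogonality to these
suffices for every `c(|X|²,|Z|)P`. It holds by assumption on one side, since `𝒜` contains them, and
by the shell approximation on the other. -/
theorem twistedSpan_eq_hankelSpace (hl : 0 < l) {s : ℕ} (hs : 2 ≤ l ∨ s ≤ 1)
    (bc : BoundaryCondition) {RX : ℝ≥0∞} {R : ℝ → ℝ} (hRpos : ∀ t ∈ baseSet RX, 0 < R t)
    (hR : ContinuousOn R (baseSet RX)) {R' : ℝ → ℝ} (hRm : Measurable R')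
    (hR' : ∀ t ∈ baseSet RX, R' t = R t) {Ps : Set (Euc k → Euc l → ℂ)}
    (hPs : ∀ P ∈ Ps, IsHarmonicSymbol s P) (m : Measure (Euc k)) [SFinite m]
    [IsFiniteMeasureOnCompacts m] (hm : ∀ᵐ X ∂m, ‖X‖ₑ < RX) {𝒜 : Set (ℝ → ℂ)}
    (h𝒜m : ∀ φ ∈ 𝒜, Measurable φ)
    (h𝒜 : ∀ φ : ℝ → ℂ, ContDiff ℝ ∞ φ → HasCompactSupport φ →
      tsupport φ ⊆ {t | ENNReal.ofReal t < RX ^ 2} → φ ∈ 𝒜) :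
    twistedSpan s bc R 𝒜 Ps (bundleMeasure m l R') = hankelSpace (bundleMeasure m l R') Ps := by
  have hmem := fun {P} (hP : IsHarmonicSymbol s P) (i : ℕ) (ψ : ℝ → ℝ) (h1 : ContDiff ℝ ∞ ψ)
    (h2 : HasCompactSupport ψ) h3 =>
      memLp_sphereTransform hl hs bc hRpos hR hR' hP m hm i h1.continuous h2 h3
  refine le_antisymm (closedSpan_le_of_orthogonal ?_) (closedSpan_le_of_orthogonal ?_)
  · rintro _ ⟨i, φ, hφ, P, hP, rfl⟩ hF h hh
    have hP' := hPs P hP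
    have hae := sphereTransform_ae_eq hl hs bc hRpos hP' hm R' i φ
    rw [MemLp.toLp_congr hF ((memLp_congr_ae hae).1 hF) hae]
    refine inner_eq_zero_of_orthogonal_smooth hl hs bc hRpos hR hRm hR' hP' m hm (hmem hP')
      (fun j ψ h1 h2 h3 => ?_) (measurable_twistRadial hl hs bc hRpos hR i (h𝒜m φ hφ)) _
    exact inner_sphereTransform_eq_zero hl hs bc hRpos hR hR' hP' m
      (fun χ hχ hχ2 => hh _ ⟨χ, hχ, P, hP, rfl⟩ hχ2) j h1.continuous h2 h3 _
  · rintro _ ⟨φ, hφ, P, hP, rfl⟩ hF h hh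
    have hP' := hPs P hP
    have heq : zFourier φ P = fun w => hankelRadial l s φ (radialMap w) * P w.1 w.2 :=
      funext fun w => zFourier_eq hl hP' hφ w
    rw [MemLp.toLp_congr hF (heq ▸ hF) (Eventually.of_forall fun w => congrFun heq w)]
    refine inner_eq_zero_of_orthogonal_smooth hl hs bc hRpos hR hRm hR' hP' m hm (hmem hP')
      (fun j ψ h1 h2 h3 => ?_) (measurable_hankelRadial l s hφ.1) _
    refine hh _ ⟨j, fun t => (ψ t : ℂ), h𝒜 _ (Complex.ofRealCLM.contDiff.comp h1)
      (h2.comp_left (g := fun x : ℝ => (x : ℂ)) Complex.ofReal_zero) ?_, P, hP, rfl⟩ _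
    refine (closure_mono (Function.support_subset_iff'.2 fun t ht => ?_)).trans h3
    rw [Function.notMem_support.1 ht, Complex.ofReal_zero]

end ZBall
end

/-! ### The domain and the single fibre as instances of `bundleMeasure`. -/

noncomputable section
namespace ZBall
open Filter Topology

variable {k l : ℕ}

theorem measurableSet_enorm_lt (k : ℕ) (RX : ℝ≥0∞) : MeasurableSet {X : Euc k | ‖X‖ₑ < RX} :=
  measurableSet_lt measurable_enorm measurable_const

theorem domainMeasure_eq_bundleMeasure {RX : ℝ≥0∞} {R R' : ℝ → ℝ} (hRm : Measurable R')
    (hR' : ∀ t ∈ baseSet RX, R' t = R t) :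
    domainMeasure k l RX R = bundleMeasure (volume.restrict {X : Euc k | ‖X‖ₑ < RX}) l R' := by
  have h1 : ((volume.restrict {X : Euc k | ‖X‖ₑ < RX}).prod (volume : Measure (Euc l))) =
      (volume : Measure (Euc k × Euc l)).restrict ({X : Euc k | ‖X‖ₑ < RX} ×ˢ univ) := by
    rw [Measure.volume_eq_prod, ← Measure.prod_restrict, Measure.restrict_univ]
  rw [bundleMeasure, h1, Measure.restrict_restrict (measurableSet_bundle hRm), domainMeasure]
  congr 1
  ext w
  refine ⟨fun h => ⟨?_, h.1, mem_univ _⟩, fun h => ⟨h.2.1, ?_⟩⟩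
  · change ‖w.2‖ < R' (‖w.1‖ ^ 2)
    rw [hR' _ (norm_sq_mem_baseSet h.1)]
    exact h.2
  · rw [← hR' _ (norm_sq_mem_baseSet h.2.1)]
    exact h.1

theorem fibreMeasure_eq_bundleMeasure {RX : ℝ≥0∞} {R R' : ℝ → ℝ}
    (hR' : ∀ t ∈ baseSet RX, R' t = R t) {X : Euc k} (hX : ‖X‖ₑ < RX) :
    fibreMeasure l R X = bundleMeasure (Measure.dirac X) l R' := by
  have h1 : ∀ᵐ w ∂(Measure.dirac X).prod (volume : Measure (Euc l)), w.1 = X :=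
    Measure.quasiMeasurePreserving_fst.ae (p := fun Y => Y = X)
      ((ae_dirac_iff (measurableSet_singleton X)).2 rfl)
  have h2 : fibreMeasure l R X = ((Measure.dirac X).prod (volume : Measure (Euc l))).restrict
      (univ ×ˢ Metric.ball (0 : Euc l) (R (‖X‖ ^ 2))) := by
    rw [fibreMeasure, ← Measure.prod_restrict, Measure.restrict_univ]
  rw [h2, bundleMeasure]
  refine Measure.restrict_congr_set ?_
  filter_upwards [h1] with w hw
  have h3 := hR' _ (norm_sq_mem_baseSet hX)
  refine propext ⟨fun h => ?_, fun h => ⟨mem_univ _, ?_⟩⟩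
  · have h4 : ‖w.2‖ < R (‖X‖ ^ 2) := mem_ball_zero_iff.1 h.2
    change ‖w.2‖ < R' (‖w.1‖ ^ 2)
    rwa [hw, h3]
  · have h4 : ‖w.2‖ < R' (‖w.1‖ ^ 2) := h
    rw [hw, h3] at h4
    exact mem_ball_zero_iff.2 h4

/-- The base measure is Lebesgue measure of the X-ball or a Dirac mass. Extending `R` by zero off
`baseSet RX` makes it measurable without changing either measure. -/
theorem twistedSpan_eq_hankelSpace_of_domain_or_fibre (hl : 0 < l) {s : ℕ} (hs : 2 ≤ l ∨ s ≤ 1)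
    (bc : BoundaryCondition) {RX : ℝ≥0∞} {R : ℝ → ℝ} (hRpos : ∀ t ∈ baseSet RX, 0 < R t)
    (hR : ContinuousOn R (baseSet RX)) {Ps : Set (Euc k → Euc l → ℂ)}
    (hPs : ∀ P ∈ Ps, IsHarmonicSymbol s P) {𝒜 : Set (ℝ → ℂ)}
    (h𝒜m : ∀ φ ∈ 𝒜, Measurable φ)
    (h𝒜 : ∀ φ : ℝ → ℂ, ContDiff ℝ ∞ φ → HasCompactSupport φ →
      tsupport φ ⊆ {t | ENNReal.ofReal t < RX ^ 2} → φ ∈ 𝒜) {μ : Measure (Euc k × Euc l)}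
    (hμ : μ = domainMeasure k l RX R ∨ ∃ X : Euc k, ‖X‖ₑ < RX ∧ μ = fibreMeasure l R X) :
    twistedSpan s bc R 𝒜 Ps μ = hankelSpace μ Ps := by
  have hRm := measurable_indicator_baseSet hR
  have hR' : ∀ t ∈ baseSet RX, (baseSet RX).indicator R t = R t := fun t ht =>
    indicator_of_mem ht R
  rcases hμ with rfl | ⟨X, hX, rfl⟩
  · rw [domainMeasure_eq_bundleMeasure hRm hR']
    exact twistedSpan_eq_hankelSpace hl hs bc hRpos hR hRm hR' hPs (volume.restrict {X : Euc k | ‖X‖ₑ < RX})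
      (ae_restrict_mem (measurableSet_enorm_lt k RX)) h𝒜m h𝒜
  · rw [fibreMeasure_eq_bundleMeasure hR' hX]
    exact twistedSpan_eq_hankelSpace hl hs bc hRpos hR hRm hR' hPs (Measure.dirac X)
      ((ae_dirac_iff (measurableSet_enorm_lt k RX)).2 hX) h𝒜m h𝒜

end ZBall
end

theorem mainTheorem6 {k l m : ℕ} (hk : 0 < k) (hl : 0 < l)
    (S : ZBall.HTypeStructure k l) (B : Fin m → ZBall.Euc k)
    (n s : ℕ) (hs : 2 ≤ l ∨ s ≤ 1)
    (RX : ℝ≥0∞) (hRX : 0 < RX) (R : ℝ → ℝ)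
    (hRpos : ∀ t ∈ ZBall.baseSet RX, 0 < R t)
    (hRsmooth : ContDiffOn ℝ ∞ R (ZBall.baseSet RX))
    (bc : ZBall.BoundaryCondition) :
    -- the eigenvalue functions exist and are smooth
    (∀ i : ℕ,
      (∀ t ∈ ZBall.baseSet RX,
        ZBall.IsNthEigenvalue l s bc i (R t) (ZBall.eigenvalue l s bc i (R t))) ∧
      ContDiffOn ℝ ∞ (fun t => ZBall.eigenvalue l s bc i (R t)) (ZBall.baseSet RX)) ∧
    -- the twisted functions satisfy it over the X-ball; if it is the Dirichlet condition and `φ`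
    -- vanishes over the X-sphere, then they vanish on the whole boundary of the domain
    (∀ (i : ℕ) (φ : ℝ → ℂ), ∀ P ∈ ZBall.phiSymbols S n s B ∪ ZBall.xiSymbols S n s B,
      (∀ X : ZBall.Euc k, ‖X‖ₑ < RX →
        bc.HoldsOn (R (‖X‖ ^ 2)) fun Z : ZBall.Euc l =>
          ZBall.sphereTransform (fun t => ZBall.eigenvalue l s bc i (R t)) φ P (X, Z)) ∧
      (bc.b = 0 →
        (∀ X : ZBall.Euc k, ‖X‖ₑ = RX → φ (‖X‖ ^ 2) = 0) →
        ∀ w ∈ frontier (ZBall.domain k l RX R),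
          ZBall.sphereTransform (fun t => ZBall.eigenvalue l s bc i (R t)) φ P w = 0)) ∧
    -- they span the spaces over the domain, and over every point of the X-ball
    (∀ 𝒜 : Set (ℝ → ℂ), (∀ φ ∈ 𝒜, Measurable φ) →
      (∀ φ : ℝ → ℂ, ContDiff ℝ ∞ φ → HasCompactSupport φ →
        tsupport φ ⊆ {t | ENNReal.ofReal t < RX ^ 2} → φ ∈ 𝒜) →
      ∀ μ : Measure (ZBall.Euc k × ZBall.Euc l),
        (μ = ZBall.domainMeasure k l RX R ∨
          ∃ X : ZBall.Euc k, ‖X‖ₑ < RX ∧ μ = ZBall.fibreMeasure l R X) →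
        ZBall.twistedSpan s bc R 𝒜 (ZBall.phiSymbols S n s B) μ = ZBall.PhiSpace S n s B μ ∧
        ZBall.twistedSpan s bc R 𝒜 (ZBall.xiSymbols S n s B) μ = ZBall.XiSpace S n s B μ) := by
  have hRc := hRsmooth.continuousOn
  refine ⟨fun i => ⟨fun t ht => ZBall.isNthEigenvalue_eigenvalue hl hs bc (hRpos t ht) i,
    (ZBall.contDiffOn_eigenvalue hl hs bc i).comp hRsmooth hRpos⟩,
    fun i φ P hP => ?_, fun 𝒜 h𝒜m h𝒜 μ hμ => ?_⟩
  · have hP' := ZBall.isHarmonicSymbol_of_mem hk hl S hP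
    refine ⟨fun X hX => ?_, fun hb hφ w hw => ?_⟩
    · exact ZBall.holdsOn_sphereTransform hl hs hP' bc i φ
        (hRpos _ (ZBall.norm_sq_mem_baseSet hX))
    · exact ZBall.sphereTransform_eq_zero_of_mem_frontier hl hs hP' bc hRpos hRc i hb hφ hw
  · exact ⟨ZBall.twistedSpan_eq_hankelSpace_of_domain_or_fibre hl hs bc hRpos hRc
      (fun P hP => ZBall.isHarmonicSymbol_of_mem hk hl S (Or.inl hP)) h𝒜m h𝒜 hμ,
      ZBall.twistedSpan_eq_hankelSpace_of_domain_or_fibre hl hs bc hRpos hRc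
      (fun P hP => ZBall.isHarmonicSymbol_of_mem hk hl S (Or.inr hP)) h𝒜m h𝒜 hμ⟩
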